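/- **Setting.** Let $E=(E^0,E^1,s,r)$ be a finite directed graph without sinks and without sources, $A=c(E^0)$ the functions on $E^0$, and $E^k$ the set of paths $\alpha=e_1\cdots e_k$ of length $|\alpha|=k$ ($s(e_j)=r(e_{j+1})$, $s(\alpha)=s(e_k)$, $r(\alpha)=r(e_1)$; $E^0$ is the set of paths of length $0$). Let $X_E^{\otimes k}$ be the space of functions on $E^k$ (with basis $\{\delta_\alpha\}$), a $C^*$-correspondence over $A$ with $(a\xi b)(\alpha)=a(r(\alpha))\xi(\alpha)b(s(\alpha))$ and $\langle\xi,\eta\rangle(v)=\sum_{s(\alpha)=v}\overline{\xi(\alpha)}\eta(\alpha)$, so that $\delta_\alpha\otimes\delta_\beta=\delta_{\alpha\beta}$ if $s(\alpha)=r(\beta)$, and $0$ otherwise. Let $\mathcal F=\bigoplus_{k\ge 0}X_E^{\otimes k}$ be the Fock correspondence, $Q_k$ the projection onto the $k$-th summand, $\mathcal L$ the algebra of adjointable operators on $\mathcal F$, $\mathcal K$ the ideal of compact operators (the closed span of the operators $\theta_{\xi,\eta}\zeta=\xi\langle\eta,\zeta\rangle$) and $q:\mathcal L\to\mathcal L/\mathcal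 K$ the quotient map. For $e\in E^1$ put $S_e\xi=\delta_e\otimes\xi$, and let $P_v$ be the left action of $\delta_v$ on $\mathcal F$. Let $Z=(Z_k)_{k\ge 0}$ be a weight sequence: $Z_k\in\mathcal L(X_E^{\otimes k})$ commutes with the left action of $A$, $Z_0=I$, $\sup_k\|Z_k\|<\infty$, each $Z_k$ is positive and invertible, and there is $\varepsilon>0$ with $Z_k\ge\varepsilon I$ for all $k\ge1$. Write also $Z=\mathrm{diag}(Z_0,Z_1,\dots)\in\mathcal L$. Let $p\ge 1$ and assume Condition A($p$): $\lim_{k\to\infty}\|I_p\otimes Z_k-Z_{k+p}\|=0$, where $I_p$ is the identity of $X_E^{\otimes p}$. Let $\mathcal T$ be the $C^*$-algebra generated by $\{ZS_e:e\in E^1\}$, let $\gamma_t=\mathrm{Ad}\big(\sum_n e^{int}Q_n\big)$, and put $$\mathcal D=\{X\in\mathcal T:\gamma_t(X)=X\ \forall t\in\mathbb R\},\qquad F=\{X\in\mathcal T:\gamma_t(X)=e^{it}X\ \forall t\in\mathbb R\}.$$ Write $z=q(Z)$, $u_e=q(S_e)$, $u_\alpha=u_{e_1}\cdots u_{e_k}$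 for a path $\alpha=e_1\cdots e_k$ with $k\ge1$, and $u_v=q(P_v)$ for a path $v\in E^0$ of length $0$. For $n\ge0$ let $\mathcal C_n$ be the $C^*$-algebra generated by all $u_\alpha z^l u_\beta^*$ with $l\ge0$, $np\le|\alpha|=|\beta|<(n+1)p$ and $s(\alpha)=s(\beta)$. For every $v\in E^0$ fix a path $\xi_v$ of length $p-1$ with $s(\xi_v)=v$. Let $J$ be a closed two-sided ideal of $q(\mathcal D)$ and $J_n=J\cap\mathcal C_n$. For $n\ge0$ and $v\in E^0$ let $$J_{n,v}=u_{\xi_v}u_{\mu_1}^*J_nu_{\mu_2}u_{\xi_v}^*,\qquad |\mu_1|=|\mu_2|=np+p-1,\quad s(\mu_1)=s(\mu_2)=v$$ (this set does not depend on the choice of $\mu_1,\mu_2$). The ideal $J$ is called fully invariant if $\overline{\mathrm{span}}\{\eta^*a\xi: a\in J,\ \xi,\eta\in q(F)\}\subseteq J$ and every $a\in q(\mathcal D)$ with $\eta^*a\xi\in J$ for all $\xi,\eta\in q(F)$ lies in $J$. **Theorem.** (A) $J$ is fully invariant if and only if the following three conditions hold: 1. $J_{0,v}=J_{n,v}$ for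 all $v\in E^0$ and $n\ge0$; 2. $u_{\alpha}^*J_0u_{\beta}\subseteq J_0$ for all paths $\alpha,\beta$ with $|\alpha|=|\beta|=p-1$; 3. $u_\alpha J_0u_\beta^*\subseteq J$ for all paths $\alpha,\beta$ with $|\alpha|=|\beta|$. (B) $J$ is fully invariant if and only if the following two conditions hold: 1. $J_{0,v}=J_{n,v}$ for all $v\in E^0$ and $n\ge0$; 2. $u_e^*J_0u_f\subseteq J_0$ for all $e,f\in E^1$. -/

import Mathlib

open scoped ComplexConjugate InnerProductSpace

noncomputable section

/-- A directed graph with vertex set `V`, edge set `Ed`, source map `s` and range map `r`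
(multiple edges and loops are allowed). -/
structure DirGraph (V Ed : Type*) where
  /-- the source map -/
  s : Ed → V
  /-- the range map -/
  r : Ed → V

namespace DirGraph

variable {V Ed : Type*}

/-- No sinks: every vertex is the source of an edge. -/
def NoSinks (G : DirGraph V Ed) : Prop := ∀ v, ∃ e, G.s e = v

/-- No sources: every vertex is the range of an edge. -/
def NoSources (G : DirGraph V Ed) : Prop := ∀ v, ∃ e, G.r e = v

/-- The range of the word `e₁ e₂ ⋯ eₖ` starting at `v`: it is `r e₁`, or `v` for the empty word. -/
def wordRange (G : DirGraph V Ed) (v : V) : List Ed → V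
  | [] => v
  | e :: _ => G.r e

/-- The word `e₁ e₂ ⋯ eₖ` is a path with source `v`: `s eⱼ = r eⱼ₊₁` for `j < k` and `s eₖ = v`. -/
def IsPathWord (G : DirGraph V Ed) (v : V) : List Ed → Prop
  | [] => True
  | e :: l => G.s e = G.wordRange v l ∧ G.IsPathWord v l

/-- The set `E^k` of paths of length `k`; paths of length `0` are the vertices. -/
@[ext]
structure Path (G : DirGraph V Ed) (k : ℕ) where
  /-- the source `s(α)` -/
  source : V
  /-- the edges of `α = e₁ e₂ ⋯ eₖ` -/
  edges : List Ed
  length_eq : edges.length = k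
  isPath : G.IsPathWord source edges

namespace Path

variable {G : DirGraph V Ed} {k : ℕ}

/-- The range `r(α)`. -/
def range (α : G.Path k) : V := G.wordRange α.source α.edges

/-- The path `e₂ ⋯ eₖ₊₁` obtained from `e₁ e₂ ⋯ eₖ₊₁`. -/
def tail (α : G.Path (k + 1)) : G.Path k where
  source := α.source
  edges := α.edges.tail
  length_eq := by simp [α.length_eq]
  isPath := by
    have h := α.isPath
    cases hl : α.edges with
    | nil => trivial
    | cons e l => rw [hl] at h; exact h.2

instance instFinite [Finite V] [Finite Ed] : Finite (G.Path k) := by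
  let f : G.Path k → V × List.Vector Ed k := fun α => (α.source, ⟨α.edges, α.length_eq⟩)
  refine Finite.of_injective f fun α β h => ?_
  have h2 : α.edges = β.edges := congrArg (fun x => x.2.1) h
  exact Path.ext (congrArg Prod.fst h) h2

instance instFintype [Finite V] [Finite Ed] : Fintype (G.Path k) := Fintype.ofFinite _

end Path

variable [Fintype V] [Fintype Ed] (G : DirGraph V Ed)

/-! ### The correspondences `X_E^{⊗k} = X_{E^k}` over `A = c(E^0)` -/

/-- The space `X_{E^k}` of all functions on `E^k`.  Its underlying vector space carries the
`ℓ²`-norm; the `A`-valued inner product is `Xk.innerA`.  For operators commuting with the right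
action of `A` the operator norm for the `ℓ²`-norm is the operator norm for the module norm. -/
abbrev Xk (k : ℕ) : Type _ := EuclideanSpace ℂ (G.Path k)

variable {G}

/-- Multiplication of a function on `E^k` by a fixed function on `E^k`. -/
def Xk.mulOp {k : ℕ} (f : G.Path k → ℂ) : G.Xk k →L[ℂ] G.Xk k :=
  LinearMap.toContinuousLinearMap
    { toFun := fun ξ => WithLp.toLp 2 fun α => f α * ξ α
      map_add' := fun x y => by ext α; simp [mul_add]
      map_smul' := fun c x => by ext α; simp [mul_left_comm] }

variable (G) in
/-- The left action `(φ(a) ξ)(α) = a(r(α)) ξ(α)`. -/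
def Xk.leftAct (k : ℕ) (a : V → ℂ) : G.Xk k →L[ℂ] G.Xk k := Xk.mulOp fun α => a α.range

variable (G) in
/-- The right action `(ξ a)(α) = ξ(α) a(s(α))`. -/
def Xk.rightAct (k : ℕ) (a : V → ℂ) : G.Xk k →L[ℂ] G.Xk k := Xk.mulOp fun α => a α.source

open Classical in
/-- The `A`-valued inner product `⟨ξ, η⟩(v) = ∑_{s(α) = v} conj (ξ(α)) η(α)`. -/
def Xk.innerA {k : ℕ} (ξ η : G.Xk k) (v : V) : ℂ :=
  ∑ α : G.Path k, if α.source = v then conj (ξ α) * η α else 0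

/-- `T` is adjointable for the `A`-valued inner product, that is, `T ∈ 𝓛(X_E^{⊗k})`. -/
def Xk.IsAdjointable {k : ℕ} (T : G.Xk k →L[ℂ] G.Xk k) : Prop :=
  ∃ T' : G.Xk k →L[ℂ] G.Xk k, ∀ ξ η v, Xk.innerA (T ξ) η v = Xk.innerA ξ (T' η) v

open Classical in
/-- The map `ξ ↦ δ_e ⊗ ξ` from `X_E^{⊗k}` to `X_E^{⊗(k+1)}`: it sends `δ_γ` to `δ_{eγ}` if
`s(e) = r(γ)` and to `0` otherwise. -/
def Xk.create (e : Ed) (k : ℕ) : G.Xk k →L[ℂ] G.Xk (k + 1) :=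
  LinearMap.toContinuousLinearMap
    { toFun := fun ξ => WithLp.toLp 2 fun β => if β.edges.head? = some e then ξ β.tail else 0
      map_add' := fun x y => by ext β; by_cases h : β.edges.head? = some e <;> simp [h]
      map_smul' := fun c x => by ext β; by_cases h : β.edges.head? = some e <;> simp [h] }

/-- The operator `I_1 ⊗ T`, `δ_e ⊗ ξ ↦ δ_e ⊗ T ξ`, on `X_E^{⊗(k+1)}`, for `T` on `X_E^{⊗k}`
commuting with the left action; the adjoint of `Xk.create e k` sends `δ_{eγ}` to `δ_γ` and
`δ_{fγ}` to `0` for `f ≠ e`. -/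
def Xk.oneTensor {k : ℕ} (T : G.Xk k →L[ℂ] G.Xk k) : G.Xk (k + 1) →L[ℂ] G.Xk (k + 1) :=
  ∑ e : Ed, Xk.create e k ∘L T ∘L ContinuousLinearMap.adjoint (Xk.create e k)

/-- The operator `I_p ⊗ T` on `X_E^{⊗(k+p)} = X_E^{⊗p} ⊗ X_E^{⊗k}`, through
`I_{p+1} ⊗ T = I_1 ⊗ (I_p ⊗ T)`. -/
def Xk.idTensor {k : ℕ} (T : G.Xk k →L[ℂ] G.Xk k) :
    (p : ℕ) → (G.Xk (k + p) →L[ℂ] G.Xk (k + p))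
  | 0 => T
  | p + 1 => Xk.oneTensor (Xk.idTensor T p)

variable (G) in
/-- A weight sequence `Z = (Z_k)`: adjointable operators commuting with the left action, `Z_0 = I`,
`sup ‖Z_k‖ < ∞`, each `Z_k` is positive and invertible, and `Z_k ≥ ε I` for all `k ≥ 1`. -/
structure WeightSequence where
  /-- the operators `Z_k` -/
  op : (k : ℕ) → (G.Xk k →L[ℂ] G.Xk k)
  adjointable : ∀ k, Xk.IsAdjointable (op k)
  comm_left : ∀ k a, op k ∘L Xk.leftAct G k a = Xk.leftAct G k a ∘L op k
  op_zero : op 0 = ContinuousLinearMap.id ℂ _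
  bounded : ∃ M : ℝ, ∀ k, ‖op k‖ ≤ M
  positive : ∀ k, (op k).IsPositive
  invertible : ∀ k, IsUnit (op k)
  lower_bound : ∃ ε : ℝ, 0 < ε ∧ ∀ k, 1 ≤ k →
    (op k - (ε : ℂ) • ContinuousLinearMap.id ℂ (G.Xk k)).IsPositive

/-- Condition A(p): `‖I_p ⊗ Z_k - Z_{k+p}‖ → 0`. -/
def WeightSequence.ConditionA (Z : G.WeightSequence) (p : ℕ) : Prop :=
  Filter.Tendsto (fun k => ‖Xk.idTensor (Z.op k) p - Z.op (k + p)‖) Filter.atTop (nhds 0)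

/-! ### The Fock correspondence -/

variable (G) in
/-- The Fock correspondence `⨁_k X_E^{⊗k}`.  As `A = c(E^0)` is finite dimensional, its underlying
vector space is the Hilbert direct sum of the `X_E^{⊗k}`, with an equivalent norm. -/
abbrev Fock : Type _ := lp (fun k : ℕ => G.Xk k) 2

namespace Fock

/-- The `A`-valued inner product of the Fock correspondence. -/
def innerA (ξ η : G.Fock) (v : V) : ℂ := ∑' k, Xk.innerA (ξ k) (η k) v

lemma memℓp_of_le {ξ : G.Fock} {f : ∀ k, G.Xk k} {M : ℝ} (hM : ∀ k, ‖f k‖ ≤ M * ‖ξ k‖) :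
    Memℓp f 2 := by
  have h2 : (0 : ℝ) < (2 : ENNReal).toReal := by norm_num
  have hs := (lp.memℓp ξ).summable h2
  refine memℓp_gen ((hs.mul_left (M ^ 2)).of_nonneg_of_le (fun k => by positivity) fun k => ?_)
  have h0 : 0 ≤ M * ‖ξ k‖ := (norm_nonneg _).trans (hM k)
  simp only [ENNReal.toReal_ofNat, Real.rpow_ofNat]
  rw [← mul_pow]
  exact pow_le_pow_left₀ (norm_nonneg _) (hM k) 2

lemma norm_sq (ξ : G.Fock) : ‖ξ‖ ^ 2 = ∑' k, ‖ξ k‖ ^ 2 := by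
  have := lp.norm_rpow_eq_tsum (p := 2) (by norm_num) ξ
  simpa using this

lemma summable_sq (ξ : G.Fock) : Summable fun k => ‖ξ k‖ ^ 2 := by
  have := (lp.memℓp ξ).summable (p := 2) (by norm_num)
  simpa using this

/-- The diagonal operator `diag(T_0, T_1, …)` for a bounded sequence `T_k` on `X_E^{⊗k}`. -/
def diag (T : (k : ℕ) → (G.Xk k →L[ℂ] G.Xk k)) (hT : ∃ M : ℝ, ∀ k, ‖T k‖ ≤ M) :
    G.Fock →L[ℂ] G.Fock :=
  LinearMap.mkContinuousOfExistsBound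
    { toFun := fun ξ => ⟨fun k => T k (ξ k), by
        obtain ⟨M, hM⟩ := hT
        exact memℓp_of_le (ξ := ξ) (M := M) fun k => (T k).le_of_opNorm_le (hM k) _⟩
      map_add' := fun x y => by ext k : 2; exact map_add (T k) _ _
      map_smul' := fun c x => by ext k : 2; exact map_smul (T k) c _ }
    (by
      obtain ⟨M, hM⟩ := hT
      have hM0 : 0 ≤ M := (norm_nonneg _).trans (hM 0)
      refine ⟨M, fun ξ => ?_⟩
      rw [← pow_le_pow_iff_left₀ (norm_nonneg _) (by positivity) two_ne_zero, mul_pow, norm_sq,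
        norm_sq, ← tsum_mul_left]
      refine Summable.tsum_le_tsum (fun k => ?_) (summable_sq _) ((summable_sq ξ).mul_left _)
      rw [← mul_pow]
      exact pow_le_pow_left₀ (norm_nonneg _) ((T k).le_of_opNorm_le (hM k) _) 2)

@[simp]
lemma diag_apply (T : (k : ℕ) → (G.Xk k →L[ℂ] G.Xk k)) (hT) (ξ : G.Fock) (k : ℕ) :
    diag T hT ξ k = T k (ξ k) := rfl

end Fock

lemma Xk.norm_mulOp_le {k : ℕ} (f : G.Path k → ℂ) (M : ℝ) (hM0 : 0 ≤ M) (hM : ∀ α, ‖f α‖ ≤ M) :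
    ‖Xk.mulOp f‖ ≤ M := by
  refine ContinuousLinearMap.opNorm_le_bound _ hM0 fun ξ => ?_
  rw [← pow_le_pow_iff_left₀ (norm_nonneg _) (by positivity) two_ne_zero, mul_pow,
    EuclideanSpace.norm_sq_eq, EuclideanSpace.norm_sq_eq, Finset.mul_sum]
  refine Finset.sum_le_sum fun α _ => ?_
  have : Xk.mulOp f ξ α = f α * ξ α := rfl
  rw [this, norm_mul, mul_pow]
  gcongr
  exact hM α

lemma Xk.norm_create_le (e : Ed) (k : ℕ) : ‖(Xk.create e k : G.Xk k →L[ℂ] G.Xk (k + 1))‖ ≤ 1 := by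
  classical
  refine ContinuousLinearMap.opNorm_le_bound _ zero_le_one fun ξ => ?_
  rw [one_mul, ← pow_le_pow_iff_left₀ (norm_nonneg _) (norm_nonneg _) two_ne_zero,
    EuclideanSpace.norm_sq_eq, EuclideanSpace.norm_sq_eq]
  have h1 : ∀ β : G.Path (k + 1), ‖Xk.create e k ξ β‖ ^ 2 =
      if β.edges.head? = some e then ‖ξ β.tail‖ ^ 2 else 0 := fun β => by
    have : Xk.create e k ξ β = if β.edges.head? = some e then ξ β.tail else 0 := rfl
    rw [this]
    split_ifs <;> simp
  rw [Finset.sum_congr rfl fun β _ => h1 β, ← Finset.sum_filter]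
  have hinj : Set.InjOn (Path.tail : G.Path (k + 1) → G.Path k)
      (Finset.univ.filter fun β : G.Path (k + 1) => β.edges.head? = some e) := by
    intro β hβ β' hβ' h
    simp only [Finset.coe_filter, Finset.mem_univ, true_and, Set.mem_ofPred_eq] at hβ hβ'
    have hs : β.tail.source = β'.tail.source := congrArg (fun γ : G.Path k => γ.source) h
    have ht : β.tail.edges = β'.tail.edges := congrArg (fun γ : G.Path k => γ.edges) h
    change β.edges.tail = β'.edges.tail at ht
    refine Path.ext hs ?_
    rw [List.eq_cons_of_mem_head? hβ, List.eq_cons_of_mem_head? hβ', ht]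
  rw [← Finset.sum_image (f := fun γ => ‖ξ γ‖ ^ 2) hinj]
  exact Finset.sum_le_sum_of_subset_of_nonneg (Finset.subset_univ _) fun _ _ _ => by positivity

namespace Fock

variable (G) in
/-- The right action of `A` on the Fock correspondence. -/
def rightAct (a : V → ℂ) : G.Fock →L[ℂ] G.Fock :=
  diag (fun k => Xk.rightAct G k a)
    ⟨‖a‖, fun _ => Xk.norm_mulOp_le _ _ (norm_nonneg _) fun _ => norm_le_pi_norm a _⟩

variable (G) in
/-- The left action `φ_∞` of `A` on the Fock correspondence. -/
def leftAct (a : V → ℂ) : G.Fock →L[ℂ] G.Fock :=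
  diag (fun k => Xk.leftAct G k a)
    ⟨‖a‖, fun _ => Xk.norm_mulOp_le _ _ (norm_nonneg _) fun _ => norm_le_pi_norm a _⟩

/-- The components of `S_e ξ`. -/
def shiftFun (e : Ed) (ξ : G.Fock) : (k : ℕ) → G.Xk k
  | 0 => 0
  | k + 1 => Xk.create e k (ξ k)

lemma norm_create_sq_le (e : Ed) (ξ : G.Fock) (k : ℕ) :
    ‖Xk.create e k (ξ k)‖ ^ 2 ≤ ‖ξ k‖ ^ 2 := by
  have h := (Xk.create (G := G) e k).le_of_opNorm_le (Xk.norm_create_le e k) (ξ k)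
  rw [one_mul] at h
  exact pow_le_pow_left₀ (norm_nonneg _) h 2

/-- The creation operator `S_e`: `S_e δ_γ = δ_{eγ}` if `s(e) = r(γ)`, and `0` otherwise. -/
def shift (e : Ed) : G.Fock →L[ℂ] G.Fock :=
  LinearMap.mkContinuous
    { toFun := fun ξ => ⟨shiftFun e ξ, by
        refine memℓp_gen ?_
        simp only [ENNReal.toReal_ofNat, Real.rpow_ofNat]
        rw [← summable_nat_add_iff 1]
        exact (summable_sq ξ).of_nonneg_of_le (fun k => by positivity)
          fun k => norm_create_sq_le e ξ k⟩
      map_add' := fun x y => by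
        ext k : 2
        cases k with
        | zero => exact (add_zero (0 : G.Xk 0)).symm
        | succ k => exact map_add (Xk.create e k) _ _
      map_smul' := fun c x => by
        ext k : 2
        cases k with
        | zero => exact (smul_zero c : c • (0 : G.Xk 0) = 0).symm
        | succ k => exact map_smul (Xk.create e k) c _ }
    1
    (fun ξ => by
      rw [one_mul, ← pow_le_pow_iff_left₀ (norm_nonneg _) (norm_nonneg _) two_ne_zero, norm_sq,
        norm_sq, (summable_sq _).tsum_eq_zero_add]
      have h0 : ‖shiftFun e ξ 0‖ ^ 2 = 0 := by simp [shiftFun]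
      refine (add_le_of_nonpos_left (le_of_eq h0)).trans ?_
      exact Summable.tsum_le_tsum (norm_create_sq_le e ξ)
        ((summable_nat_add_iff 1).2 (summable_sq _)) (summable_sq ξ))

/-- The unitary `W_t = ∑_n e^{int} Q_n`. -/
def gaugeUnitary (t : ℝ) : G.Fock →L[ℂ] G.Fock :=
  diag (fun k => Complex.exp (Complex.I * k * t) • ContinuousLinearMap.id ℂ (G.Xk k))
    ⟨1, fun k => by
      rw [norm_smul, show Complex.I * k * t = ((k * t : ℝ) : ℂ) * Complex.I by push_cast; ring,
        Complex.norm_exp_ofReal_mul_I, one_mul]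
      exact ContinuousLinearMap.norm_id_le⟩

/-- The weight operator `Z = diag(Z_0, Z_1, …)`. -/
def weightOp (Z : G.WeightSequence) : G.Fock →L[ℂ] G.Fock := diag Z.op Z.bounded

open Classical in
/-- The function `δ_v ∈ A = c(E^0)`. -/
def delta (v : V) : V → ℂ := fun w => if w = v then 1 else 0

lemma _root_.DirGraph.Xk.innerA_eq {k : ℕ} (ξ η : G.Xk k) (v : V) :
    Xk.innerA ξ η v = ⟪ξ, Xk.rightAct G k (delta v) η⟫_ℂ := by
  classical
  rw [PiLp.inner_apply]
  refine Finset.sum_congr rfl fun α _ => ?_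
  have : Xk.rightAct G k (delta v) η α = delta v α.source * η α := rfl
  rw [this]
  by_cases h : α.source = v <;> simp [h, delta, mul_comm]

lemma innerA_eq (ξ η : G.Fock) (v : V) : innerA ξ η v = ⟪ξ, rightAct G (delta v) η⟫_ℂ := by
  rw [lp.inner_eq_tsum]
  exact tsum_congr fun k => Xk.innerA_eq _ _ _

lemma _root_.DirGraph.Xk.inner_rightAct {k : ℕ} (ξ η : G.Xk k) (v : V) :
    ⟪Xk.rightAct G k (delta v) ξ, η⟫_ℂ = ⟪ξ, Xk.rightAct G k (delta v) η⟫_ℂ := by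
  classical
  rw [PiLp.inner_apply, PiLp.inner_apply]
  refine Finset.sum_congr rfl fun α _ => ?_
  have h1 : ∀ ζ, Xk.rightAct G k (delta v) ζ α = delta v α.source * ζ α := fun _ => rfl
  rw [h1, h1]
  by_cases h : α.source = v <;> simp [h, delta]

lemma inner_rightAct (ξ η : G.Fock) (v : V) :
    ⟪rightAct G (delta v) ξ, η⟫_ℂ = ⟪ξ, rightAct G (delta v) η⟫_ℂ := by
  rw [lp.inner_eq_tsum, lp.inner_eq_tsum]
  exact tsum_congr fun k => Xk.inner_rightAct _ _ _

lemma rightAct_eq_sum (a : V → ℂ) (ξ : G.Fock) :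
    rightAct G a ξ = ∑ v, a v • rightAct G (delta v) ξ := by
  classical
  ext k α
  have h1 : ∀ b : V → ℂ, (rightAct G b ξ) k α = b α.source * ξ k α := fun _ => rfl
  have h2 : (∑ v, a v • rightAct G (delta v) ξ) k α =
      ∑ v, a v * (rightAct G (delta v) ξ k α) := by
    rw [lp.coeFn_sum, Finset.sum_apply, WithLp.ofLp_sum, Finset.sum_apply]
    rfl
  rw [h2, h1]
  simp only [h1, delta]
  simp

lemma sum_rightAct (ξ : G.Fock) : ∑ v, rightAct G (delta v) ξ = ξ := by
  have h := rightAct_eq_sum (fun _ => 1) ξ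
  simp only [one_smul] at h
  rw [← h]
  ext k α
  exact one_mul _

/-- `T` is adjointable for the `A`-valued inner product of the Fock correspondence. -/
def IsAdjointable (T : G.Fock →L[ℂ] G.Fock) : Prop :=
  ∃ T' : G.Fock →L[ℂ] G.Fock, ∀ ξ η v, innerA (T ξ) η v = innerA ξ (T' η) v

lemma isAdjointable_iff (T : G.Fock →L[ℂ] G.Fock) :
    IsAdjointable T ↔ ∀ v ξ, T (rightAct G (delta v) ξ) = rightAct G (delta v) (T ξ) := by
  constructor
  · rintro ⟨T', h⟩
    simp only [innerA_eq] at h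
    have hT' : T' = ContinuousLinearMap.adjoint T := by
      rw [ContinuousLinearMap.eq_adjoint_iff]
      intro x y
      rw [← inner_conj_symm, ← inner_conj_symm x]
      congr 1
      conv_rhs => rw [← sum_rightAct x]
      conv_lhs => rw [← sum_rightAct (T' x)]
      rw [inner_sum, inner_sum]
      exact Finset.sum_congr rfl fun v _ => (h y x v).symm
    subst hT'
    intro v ξ
    refine ext_inner_right ℂ fun η => ?_
    rw [← ContinuousLinearMap.adjoint_inner_right, inner_rightAct, inner_rightAct, h]
  · intro h
    refine ⟨ContinuousLinearMap.adjoint T, fun ξ η v => ?_⟩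
    rw [innerA_eq, innerA_eq, ← inner_rightAct, ← inner_rightAct, ← h,
      ContinuousLinearMap.adjoint_inner_right]

lemma _root_.DirGraph.Xk.IsAdjointable.comm {k : ℕ} {T : G.Xk k →L[ℂ] G.Xk k}
    (hT : Xk.IsAdjointable T) (v : V) (ξ : G.Xk k) :
    T (Xk.rightAct G k (delta v) ξ) = Xk.rightAct G k (delta v) (T ξ) := by
  classical
  obtain ⟨T', h⟩ := hT
  have hsum : ∀ x : G.Xk k, ∑ v, Xk.rightAct G k (delta v) x = x := fun x => by
    ext α
    rw [WithLp.ofLp_sum, Finset.sum_apply]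
    have h1 : ∀ v, Xk.rightAct G k (delta v) x α = delta v α.source * x α := fun _ => rfl
    simp only [h1, delta]
    simp
  simp only [Xk.innerA_eq] at h
  have hT' : T' = ContinuousLinearMap.adjoint T := by
    rw [ContinuousLinearMap.eq_adjoint_iff]
    intro x y
    rw [← inner_conj_symm, ← inner_conj_symm x]
    congr 1
    conv_rhs => rw [← hsum x]
    conv_lhs => rw [← hsum (T' x)]
    rw [inner_sum, inner_sum]
    exact Finset.sum_congr rfl fun v _ => (h y x v).symm
  subst hT'
  refine ext_inner_right ℂ fun η => ?_
  rw [← ContinuousLinearMap.adjoint_inner_right, Xk.inner_rightAct, Xk.inner_rightAct, h]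

lemma isAdjointable_diag (T : (k : ℕ) → (G.Xk k →L[ℂ] G.Xk k)) (hT)
    (h : ∀ k v ξ, T k (Xk.rightAct G k (delta v) ξ) = Xk.rightAct G k (delta v) (T k ξ)) :
    IsAdjointable (diag T hT) :=
  (isAdjointable_iff _).2 fun v ξ => by ext k : 2; exact h k v (ξ k)

lemma isAdjointable_leftAct (a : V → ℂ) : IsAdjointable (leftAct G a) :=
  isAdjointable_diag _ _ fun _ _ _ => by ext α; exact mul_left_comm _ _ _

lemma isAdjointable_gaugeUnitary (t : ℝ) : IsAdjointable (gaugeUnitary t : G.Fock →L[ℂ] G.Fock) :=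
  isAdjointable_diag _ _ fun k v ξ => (map_smul (Xk.rightAct G k (delta v)) _ ξ).symm

lemma isAdjointable_weightOp (Z : G.WeightSequence) : IsAdjointable (weightOp Z) :=
  isAdjointable_diag _ _ fun k => (Z.adjointable k).comm

lemma isAdjointable_shift (e : Ed) : IsAdjointable (shift e : G.Fock →L[ℂ] G.Fock) := by
  classical
  refine (isAdjointable_iff _).2 fun v ξ => ?_
  ext k : 2
  cases k with
  | zero => exact (map_zero (Xk.rightAct G 0 (delta v))).symm
  | succ k =>
    ext β
    change (if β.edges.head? = some e then delta v β.source * ξ k β.tail else 0) =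
      delta v β.source * (if β.edges.head? = some e then ξ k β.tail else 0)
    split_ifs <;> simp

end Fock

/-! ### The algebra `𝓛(𝓕(X_E))`, the compact operators, and the quotient -/

variable (G) in
/-- The algebra `𝓛 = 𝓛(𝓕(X_E))` of adjointable operators on the Fock correspondence. -/
def adjointableOps : StarSubalgebra ℂ (G.Fock →L[ℂ] G.Fock) where
  carrier := {T | Fock.IsAdjointable T}
  mul_mem' := fun {S T} hS hT => by
    rw [Set.mem_ofPred_eq, Fock.isAdjointable_iff] at *
    intro v ξ
    simp [hS, hT]
  add_mem' := fun {S T} hS hT => by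
    rw [Set.mem_ofPred_eq, Fock.isAdjointable_iff] at *
    intro v ξ
    simp [hS, hT]
  algebraMap_mem' := fun c => by
    rw [Set.mem_ofPred_eq, Fock.isAdjointable_iff]
    intro v ξ
    simp [Algebra.algebraMap_eq_smul_one]
  star_mem' := fun {T} hT => by
    rw [Set.mem_ofPred_eq, Fock.isAdjointable_iff] at *
    intro v ξ
    refine ext_inner_right ℂ fun η => ?_
    rw [ContinuousLinearMap.star_eq_adjoint, ContinuousLinearMap.adjoint_inner_left,
      Fock.inner_rightAct, Fock.inner_rightAct, ContinuousLinearMap.adjoint_inner_left, hT]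

variable (G) in
/-- The rank-one operators `θ_{ξ,η} ζ = ξ ⟨η, ζ⟩` on the Fock correspondence. -/
def rankOneOps : Set G.adjointableOps :=
  {T | ∃ ξ η : G.Fock, ∀ ζ : G.Fock, T.1 ζ = Fock.rightAct G (Fock.innerA η ζ) ξ}

lemma mul_mem_rankOneOps (S : G.adjointableOps) {T : G.adjointableOps} (hT : T ∈ G.rankOneOps) :
    S * T ∈ G.rankOneOps := by
  obtain ⟨ξ, η, h⟩ := hT
  refine ⟨S.1 ξ, η, fun ζ => ?_⟩
  have hS := (Fock.isAdjointable_iff S.1).1 S.2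
  have : (S * T).1 ζ = S.1 (T.1 ζ) := rfl
  rw [this, h, Fock.rightAct_eq_sum, Fock.rightAct_eq_sum, map_sum]
  simp [hS]

lemma star_mem_rankOneOps {T : G.adjointableOps} (hT : T ∈ G.rankOneOps) :
    star T ∈ G.rankOneOps := by
  obtain ⟨ξ, η, h⟩ := hT
  refine ⟨η, ξ, fun ζ => ?_⟩
  refine ext_inner_right ℂ fun χ => ?_
  have : (star T).1 = ContinuousLinearMap.adjoint T.1 := rfl
  rw [this, ContinuousLinearMap.adjoint_inner_left, h, Fock.rightAct_eq_sum, Fock.rightAct_eq_sum,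
    inner_sum, sum_inner]
  refine Finset.sum_congr rfl fun v _ => ?_
  rw [inner_smul_right, inner_smul_left, Fock.innerA_eq, Fock.innerA_eq, inner_conj_symm,
    Fock.inner_rightAct, Fock.inner_rightAct, mul_comm]

variable (G) in
/-- The closed linear span of the rank-one operators. -/
def compactSpan : Submodule ℂ G.adjointableOps :=
  (Submodule.span ℂ G.rankOneOps).topologicalClosure

lemma mul_mem_compactSpan (S : G.adjointableOps) {T : G.adjointableOps} (hT : T ∈ G.compactSpan) :
    S * T ∈ G.compactSpan := by
  refine map_mem_closure (continuous_const_mul S) hT fun x hx => ?_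
  induction hx using Submodule.span_induction with
  | mem x hx => exact Submodule.subset_span (mul_mem_rankOneOps S hx)
  | zero => simp
  | add x y _ _ hx hy => simpa [mul_add] using Submodule.add_mem _ hx hy
  | smul c x _ hx => simpa using Submodule.smul_mem _ c hx

lemma star_mem_compactSpan {T : G.adjointableOps} (hT : T ∈ G.compactSpan) :
    star T ∈ G.compactSpan := by
  refine map_mem_closure continuous_star hT fun x hx => ?_
  induction hx using Submodule.span_induction with
  | mem x hx => exact Submodule.subset_span (star_mem_rankOneOps hx)
  | zero => simp
  | add x y _ _ hx hy => simpa using Submodule.add_mem _ hx hy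
  | smul c x _ hx => simpa using Submodule.smul_mem _ (conj c) hx

variable (G) in
/-- The ideal `𝓚 = 𝓚(𝓕(X_E))` of (generalized) compact operators: the closed linear span of the
operators `θ_{ξ,η}`. -/
def compactOps : Ideal G.adjointableOps where
  carrier := G.compactSpan
  add_mem' := G.compactSpan.add_mem
  zero_mem' := G.compactSpan.zero_mem
  smul_mem' := fun S _ hT => mul_mem_compactSpan S hT

instance instIsTwoSided : G.compactOps.IsTwoSided where
  mul_mem_of_left := fun {T} S hT => by
    have h := star_mem_compactSpan (mul_mem_compactSpan (star S) (star_mem_compactSpan hT))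
    rw [star_mul, star_star, star_star] at h
    exact h

instance instIsClosed : IsClosed (G.compactOps : Set G.adjointableOps) :=
  Submodule.isClosed_topologicalClosure _

variable (G) in
/-- The quotient algebra `𝓛(𝓕(X_E)) / 𝓚`, with the quotient norm and the involution
`q(T)^* = q(T^*)`. -/
def QuotAlg : Type _ := G.adjointableOps ⧸ G.compactOps

namespace QuotAlg

instance : Ring G.QuotAlg := inferInstanceAs (Ring (G.adjointableOps ⧸ G.compactOps))

instance : Algebra ℂ G.QuotAlg := inferInstanceAs (Algebra ℂ (G.adjointableOps ⧸ G.compactOps))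

variable (G) in
/-- The quotient map `q`. -/
def q : G.adjointableOps →ₐ[ℂ] G.QuotAlg := Ideal.Quotient.mkₐ ℂ G.compactOps

lemma q_surjective : Function.Surjective (q G) := Ideal.Quotient.mk_surjective

lemma q_eq_zero_iff (T : G.adjointableOps) : q G T = 0 ↔ T ∈ G.compactOps :=
  Ideal.Quotient.eq_zero_iff_mem

instance : NormedAddCommGroup G.QuotAlg :=
  inferInstanceAs (NormedAddCommGroup (G.adjointableOps ⧸ G.compactOps))


lemma norm_q_le (T : G.adjointableOps) : ‖q G T‖ ≤ ‖T‖ :=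
  Submodule.Quotient.norm_mk_le G.compactOps T

lemma exists_norm_lt (x : G.QuotAlg) {ε : ℝ} (hε : 0 < ε) :
    ∃ T : G.adjointableOps, q G T = x ∧ ‖T‖ < ‖x‖ + ε :=
  Submodule.Quotient.norm_mk_lt x hε

instance : NormedRing G.QuotAlg where
  __ := (inferInstance : Ring G.QuotAlg)
  __ := (inferInstance : NormedAddCommGroup G.QuotAlg)
  norm_mul_le := fun x y => by
    refine le_of_forall_pos_le_add fun ε hε => ?_
    have ht : Filter.Tendsto (fun d : ℝ => (‖x‖ + d) * (‖y‖ + d)) (nhdsWithin 0 (Set.Ioi 0))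
        (nhds ((‖x‖ + 0) * (‖y‖ + 0))) :=
      ((by fun_prop : Continuous fun d : ℝ => (‖x‖ + d) * (‖y‖ + d)).tendsto 0).mono_left
        nhdsWithin_le_nhds
    rw [add_zero, add_zero] at ht
    obtain ⟨d, hd, hd0⟩ := ((ht.eventually (gt_mem_nhds (lt_add_of_pos_right _ hε))).and
      self_mem_nhdsWithin).exists
    obtain ⟨S, rfl, hS⟩ := exists_norm_lt x hd0
    obtain ⟨T, rfl, hT⟩ := exists_norm_lt y hd0
    calc ‖q G S * q G T‖ = ‖q G (S * T)‖ := by rw [map_mul]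
      _ ≤ ‖S * T‖ := norm_q_le _
      _ ≤ ‖S‖ * ‖T‖ := norm_mul_le _ _
      _ ≤ _ := mul_le_mul hS.le hT.le (norm_nonneg _) ((norm_nonneg _).trans hS.le)
      _ ≤ _ := hd.le

instance : NormedAlgebra ℂ G.QuotAlg where
  __ := (inferInstance : Algebra ℂ G.QuotAlg)
  norm_smul_le := fun c x => by
    refine le_of_forall_pos_le_add fun ε hε => ?_
    have hc : 0 < ‖c‖ + 1 := by positivity
    obtain ⟨T, rfl, hT⟩ := exists_norm_lt x (div_pos hε hc)
    calc ‖c • q G T‖ = ‖q G (c • T)‖ := by rw [map_smul]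
      _ ≤ ‖c • T‖ := norm_q_le _
      _ = ‖c‖ * ‖T‖ := norm_smul _ _
      _ ≤ ‖c‖ * (‖q G T‖ + ε / (‖c‖ + 1)) := by gcongr
      _ = ‖c‖ * ‖q G T‖ + ε * (‖c‖ / (‖c‖ + 1)) := by ring
      _ ≤ ‖c‖ * ‖q G T‖ + ε * 1 := by
        gcongr
        rw [div_le_one hc]
        linarith
      _ = _ := by rw [mul_one]

/-- The involution of the quotient, `q(T)^* = q(T^*)`. -/
def starFun : G.QuotAlg → G.QuotAlg :=
  Quotient.map' (fun T : G.adjointableOps => star T) fun S T h => by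
    rw [Submodule.quotientRel_def] at h ⊢
    rw [← star_sub]
    exact star_mem_compactSpan h

instance : Star G.QuotAlg := ⟨starFun⟩

lemma q_star (T : G.adjointableOps) : q G (star T) = star (q G T) := rfl

instance : StarRing G.QuotAlg where
  star_involutive := fun x => by
    obtain ⟨T, rfl⟩ := q_surjective x
    rw [← q_star, ← q_star, star_star]
  star_mul := fun x y => by
    obtain ⟨S, rfl⟩ := q_surjective x
    obtain ⟨T, rfl⟩ := q_surjective y
    rw [← map_mul, ← q_star, star_mul, map_mul, q_star, q_star]
  star_add := fun x y => by
    obtain ⟨S, rfl⟩ := q_surjective x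
    obtain ⟨T, rfl⟩ := q_surjective y
    rw [← map_add, ← q_star, star_add, map_add, q_star, q_star]

instance : StarModule ℂ G.QuotAlg where
  star_smul := fun c x => by
    obtain ⟨T, rfl⟩ := q_surjective x
    rw [← map_smul, ← q_star, star_smul, map_smul, q_star]

instance : NormedStarGroup G.QuotAlg where
  norm_star_le := fun x => by
    refine le_of_forall_pos_le_add fun ε hε => ?_
    obtain ⟨T, rfl, hT⟩ := exists_norm_lt x hε
    rw [← q_star]
    refine (norm_q_le _).trans ?_
    have h : ‖star T‖ = ‖T‖ := norm_star (T : G.Fock →L[ℂ] G.Fock)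
    rw [h]
    exact hT.le

end QuotAlg

/-! ### The weighted Toeplitz algebra, `𝓓`, `F`, and their images in the quotient -/

variable (G) in
/-- `S_e` as an element of `𝓛(𝓕(X_E))`. -/
def S (e : Ed) : G.adjointableOps := ⟨Fock.shift e, Fock.isAdjointable_shift e⟩

variable (G) in
/-- `P_v = φ_∞(δ_v)` as an element of `𝓛(𝓕(X_E))`. -/
def P (v : V) : G.adjointableOps :=
  ⟨Fock.leftAct G (Fock.delta v), Fock.isAdjointable_leftAct (Fock.delta v)⟩

variable (G) in
/-- The gauge automorphism `γ_t = Ad W_t` of `𝓛(𝓕(X_E))`. -/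
def gauge (t : ℝ) (X : G.adjointableOps) : G.adjointableOps :=
  let W : G.adjointableOps := ⟨Fock.gaugeUnitary t, Fock.isAdjointable_gaugeUnitary t⟩
  W * X * star W

variable (G) in
/-- `u_e = q(S_e)`. -/
def u (e : Ed) : G.QuotAlg := QuotAlg.q G (G.S e)

variable (G) in
/-- `p_v = q(P_v)`. -/
def pv (v : V) : G.QuotAlg := QuotAlg.q G (G.P v)

/-- `u_α = u_{e₁} u_{e₂} ⋯ u_{eₖ}` for a path `α = e₁ e₂ ⋯ eₖ`, and `u_v = p_v` for a path of length
`0`.  The last factor `p_{s(α)}` is redundant if `k ≥ 1`, as `u_e p_{s(e)} = u_e`. -/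
def uPath {k : ℕ} (α : G.Path k) : G.QuotAlg :=
  α.edges.foldr (fun e x => G.u e * x) (G.pv α.source)

namespace WeightSequence

variable (Z : G.WeightSequence)

/-- The weight operator `Z` as an element of `𝓛(𝓕(X_E))`. -/
def opL : G.adjointableOps := ⟨Fock.weightOp Z, Fock.isAdjointable_weightOp Z⟩

/-- The weighted Toeplitz algebra `𝓣(X_E, Z)`: the `C^*`-algebra generated by the weighted shifts
`W_e = Z S_e`. -/
def toeplitz : NonUnitalStarSubalgebra ℂ G.adjointableOps :=
  (NonUnitalStarAlgebra.adjoin ℂ (Set.range fun e : Ed => Z.opL * G.S e)).topologicalClosure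

/-- `𝓓`, the fixed points of the gauge action in `𝓣(X_E, Z)`. -/
def D : Set G.adjointableOps := {X | X ∈ Z.toeplitz ∧ ∀ t : ℝ, G.gauge t X = X}

/-- `F`, the first spectral subspace of the gauge action in `𝓣(X_E, Z)`. -/
def F : Set G.adjointableOps :=
  {X | X ∈ Z.toeplitz ∧ ∀ t : ℝ, G.gauge t X = Complex.exp (Complex.I * t) • X}

/-- `q(𝓓)`. -/
def qD : Set G.QuotAlg := QuotAlg.q G '' Z.D

/-- `q(F)`. -/
def qF : Set G.QuotAlg := QuotAlg.q G '' Z.F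

/-- `z = q(Z)`. -/
def z : G.QuotAlg := QuotAlg.q G Z.opL

/-- The algebra `𝓒_n`: the `C^*`-algebra generated by the elements `u_α z^l u_β^*` with `l ≥ 0`,
`np ≤ |α| = |β| < (n+1)p` and `s(α) = s(β)`. -/
def C (p n : ℕ) : NonUnitalStarSubalgebra ℂ G.QuotAlg :=
  (NonUnitalStarAlgebra.adjoin ℂ
    {x : G.QuotAlg | ∃ (l k : ℕ) (α β : G.Path k), n * p ≤ k ∧ k < (n + 1) * p ∧
      α.source = β.source ∧ x = uPath α * Z.z ^ l * star (uPath β)}).topologicalClosure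

/-- `J` is a closed two-sided ideal of `q(𝓓)`. -/
structure IsIdeal (J : Submodule ℂ G.QuotAlg) : Prop where
  subset : (J : Set G.QuotAlg) ⊆ Z.qD
  isClosed : IsClosed (J : Set G.QuotAlg)
  mul_mem_left : ∀ a ∈ Z.qD, ∀ x ∈ J, a * x ∈ J
  mul_mem_right : ∀ a ∈ Z.qD, ∀ x ∈ J, x * a ∈ J

/-- `q(F)(J)`, the closed linear span of the elements `⟨η, a ξ⟩ = η^* a ξ` with `a ∈ J` and
`ξ, η ∈ q(F)`. -/
def qFImage (J : Submodule ℂ G.QuotAlg) : Submodule ℂ G.QuotAlg :=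
  (Submodule.span ℂ {x | ∃ a ∈ J, ∃ ξ ∈ Z.qF, ∃ η ∈ Z.qF,
    x = star η * a * ξ}).topologicalClosure

/-- `q(F)⁻¹(J)`, the set of all `a ∈ q(𝓓)` with `⟨η, a ξ⟩ = η^* a ξ ∈ J` for all `ξ, η ∈ q(F)`. -/
def qFPreimage (J : Submodule ℂ G.QuotAlg) : Set G.QuotAlg :=
  {a | a ∈ Z.qD ∧ ∀ ξ ∈ Z.qF, ∀ η ∈ Z.qF, star η * a * ξ ∈ J}

/-- The ideal `J` is fully invariant: `q(F)(J) ⊆ J` and `q(F)⁻¹(J) ⊆ J`. -/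
def FullyInvariant (J : Submodule ℂ G.QuotAlg) : Prop :=
  Z.qFImage J ≤ J ∧ Z.qFPreimage J ⊆ J

/-- `J_n = J ∩ 𝓒_n`. -/
def restrict (p : ℕ) (J : Submodule ℂ G.QuotAlg) (n : ℕ) : Set G.QuotAlg := {x | x ∈ J ∧ x ∈ Z.C p n}

/-- The corner `J_{n,v}`: the set of all `u_{ξ_v} u_{μ₁}^* x u_{μ₂} u_{ξ_v}^*` with `x ∈ J_n` and
`μ₁, μ₂` paths of length `np + (p - 1)` with source `v`, for a given path `ξ_v`.  (The
set obtained from one fixed pair `μ₁, μ₂` is the same for all such pairs.) -/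
def corner (p : ℕ) (J : Submodule ℂ G.QuotAlg) {k : ℕ} (ξ : V → G.Path k) (n : ℕ) (v : V) :
    Set G.QuotAlg :=
  {y | ∃ μ₁ μ₂ : G.Path (n * p + (p - 1)), μ₁.source = v ∧ μ₂.source = v ∧
    ∃ x ∈ Z.restrict p J n,
      y = uPath (ξ v) * star (uPath μ₁) * x * uPath μ₂ * star (uPath (ξ v))}

end WeightSequence

end DirGraph

end

/-! Modulo the compacts, `∑ₑ uₑ uₑ^* = 1`, and Condition A(p) says that `x ↦ ∑ₑ uₑ x uₑ^*`, iterated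
`p` times, fixes `z`. Hence the elements `z_j = ∑_{|α|=j} u_α z u_α^*` are periodic in `j`. Let `R`
(`coeffAlg`) be the closed `*`-algebra generated by the `z_j` and the `p_v`. Then `uₑ^* R u_f ⊆ R`,
with zero for `e ≠ f` (`conj_mem_coeffAlg`), so the algebras `M_k` (`matAlg`) of elements whose
compressions by paths of length `k` lie in `R` increase with `k`. Periodicity gives `𝓒_n =
M_{np+p-1}` (`C_eq_matAlg`).

An ideal `J` is encoded by its coefficient ideals `I_k(v)` (`coeffIdeal`): the `y ∈ p_v R` with `u_μ
y u_μ^* ∈ J` for paths `μ` of length `k` and source `v`. Let `Ψ` (`edgePreimage`) send a family `X`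
to the family of all `y ∈ p_v R` with `u_g^* y u_g ∈ X(s(g))` for every edge `g` of range `v`. For
every closed ideal, `I_k = Ψ(I_{k+1})` (`coeffIdeal_eq_edgePreimage`).

Full invariance means invariance under `x ↦ uₑ^* x u_f` and `x ↦ uₑ x u_f^*`
(`IsIdeal.fullyInvariant_iff`), and this amounts to `I_k = I_0` for all `k`
(`coeffIdeal_eq_of_fullyInvariant`, `fullyInvariant_of_coeffIdeal_eq`). The direction from
coefficients to `J` needs the union of the `J ∩ 𝓒_n` to be dense in `J`
(`IsIdeal.exists_mem_restrict_norm_sub_le`). This rests on gauge averaging, which approximates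
`q(𝓓)` by the `M_k`, and on a functional calculus argument that moves the approximants into `J`.

Condition 1 says `I_{np+p-1} = I_{p-1}` for all `n` (`corner_eq_corner_iff`). It gives `Ψ(I_0) =
Ψ^p(I_{p-1}) = Ψ^p(I_{2p-1}) = I_{p-1}`. If moreover `I_0 = I_{p-1}`, then `Ψ` fixes `I_0`, and
every `I_k`, being an iterate of `Ψ` applied to some `I_{np+p-1} = I_0`, equals `I_0`. So only `I_0
= I_{p-1}` remains. In (A), conditions 3 and 2 give the two inclusions. In (B), condition 2 applied
once gives `I_0 ⊆ Ψ(I_0) = I_{p-1}`, and applied `p - 1` times it gives the reverse inclusion. -/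

noncomputable section

/-! ### Functional calculus: square roots, and approximation inside a closed ideal. -/

/-- A closed `*`-subalgebra that contains the square of a positive element contains the element. -/
lemma NonUnitalStarSubalgebra.mem_of_mul_self_mem {A : Type*} [CStarAlgebra A] [PartialOrder A]
    [StarOrderedRing A] (T : NonUnitalStarSubalgebra ℂ A) (hT : IsClosed (T : Set A)) {b : A}
    (hb : 0 ≤ b) (h : b * b ∈ T) : b ∈ T := by
  -- The square root vanishes at `0`, so the non-unital calculus applies and `T` need not contain
  -- the unit.
  rw [← CFC.sqrt_mul_self b hb, CFC.sqrt_eq_real_sqrt (b * b) (by cfc_tac)]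
  exact cfcₙ_mem (hs := hT) Real.sqrt h

/-- The soft threshold functions used to cut down an element of a `C^*`-algebra. -/
def softThreshold (θ : ℝ) (n : ℕ) (t : ℝ) : ℝ := max 0 (t - θ) / max t θ ^ (n + 1)

section softThreshold

variable {θ : ℝ} (hθ : 0 < θ)
include hθ

lemma continuous_softThreshold (n : ℕ) : Continuous (softThreshold θ n) := by
  unfold softThreshold
  refine Continuous.div (by fun_prop) (by fun_prop) fun t => ?_
  have : 0 < max t θ := lt_max_of_lt_right hθ
  positivity

lemma softThreshold_zero (n : ℕ) : softThreshold θ n 0 = 0 := by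
  simp [softThreshold, hθ.le]

/-- Iterating this writes the cut-off as `t ^ n` times a function bounded by `θ⁻ⁿ`, which is what
beats the powers of an error of norm below `θ`. -/
lemma softThreshold_eq_mul (n : ℕ) (t : ℝ) :
    softThreshold θ n t = t * softThreshold θ (n + 1) t := by
  unfold softThreshold
  rcases le_total t θ with h | h
  · simp [h]
  · have : t ≠ 0 := (hθ.trans_le h).ne'
    rw [max_eq_left h]
    field_simp
    ring

lemma norm_softThreshold_le (n : ℕ) (t : ℝ) : ‖softThreshold θ n t‖ ≤ (θ ^ n)⁻¹ := by
  have hm : 0 < max t θ := lt_max_of_lt_right hθ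
  unfold softThreshold
  rw [Real.norm_of_nonneg (by positivity), pow_succ, ← div_div, div_right_comm]
  rw [← one_div (θ ^ n)]
  have h1 : max 0 (t - θ) / max t θ ≤ 1 := by
    rw [div_le_one hm]
    exact max_le hm.le ((sub_le_self _ hθ.le).trans (le_max_left _ _))
  gcongr
  exact le_max_right _ _

/-- The expression is `t (1 - f(t))²`, which is `t` below `θ` and `θ² / t` above. It is kept
expanded to match `(1 - g) h (1 - g)` for operators. -/
lemma norm_softThreshold_defect_le {t : ℝ} (ht : 0 ≤ t) :
    ‖t - t * softThreshold θ 0 t - softThreshold θ 0 t * t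
      + softThreshold θ 0 t * t * softThreshold θ 0 t‖ ≤ θ := by
  have h0 : t - t * softThreshold θ 0 t - softThreshold θ 0 t * t
      + softThreshold θ 0 t * t * softThreshold θ 0 t = t * (1 - softThreshold θ 0 t) ^ 2 := by ring
  rw [h0, Real.norm_of_nonneg (by positivity)]
  unfold softThreshold
  rcases le_total t θ with h | h
  · simp [h]
  · have hpos : 0 < t := hθ.trans_le h
    rw [max_eq_left h, max_eq_right (sub_nonneg.2 h)]
    have : t * (1 - (t - θ) / t ^ (0 + 1)) ^ 2 = θ * (θ / t) := by field_simp; ring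
    rw [this]
    exact mul_le_of_le_one_right hθ.le ((div_le_one hpos).2 h)

end softThreshold

/-- An element of a closed ideal `J` that is close to a closed `*`-subalgebra `C` is close to
`J ∩ C`. -/
lemma exists_mem_inter_norm_sub_le {A B : Type*} [CStarAlgebra A] [PartialOrder A]
    [StarOrderedRing A] [NormedRing B]
    [StarRing B] [NormedStarGroup B] [NormedAlgebra ℂ B] [StarModule ℂ B] (q : A →⋆ₐ[ℂ] B)
    (hq : ∀ a, ‖q a‖ ≤ ‖a‖) (hsurj : Function.Surjective q)
    (C : NonUnitalStarSubalgebra ℂ B) (hC : IsClosed (C : Set B))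
    (J : Submodule ℂ B) (hJ : IsClosed (J : Set B))
    (hl : ∀ a ∈ C, ∀ x ∈ J, a * x ∈ J) (hr : ∀ a ∈ C, ∀ x ∈ J, x * a ∈ J)
    (hJJ : ∀ a ∈ J, ∀ x ∈ J, a * x ∈ J) {x c : B} (hx : x ∈ J) (hc : c ∈ C) {δ : ℝ} (hδ : 0 < δ)
    (hxc : ‖c - x‖ ≤ δ) : ∃ y ∈ J, y ∈ C ∧ ‖c - y‖ ^ 2 ≤ 2 * ((‖x‖ + δ) * δ) := by
  obtain ⟨d, rfl⟩ := hsurj c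
  -- The functional calculus takes place in `A`, on a lift `d` of `c`; the target `B` is only used
  -- as a normed `*`-ring.
  set h : A := star d * d with hh
  have hh0 : 0 ≤ h := star_mul_self_nonneg d
  have hsa : IsSelfAdjoint h := .of_nonneg hh0
  -- `η` bounds the distance from `c^* c` to the element `c^* x` of `J`. The threshold `θ = 2η`
  -- makes the error terms below decay like `2⁻ⁿ`.
  set η : ℝ := (‖x‖ + δ) * δ with hη
  have hη0 : 0 < η := by positivity
  set θ : ℝ := 2 * η with hθdef
  have hθ : 0 < θ := by positivity
  have hqh : q h = star (q d) * q d := by rw [hh, map_mul, map_star]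
  have hhC : q h ∈ C := hqh ▸ mul_mem (star_mem hc) hc
  have hcfc : ∀ f : ℝ → ℝ, q (cfcₙ f h) ∈ C := fun f =>
    cfcₙ_mem (s := C.comap (q : A →⋆ₙₐ[ℂ] B))
      (hs := hC.preimage (AddMonoidHomClass.continuous_of_bound q 1 fun a => by simpa using hq a))
      f hhC
  set g : ℕ → A := fun n => cfcₙ (softThreshold θ n) h with hg
  have hgc : ∀ n, ContinuousOn (softThreshold θ n) (quasispectrum ℝ h) := fun n =>
    (continuous_softThreshold hθ n).continuousOn
  have hgs : ∀ n, g n = h * g (n + 1) := fun n => by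
    have h1 : g n = cfcₙ (fun t => t * softThreshold θ (n + 1) t) h :=
      cfcₙ_congr fun t _ => softThreshold_eq_mul hθ n t
    rw [h1, cfcₙ_mul _ _ h (by fun_prop) rfl (hgc _) (softThreshold_zero hθ _), cfcₙ_id' ℝ h]
  have hgp : ∀ n, g 0 = h ^ n * g n := fun n => by
    induction n with
    | zero => simp
    | succ n ih => rw [ih, pow_succ, mul_assoc, ← hgs]
  have hgn : ∀ n, ‖g n‖ ≤ (θ ^ n)⁻¹ := fun n =>
    norm_cfcₙ_le fun t _ => norm_softThreshold_le hθ n t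
  set j : B := star (q d) * x with hj
  have hjJ : j ∈ J := hl _ (star_mem hc) _ hx
  set r : B := q h - j with hrdef
  have hrn : ‖r‖ ≤ η := by
    have : r = star (q d) * (q d - x) := by rw [hrdef, hqh, hj, mul_sub]
    rw [this]
    refine (norm_mul_le _ _).trans ?_
    rw [norm_star]
    have h1 : ‖q d‖ ≤ ‖x‖ + δ := by
      calc ‖q d‖ = ‖x + (q d - x)‖ := by congr 1; abel
        _ ≤ _ := (norm_add_le _ _).trans (by gcongr)
    exact mul_le_mul h1 hxc (norm_nonneg _) (by positivity)
  -- Neither `C` nor `J` need contain `r`, so multiplication by `r` is rewritten with `r = q h - j`,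
  -- where `q h ∈ C` and `j ∈ J`.
  have hpow : ∀ n, q h ^ (n + 1) ∈ C ∧ q h ^ (n + 1) - r ^ (n + 1) ∈ J := fun n => by
    induction n with
    | zero => refine ⟨by simpa using hhC, ?_⟩; simpa [hrdef] using hjJ
    | succ n ih =>
      refine ⟨by rw [pow_succ]; exact mul_mem ih.1 hhC, ?_⟩
      have : q h ^ (n + 1 + 1) - r ^ (n + 1 + 1) =
          q h ^ (n + 1) * j + ((q h ^ (n + 1) - r ^ (n + 1)) * q h
            - (q h ^ (n + 1) - r ^ (n + 1)) * j) := by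
        rw [pow_succ, pow_succ r]
        have : q h = r + j := by rw [hrdef]; abel
        nth_rw 2 [this]
        nth_rw 4 [this]
        noncomm_ring
      rw [this]
      exact add_mem (hl _ ih.1 _ hjJ) (sub_mem (hr _ hhC _ ih.2) (hJJ _ ih.2 _ hjJ))
  -- `q (g 0) = q(h)ⁿ q(g n)` differs from an element of `J` by `rⁿ q(g n)`, of norm at most `ηⁿ θ⁻ⁿ
  -- = 2⁻ⁿ`.
  have hgJ : q (g 0) ∈ J := by
    have hlim : Filter.Tendsto (fun n : ℕ => (q h ^ (n + 1) - r ^ (n + 1)) * q (g (n + 1)))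
        Filter.atTop (nhds (q (g 0))) := by
      rw [tendsto_iff_norm_sub_tendsto_zero]
      have hz : Filter.Tendsto (fun n : ℕ => ((1 : ℝ) / 2) ^ (n + 1)) Filter.atTop (nhds 0) :=
        (tendsto_pow_atTop_nhds_zero_of_lt_one (by norm_num) (by norm_num)).comp
          (Filter.tendsto_add_atTop_nat 1)
      refine squeeze_zero (fun _ => norm_nonneg _) (fun n => ?_) hz
      have : (q h ^ (n + 1) - r ^ (n + 1)) * q (g (n + 1)) - q (g 0)
          = - (r ^ (n + 1) * q (g (n + 1))) := by
        rw [hgp (n + 1), map_mul q (h ^ (n + 1)), map_pow q h]; noncomm_ring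
      rw [this, norm_neg]
      calc ‖r ^ (n + 1) * q (g (n + 1))‖ ≤ ‖r ^ (n + 1)‖ * ‖q (g (n + 1))‖ := norm_mul_le _ _
        _ ≤ η ^ (n + 1) * (θ ^ (n + 1))⁻¹ := by
          refine mul_le_mul ?_ ((hq _).trans (hgn _)) (norm_nonneg _) (by positivity)
          exact (norm_pow_le' r n.succ_pos).trans (by gcongr)
        _ = _ := by
          rw [← inv_pow, ← mul_pow, hθdef]
          congr 1
          field_simp
    exact hJ.mem_of_tendsto hlim (Filter.Eventually.of_forall fun n => hr _ (hcfc _) _ (hpow n).2)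
  refine ⟨q d * q (g 0), hl _ hc _ hgJ, mul_mem hc (hcfc _), ?_⟩
  rw [← map_mul, ← map_sub]
  refine (pow_le_pow_left₀ (norm_nonneg _) (hq _) 2).trans ?_
  rw [sq, ← CStarRing.norm_star_mul_self]
  have hgsa : star (g 0) = g 0 := (IsSelfAdjoint.cfcₙ : IsSelfAdjoint (g 0)).star_eq
  -- By the `C^*`-identity in `A`, the error of `y = q (d * g 0)` is controlled by the defect
  -- function of the threshold evaluated at `h`.
  have hexp : star (d - d * g 0) * (d - d * g 0) =
      cfcₙ (fun t => t - t * softThreshold θ 0 t - softThreshold θ 0 t * t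
      + softThreshold θ 0 t * t * softThreshold θ 0 t) h := by
    have h0 := softThreshold_zero hθ 0
    have hc0 : ContinuousOn (softThreshold θ 0) (quasispectrum ℝ h) := hgc 0
    have hci : ContinuousOn (fun t : ℝ => t) (quasispectrum ℝ h) := continuousOn_id
    set f := softThreshold θ 0
    have hif : ContinuousOn (fun t => t * f t) (quasispectrum ℝ h) := hci.mul hc0
    have hfi : ContinuousOn (fun t => f t * t) (quasispectrum ℝ h) := hc0.mul hci
    have hfif : ContinuousOn (fun t => f t * t * f t) (quasispectrum ℝ h) := hfi.mul hc0
    have e1 : cfcₙ (fun t => t * f t) h = h * g 0 := by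
      rw [cfcₙ_mul _ _ h hci rfl hc0 h0, cfcₙ_id' ℝ h]
    have e2 : cfcₙ (fun t => f t * t) h = g 0 * h := by
      rw [cfcₙ_mul _ _ h hc0 h0 hci rfl, cfcₙ_id' ℝ h]
    have e3 : cfcₙ (fun t => f t * t * f t) h = g 0 * h * g 0 := by
      rw [cfcₙ_mul _ _ h hfi (mul_zero _) hc0 h0, e2]
    have e4 : cfcₙ (fun t => t - t * f t) h = h - h * g 0 := by
      rw [cfcₙ_sub (fun t => t) (fun t => t * f t) h hci rfl hif (zero_mul _), e1, cfcₙ_id' ℝ h]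
    have e5 : cfcₙ (fun t => t - t * f t - f t * t) h = h - h * g 0 - g 0 * h := by
      rw [cfcₙ_sub (fun t => t - t * f t) (fun t => f t * t) h (hci.sub hif) (by simp) hfi
        (mul_zero _), e4, e2]
    rw [cfcₙ_add (a := h) (fun t => t - t * f t - f t * t) (fun t => f t * t * f t)
      ((hci.sub hif).sub hfi) (by simp) hfif (by simp), e5, e3]
    rw [star_sub, star_mul, hgsa, hh]
    noncomm_ring
  rw [hexp]
  refine norm_cfcₙ_le fun t ht => norm_softThreshold_defect_le hθ ?_
  exact quasispectrum_nonneg_of_nonneg h hh0 t ht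

end

/-! ### Paths, creation and annihilation on the summands, and diagonal operators. -/

noncomputable section

namespace DirGraph

variable {V Ed : Type*} {G : DirGraph V Ed}

namespace Path

variable {k : ℕ}

/-- The first edge of a path of positive length. -/
def head (α : G.Path (k + 1)) : Ed := α.edges.head (by
  intro h
  have := α.length_eq
  simp [h] at this)

/-- The path `e α`, for `s(e) = r(α)`. -/
def cons (e : Ed) (α : G.Path k) (h : G.s e = α.range) : G.Path (k + 1) where
  source := α.source
  edges := e :: α.edges
  length_eq := by simp [α.length_eq]
  isPath := ⟨h, α.isPath⟩

lemma edges_eq (α : G.Path (k + 1)) : α.edges = α.head :: α.tail.edges :=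
  (List.cons_head_tail _).symm

lemma s_head (α : G.Path (k + 1)) : G.s α.head = α.tail.range := by
  have h := α.isPath
  rw [edges_eq] at h
  exact h.1

lemma range_eq (α : G.Path (k + 1)) : α.range = G.r α.head := by
  rw [range, edges_eq]
  rfl

@[simp] lemma cons_head_tail (α : G.Path (k + 1)) : cons α.head α.tail α.s_head = α :=
  Path.ext rfl (edges_eq α).symm

@[simp] lemma head_cons (e : Ed) (α : G.Path k) (h) : (cons e α h).head = e := rfl

@[simp] lemma tail_cons (e : Ed) (α : G.Path k) (h) : (cons e α h).tail = α := rfl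

@[simp] lemma source_tail (α : G.Path (k + 1)) : α.tail.source = α.source := rfl

lemma head?_edges (α : G.Path (k + 1)) (e : Ed) : α.edges.head? = some e ↔ α.head = e := by
  rw [edges_eq]
  simp

lemma head_tail_injective :
    Function.Injective fun α : G.Path (k + 1) => (α.head, α.tail) := by
  intro α β h
  have h1 : α.head = β.head := congrArg Prod.fst h
  have h2 : α.tail = β.tail := congrArg Prod.snd h
  have h3 : α.tail.source = β.tail.source := congrArg Path.source h2
  refine Path.ext h3 ?_
  rw [edges_eq, edges_eq β, h1, h2]

open Classical in
lemma sum_succ [Fintype V] [Fintype Ed] {M : Type*} [AddCommMonoid M] (F : G.Path (k + 1) → M) :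
    ∑ β, F β = ∑ e, ∑ γ : G.Path k, if h : G.s e = γ.range then F (cons e γ h) else 0 := by
  rw [← Fintype.sum_prod_type']
  refine Fintype.sum_of_injective (fun α : G.Path (k + 1) => (α.head, α.tail))
    head_tail_injective _ _ ?_ ?_
  · rintro ⟨e, γ⟩ hx
    refine dif_neg fun h => hx ⟨cons e γ h, rfl⟩
  · intro α
    simp [s_head]

/-- The path `α e`, for `s(α) = r(e)`. -/
def snoc (α : G.Path k) (e : Ed) (h : α.source = G.r e) : G.Path (k + 1) where
  source := G.s e
  edges := α.edges ++ [e]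
  length_eq := by simp [α.length_eq]
  isPath := by
    have key : ∀ l : List Ed, G.IsPathWord (G.r e) l → G.IsPathWord (G.s e) (l ++ [e]) := by
      intro l
      induction l with
      | nil => exact fun _ => ⟨rfl, trivial⟩
      | cons f l ih =>
        rintro ⟨h1, h2⟩
        refine ⟨h1.trans ?_, ih h2⟩
        cases l <;> rfl
    exact key _ (h ▸ α.isPath)

/-- In a graph without sinks every vertex is the source of a path of length `k`. -/
lemma exists_source_eq (hG : G.NoSinks) (k : ℕ) (v : V) : ∃ α : G.Path k, α.source = v := by
  induction k with
  | zero => exact ⟨⟨v, [], rfl, trivial⟩, rfl⟩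
  | succ k ih =>
    obtain ⟨α, hα⟩ := ih
    obtain ⟨e, he⟩ := hG α.range
    exact ⟨cons e α he, hα⟩

end Path

variable [Fintype V] [Fintype Ed]

/-! Shortcut instances for `𝓛`, which speed up instance search. -/

instance : NormedRing G.adjointableOps := inferInstance

instance : Ring G.adjointableOps := inferInstance

instance : StarRing G.adjointableOps := inferInstance

instance : Algebra ℂ G.adjointableOps := inferInstance

instance : NormedAlgebra ℂ G.adjointableOps := inferInstance

instance : Module ℂ G.adjointableOps := inferInstance

instance : SMul ℂ G.adjointableOps := inferInstance

instance : Mul G.adjointableOps := inferInstance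

instance : Star G.adjointableOps := inferInstance

/-! ### Creation and annihilation on the summands -/

namespace Xk

open Classical in
lemma create_apply (e : Ed) (k : ℕ) (ξ : G.Xk k) (β : G.Path (k + 1)) :
    create e k ξ β = if β.head = e then ξ β.tail else 0 := by
  have : create e k ξ β = if β.edges.head? = some e then ξ β.tail else 0 := rfl
  simp only [this, Path.head?_edges]

open Classical in
lemma adjoint_create_apply (e : Ed) (k : ℕ) (ξ : G.Xk (k + 1)) (γ : G.Path k) :
    ContinuousLinearMap.adjoint (create e k) ξ γ =
      if h : G.s e = γ.range then ξ (γ.cons e h) else 0 := by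
  have h1 : ContinuousLinearMap.adjoint (create e k) ξ γ =
      ⟪EuclideanSpace.single γ (1 : ℂ), ContinuousLinearMap.adjoint (create e k) ξ⟫_ℂ := by
    rw [EuclideanSpace.inner_single_left, map_one, one_mul]
  rw [h1, ContinuousLinearMap.adjoint_inner_right, PiLp.inner_apply, Path.sum_succ,
    Finset.sum_eq_single e, Finset.sum_eq_single γ]
  · simp [create_apply]
  · intro γ' _ hγ
    split_ifs with h
    · simp [create_apply, hγ]
    · rfl
  · simp
  · intro e' _ he
    refine Finset.sum_eq_zero fun γ' _ => ?_
    split_ifs with h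
    · simp [create_apply, he]
    · rfl
  · simp

lemma leftAct_apply (k : ℕ) (a : V → ℂ) (ξ : G.Xk k) (α : G.Path k) :
    leftAct G k a ξ α = a α.range * ξ α := rfl

open Classical in
lemma adjoint_create_create (e f : Ed) (k : ℕ) (ξ : G.Xk k) :
    ContinuousLinearMap.adjoint (create e k) (create f k ξ) =
      if e = f then leftAct G k (Fock.delta (G.s e)) ξ else 0 := by
  ext γ
  rw [adjoint_create_apply]
  by_cases hef : e = f
  · subst hef
    by_cases h : G.s e = γ.range
    · rw [dif_pos h, if_pos rfl, leftAct_apply, h]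
      simp [create_apply, Fock.delta]
    · rw [dif_neg h, if_pos rfl, leftAct_apply]
      simp [Fock.delta, Ne.symm h]
  · rw [if_neg hef]
    split_ifs
    · simp [create_apply, hef]
    · rfl

lemma sum_create_adjoint_create (k : ℕ) (ξ : G.Xk (k + 1)) :
    ∑ e, create e k (ContinuousLinearMap.adjoint (create e k) ξ) = ξ := by
  classical
  ext β
  rw [WithLp.ofLp_sum, Finset.sum_apply, Finset.sum_eq_single β.head]
  · simp [create_apply, adjoint_create_apply, Path.s_head]
  · intro e _ he
    simp [create_apply, he.symm]
  · simp

lemma create_leftAct (e : Ed) (k : ℕ) (ξ : G.Xk k) :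
    create e k (leftAct G k (Fock.delta (G.s e)) ξ) = create e k ξ := by
  classical
  ext β
  rw [create_apply, create_apply]
  split_ifs with h
  · rw [leftAct_apply, ← Path.s_head, h]
    simp [Fock.delta]
  · rfl

lemma leftAct_create (e : Ed) (k : ℕ) (ξ : G.Xk k) :
    leftAct G (k + 1) (Fock.delta (G.r e)) (create e k ξ) = create e k ξ := by
  classical
  ext β
  rw [leftAct_apply, create_apply]
  split_ifs with h
  · rw [Path.range_eq, h]
    simp [Fock.delta]
  · simp

end Xk

/-! ### Diagonal operators -/

/-- `X` is the diagonal operator `diag(T_0, T_1, …)`. -/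
def IsDiag (X : G.adjointableOps) (T : (k : ℕ) → (G.Xk k →L[ℂ] G.Xk k)) : Prop :=
  ∀ (ξ : G.Fock) (k : ℕ), X.1 ξ k = T k (ξ k)

namespace IsDiag

variable {X Y : G.adjointableOps} {T U : (k : ℕ) → (G.Xk k →L[ℂ] G.Xk k)}

lemma ext (hX : IsDiag X T) (hY : IsDiag Y T) : X = Y := by
  refine Subtype.ext (ContinuousLinearMap.ext fun ξ => ?_)
  ext k : 2
  rw [hX, hY]

lemma congr (hX : IsDiag X T) (h : T = U) : IsDiag X U := h ▸ hX

lemma one : IsDiag (1 : G.adjointableOps) fun _ => 1 := fun _ _ => rfl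

lemma zero : IsDiag (0 : G.adjointableOps) fun _ => 0 := fun _ _ => rfl

lemma add (hX : IsDiag X T) (hY : IsDiag Y U) : IsDiag (X + Y) fun k => T k + U k := fun ξ k => by
  change X.1 ξ k + Y.1 ξ k = _
  rw [hX, hY]; rfl

lemma sub (hX : IsDiag X T) (hY : IsDiag Y U) : IsDiag (X - Y) fun k => T k - U k := fun ξ k => by
  change X.1 ξ k - Y.1 ξ k = _
  rw [hX, hY]; rfl

lemma smul (c : ℂ) (hX : IsDiag X T) : IsDiag (c • X) fun k => c • T k := fun ξ k => by
  change c • X.1 ξ k = _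
  rw [hX]; rfl

lemma mul (hX : IsDiag X T) (hY : IsDiag Y U) : IsDiag (X * Y) fun k => T k * U k := fun ξ k => by
  change X.1 (Y.1 ξ) k = _
  rw [hX, hY]; rfl

lemma pow (hX : IsDiag X T) (n : ℕ) : IsDiag (X ^ n) fun k => T k ^ n := by
  induction n with
  | zero => simpa using one
  | succ n ih => simpa only [pow_succ] using ih.mul hX

lemma star (hX : IsDiag X T) : IsDiag (star X) fun k => Star.star (T k) := fun ξ k => by
  refine ext_inner_left ℂ fun η => ?_
  have h1 : ⟪lp.single 2 k η, (Star.star X).1 ξ⟫_ℂ = ⟪η, (Star.star X).1 ξ k⟫_ℂ :=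
    lp.inner_single_left k η _
  have h2 : ⟪lp.single 2 k η, (Star.star X).1 ξ⟫_ℂ = ⟪X.1 (lp.single 2 k η), ξ⟫_ℂ :=
    ContinuousLinearMap.adjoint_inner_right _ _ _
  have h3 : X.1 (lp.single 2 k η) = lp.single 2 k (T k η) := by
    ext j : 2
    rw [hX]
    by_cases hj : j = k
    · subst hj; simp
    · rw [lp.single_apply_ne 2 _ _ hj, lp.single_apply_ne 2 _ _ hj, map_zero]
  rw [← h1, h2, h3, lp.inner_single_left]
  exact (ContinuousLinearMap.adjoint_inner_right _ _ _).symm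

lemma norm_le (hX : IsDiag X T) {M : ℝ} (hM0 : 0 ≤ M) (hM : ∀ k, ‖T k‖ ≤ M) : ‖X‖ ≤ M := by
  refine ContinuousLinearMap.opNorm_le_bound X.1 hM0 fun ξ => ?_
  rw [← pow_le_pow_iff_left₀ (norm_nonneg _) (by positivity) two_ne_zero, mul_pow, Fock.norm_sq,
    Fock.norm_sq, ← tsum_mul_left]
  refine Summable.tsum_le_tsum (fun k => ?_) (Fock.summable_sq _) ((Fock.summable_sq ξ).mul_left _)
  rw [← mul_pow, hX]
  exact pow_le_pow_left₀ (norm_nonneg _) ((T k).le_of_opNorm_le (hM k) _) 2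

end IsDiag

open Classical in
variable (G) in
/-- The projection `Q_k` onto the `k`-th summand. -/
def Q (k : ℕ) : G.adjointableOps :=
  ⟨Fock.diag (fun j => if j = k then 1 else 0)
    ⟨1, fun j => by split_ifs <;> simp [ContinuousLinearMap.norm_id_le, ContinuousLinearMap.one_def]⟩,
    Fock.isAdjointable_diag _ _ fun j v ξ => by split_ifs <;> simp⟩

open Classical in
lemma isDiag_Q (k : ℕ) : IsDiag (G.Q k) fun j => if j = k then 1 else 0 := fun _ _ => rfl

lemma isDiag_P (v : V) : IsDiag (G.P v) fun k => Xk.leftAct G k (Fock.delta v) := fun _ _ => rfl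

lemma isDiag_opL (Z : G.WeightSequence) : IsDiag Z.opL Z.op := fun _ _ => rfl

/-- As the graph is finite, `Q_k` is the finite sum of the `θ_{δ_α, δ_α}` with `|α| = k`. Since
`δ_α` is supported over the single vertex `s(α)`, the module operator `θ_{δ_α, δ_α}` is the Hilbert
space rank-one operator of `δ_α`. -/
lemma Q_mem_compactOps (k : ℕ) : G.Q k ∈ G.compactOps := by
  classical
  let b : G.Path k → G.Fock := fun α => lp.single 2 k (EuclideanSpace.single α (1 : ℂ))
  have hb : ∀ α v, Fock.rightAct G (Fock.delta v) (b α) = Fock.delta v α.source • b α := by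
    intro α v
    ext j β
    change Fock.delta v β.source * b α j β = Fock.delta v α.source * b α j β
    by_cases hj : j = k
    · subst hj
      by_cases hβ : β = α
      · rw [hβ]
      · simp [b, hβ]
    · have : b α j = 0 := lp.single_apply_ne 2 _ _ hj
      simp [this]
  have hconj : ∀ v w : V, conj (Fock.delta v w) = Fock.delta v w := by
    intro v w
    unfold Fock.delta
    split_ifs <;> simp
  have hin : ∀ α v ζ, ⟪b α, Fock.rightAct G (Fock.delta v) ζ⟫_ℂ
      = Fock.delta v α.source * ⟪b α, ζ⟫_ℂ := by
    intro α v ζ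
    rw [← Fock.inner_rightAct, hb, inner_smul_left, hconj]
  let θ : G.Path k → G.adjointableOps := fun α =>
    ⟨InnerProductSpace.rankOne ℂ (b α) (b α), by
      refine (Fock.isAdjointable_iff _).2 fun v ζ => ?_
      rw [InnerProductSpace.rankOne_apply, InnerProductSpace.rankOne_apply, hin, map_smul, hb,
        smul_smul, mul_comm]⟩
  have hθ : ∀ α ζ, (θ α).1 ζ = ⟪b α, ζ⟫_ℂ • b α := fun α ζ => InnerProductSpace.rankOne_apply ..
  have hmem : ∀ α, θ α ∈ G.rankOneOps := by
    intro α
    refine ⟨b α, b α, fun ζ => ?_⟩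
    rw [hθ, Fock.rightAct_eq_sum, Finset.sum_eq_single α.source]
    · rw [hb, Fock.innerA_eq, hin]
      simp [Fock.delta]
    · intro v _ hv
      rw [hb]
      simp [Fock.delta, hv.symm]
    · simp
  have hQ : G.Q k = ∑ α, θ α := by
    refine Subtype.ext (ContinuousLinearMap.ext fun ζ => ?_)
    have h1 : (∑ α, θ α).1 ζ = ∑ α, ⟪b α, ζ⟫_ℂ • b α := by
      rw [AddSubmonoidClass.coe_finsetSum, _root_.sum_apply]
      exact Finset.sum_congr rfl fun α _ => hθ α ζ
    have h2 : ∀ α, ⟪b α, ζ⟫_ℂ = ζ k α := fun α => by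
      change ⟪lp.single 2 k _, _⟫_ℂ = _
      rw [lp.inner_single_left, EuclideanSpace.inner_single_left, map_one, one_mul]
    rw [h1]
    ext j : 2
    rw [isDiag_Q, lp.coeFn_sum, Finset.sum_apply]
    simp only [lp.coeFn_smul, Pi.smul_apply]
    by_cases hj : j = k
    · subst hj
      ext β
      rw [if_pos rfl, WithLp.ofLp_sum, Finset.sum_apply, Finset.sum_eq_single β]
      · simp [h2, b]
      · intro α _ hα
        simp [b, hα.symm]
      · simp
    · rw [if_neg hj, Finset.sum_eq_zero]
      · rfl
      · intro α _
        have : b α j = 0 := lp.single_apply_ne 2 _ _ hj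
        rw [this, smul_zero]
  rw [hQ]
  exact sum_mem fun α _ => subset_closure (Submodule.subset_span (hmem α))

/-- A diagonal operator whose entries tend to zero is compact. -/
lemma IsDiag.mem_compactOps {X : G.adjointableOps} {T : (k : ℕ) → (G.Xk k →L[ℂ] G.Xk k)}
    (hX : IsDiag X T) (hT : Filter.Tendsto (fun k => ‖T k‖) Filter.atTop (nhds 0)) :
    X ∈ G.compactOps := by
  classical
  have hcl : IsClosed (G.compactOps : Set G.adjointableOps) := inferInstance
  have hE : ∀ n, IsDiag (∑ k ∈ Finset.range n, G.Q k) fun j => if j < n then 1 else 0 := by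
    intro n
    induction n with
    | zero => simpa using IsDiag.zero
    | succ n ih =>
      rw [Finset.sum_range_succ]
      refine (ih.add (isDiag_Q n)).congr (funext fun j => ?_)
      rcases lt_trichotomy j n with h | h | h
      · simp [h, h.ne, h.trans (Nat.lt_succ_self n)]
      · simp [h]
      · simp [h.ne', not_lt.2 h.le, not_lt.2 (Nat.succ_le_of_lt h)]
  refine SetLike.mem_coe.1 (hcl.closure_subset_iff.2 subset_rfl (Metric.mem_closure_iff.2 ?_))
  intro ε hε
  obtain ⟨n, hn⟩ := Filter.eventually_atTop.1 (hT.eventually (gt_mem_nhds (half_pos hε)))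
  -- Cutting down to the first `n` summands leaves only the entries `T k` with `k ≥ n`, all of norm
  -- below `ε / 2`.
  refine ⟨X * ∑ k ∈ Finset.range n, G.Q k,
    Ideal.mul_mem_left _ _ (sum_mem fun k _ => Q_mem_compactOps k), ?_⟩
  rw [dist_eq_norm]
  refine lt_of_le_of_lt ((hX.sub (hX.mul (hE n))).norm_le (half_pos hε).le fun k => ?_)
    (half_lt_self hε)
  by_cases hk : k < n
  · simp [hk, (half_pos hε).le]
  · simpa [hk] using (hn k (not_lt.1 hk)).le

end DirGraph
end

/-! ### Cuntz–Krieger relations in the quotient, and the invariance of `z` given by Condition A(p).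
-/

noncomputable section

namespace DirGraph

variable {V Ed : Type*} {G : DirGraph V Ed} [Fintype V] [Fintype Ed]

/-! ### Relations in `𝓛` -/

lemma S_apply_zero (e : Ed) (ξ : G.Fock) : (G.S e).1 ξ 0 = 0 := rfl

lemma S_apply_succ (e : Ed) (ξ : G.Fock) (k : ℕ) : (G.S e).1 ξ (k + 1) = Xk.create e k (ξ k) := rfl

lemma star_S_apply (e : Ed) (ξ : G.Fock) (k : ℕ) :
    (star (G.S e)).1 ξ k = ContinuousLinearMap.adjoint (Xk.create e k) (ξ (k + 1)) := by
  refine ext_inner_left ℂ fun η => ?_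
  have h1 : ⟪lp.single 2 k η, (star (G.S e)).1 ξ⟫_ℂ = ⟪η, (star (G.S e)).1 ξ k⟫_ℂ :=
    lp.inner_single_left k η _
  have h2 : ⟪lp.single 2 k η, (star (G.S e)).1 ξ⟫_ℂ = ⟪(G.S e).1 (lp.single 2 k η), ξ⟫_ℂ :=
    ContinuousLinearMap.adjoint_inner_right _ _ _
  have h3 : (G.S e).1 (lp.single 2 k η) = lp.single 2 (k + 1) (Xk.create e k η) := by
    ext j : 2
    cases j with
    | zero => rw [S_apply_zero, lp.single_apply_ne 2 _ _ (Nat.succ_ne_zero k).symm]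
    | succ j =>
      rw [S_apply_succ]
      by_cases hj : j = k
      · subst hj; simp
      · rw [lp.single_apply_ne 2 _ _ hj, lp.single_apply_ne 2 _ _ (by simpa using hj), map_zero]
  rw [← h1, h2, h3, lp.inner_single_left]
  exact (ContinuousLinearMap.adjoint_inner_right _ _ _).symm

open Classical in
lemma star_S_mul_S (e f : Ed) : star (G.S e) * G.S f = if e = f then G.P (G.s e) else 0 := by
  refine Subtype.ext (ContinuousLinearMap.ext fun ξ => ?_)
  ext k : 2
  change (star (G.S e)).1 ((G.S f).1 ξ) k = _
  rw [star_S_apply, S_apply_succ, Xk.adjoint_create_create]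
  split_ifs <;> rfl

lemma S_mul_P (e : Ed) : G.S e * G.P (G.s e) = G.S e := by
  refine Subtype.ext (ContinuousLinearMap.ext fun ξ => ?_)
  ext k : 2
  cases k with
  | zero => rfl
  | succ k => exact Xk.create_leftAct e k (ξ k)

lemma P_mul_S (e : Ed) : G.P (G.r e) * G.S e = G.S e := by
  refine Subtype.ext (ContinuousLinearMap.ext fun ξ => ?_)
  ext k : 2
  cases k with
  | zero => exact map_zero (Xk.leftAct G 0 _)
  | succ k => exact Xk.leftAct_create e k (ξ k)

/-- The entries of `∑ₑ Sₑ diag(T) Sₑ^*`. -/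
def Xk.oneTensorSeq (T : (k : ℕ) → (G.Xk k →L[ℂ] G.Xk k)) : (k : ℕ) → (G.Xk k →L[ℂ] G.Xk k)
  | 0 => 0
  | k + 1 => Xk.oneTensor (T k)

lemma coe_sum_apply {ι : Type*} (s : Finset ι) (X : ι → G.adjointableOps) (ξ : G.Fock) (k : ℕ) :
    (∑ i ∈ s, X i).1 ξ k = ∑ i ∈ s, (X i).1 ξ k := by
  rw [AddSubmonoidClass.coe_finsetSum, _root_.sum_apply, lp.coeFn_sum,
    Finset.sum_apply]

lemma IsDiag.sum_S {X : G.adjointableOps} {T : (k : ℕ) → (G.Xk k →L[ℂ] G.Xk k)}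
    (hX : IsDiag X T) : IsDiag (∑ e, G.S e * X * Star.star (G.S e)) (Xk.oneTensorSeq T) := by
  intro ξ k
  rw [coe_sum_apply]
  cases k with
  | zero => exact Finset.sum_eq_zero fun e _ => rfl
  | succ k =>
    rw [Xk.oneTensorSeq, Xk.oneTensor, _root_.sum_apply]
    refine Finset.sum_congr rfl fun e _ => ?_
    change (G.S e).1 (X.1 ((Star.star (G.S e)).1 ξ)) (k + 1) = _
    rw [S_apply_succ, hX, star_S_apply]
    rfl

/-- Only the summand of the vertices is missed, and its projection is compact; hence the ranges of
the `uₑ` add up to `1` in the quotient. -/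
lemma sum_S_mul_star_S : ∑ e, G.S e * star (G.S e) = 1 - G.Q 0 := by
  classical
  have h := (IsDiag.one (G := G)).sum_S
  simp only [mul_one] at h
  refine h.ext ((IsDiag.one.sub (isDiag_Q 0)).congr (funext fun k => ?_))
  cases k with
  | zero => simp [Xk.oneTensorSeq]
  | succ k =>
    refine ContinuousLinearMap.ext fun ξ => ?_
    rw [Xk.oneTensorSeq, Xk.oneTensor, _root_.sum_apply]
    simpa using (Xk.sum_create_adjoint_create k ξ).symm

lemma sum_P : ∑ v, G.P v = 1 := by
  classical
  refine Subtype.ext (ContinuousLinearMap.ext fun ξ => ?_)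
  ext k α
  rw [coe_sum_apply, WithLp.ofLp_sum, Finset.sum_apply]
  have : ∀ v, (G.P v).1 ξ k α = Fock.delta v α.range * ξ k α := fun _ => rfl
  simp only [this, Fock.delta]
  simp

open Classical in
lemma P_mul_P (v w : V) : G.P v * G.P w = if v = w then G.P v else 0 := by
  refine Subtype.ext (ContinuousLinearMap.ext fun ξ => ?_)
  ext k α
  have h1 : (G.P v * G.P w).1 ξ k α = Fock.delta v α.range * (Fock.delta w α.range * ξ k α) := rfl
  have h2 : (G.P v).1 ξ k α = Fock.delta v α.range * ξ k α := rfl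
  rw [h1]
  split_ifs with h
  · rw [h2, ← h]
    by_cases h' : α.range = v <;> simp [Fock.delta, h']
  · change _ = (0 : ℂ)
    by_cases h' : α.range = v
    · simp [Fock.delta, h', h]
    · simp [Fock.delta, h']

lemma opL_mul_P (Z : G.WeightSequence) (v : V) : Z.opL * G.P v = G.P v * Z.opL :=
  ((isDiag_opL Z).mul (isDiag_P v)).ext
    (((isDiag_P v).mul (isDiag_opL Z)).congr (funext fun k => (Z.comm_left k _).symm))

lemma star_opL (Z : G.WeightSequence) : star Z.opL = Z.opL :=
  (isDiag_opL Z).star.ext ((isDiag_opL Z).congr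
    (funext fun k => (Z.positive k).isSelfAdjoint.star_eq.symm))

lemma star_P (v : V) : star (G.P v) = G.P v := by
  classical
  refine (isDiag_P v).star.ext ((isDiag_P v).congr (funext fun k => ?_))
  refine ((ContinuousLinearMap.eq_adjoint_iff _ _).2 fun x y => ?_)
  rw [PiLp.inner_apply, PiLp.inner_apply]
  refine Finset.sum_congr rfl fun α _ => ?_
  rw [Xk.leftAct_apply, Xk.leftAct_apply]
  by_cases h : α.range = v <;> simp [Fock.delta, h]

/-! ### Relations in the quotient -/

variable (G) in
/-- The quotient map as a `*`-homomorphism. -/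
def qStar : G.adjointableOps →⋆ₐ[ℂ] G.QuotAlg where
  __ := QuotAlg.q G
  map_star' := QuotAlg.q_star

lemma q_Q (k : ℕ) : QuotAlg.q G (G.Q k) = 0 := (QuotAlg.q_eq_zero_iff _).2 (Q_mem_compactOps k)

open Classical in
lemma star_u_mul_u (e f : Ed) : star (G.u e) * G.u f = if e = f then G.pv (G.s e) else 0 := by
  rw [u, u, ← QuotAlg.q_star, ← map_mul, star_S_mul_S]
  split_ifs <;> simp [pv]

lemma star_u_mul_u_self (e : Ed) : star (G.u e) * G.u e = G.pv (G.s e) := by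
  classical rw [star_u_mul_u, if_pos rfl]

lemma star_u_mul_u_of_ne {e f : Ed} (h : e ≠ f) : star (G.u e) * G.u f = 0 := by
  classical rw [star_u_mul_u, if_neg h]

lemma sum_u_mul_star_u : ∑ e, G.u e * star (G.u e) = 1 := by
  have h := congrArg (QuotAlg.q G) (sum_S_mul_star_S (G := G))
  rw [map_sub, q_Q, sub_zero, map_one, map_sum] at h
  simpa only [map_mul, QuotAlg.q_star, u] using h

@[simp] lemma u_mul_pv (e : Ed) : G.u e * G.pv (G.s e) = G.u e := by
  rw [u, pv, ← map_mul, S_mul_P]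

@[simp] lemma pv_mul_u (e : Ed) : G.pv (G.r e) * G.u e = G.u e := by
  rw [u, pv, ← map_mul, P_mul_S]

@[simp] lemma pv_mul_self (v : V) : G.pv v * G.pv v = G.pv v := by
  classical rw [pv, ← map_mul, P_mul_P, if_pos rfl]

lemma pv_mul_pv_of_ne {v w : V} (h : v ≠ w) : G.pv v * G.pv w = 0 := by
  classical rw [pv, pv, ← map_mul, P_mul_P, if_neg h, map_zero]

@[simp] lemma star_pv (v : V) : star (G.pv v) = G.pv v := by
  rw [pv, ← QuotAlg.q_star, star_P]

lemma sum_pv : ∑ v, G.pv v = 1 := by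
  have h := congrArg (QuotAlg.q G) (sum_P (G := G))
  rwa [map_sum, map_one] at h

lemma pv_mul_u_of_ne {v : V} {e : Ed} (h : v ≠ G.r e) : G.pv v * G.u e = 0 := by
  rw [← pv_mul_u, ← mul_assoc, pv_mul_pv_of_ne h, zero_mul]

lemma u_mul_pv_of_ne {v : V} {e : Ed} (h : G.s e ≠ v) : G.u e * G.pv v = 0 := by
  rw [← u_mul_pv, mul_assoc, pv_mul_pv_of_ne h, mul_zero]

@[simp] lemma pv_mul_star_u (e : Ed) : G.pv (G.s e) * star (G.u e) = star (G.u e) := by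
  have := congrArg star (u_mul_pv (G := G) e)
  rwa [star_mul, star_pv] at this

@[simp] lemma star_u_mul_pv (e : Ed) : star (G.u e) * G.pv (G.r e) = star (G.u e) := by
  have := congrArg star (pv_mul_u (G := G) e)
  rwa [star_mul, star_pv] at this

namespace WeightSequence

variable (Z : G.WeightSequence)

lemma z_mul_pv (v : V) : Z.z * G.pv v = G.pv v * Z.z := by
  rw [z, pv, ← map_mul, opL_mul_P, map_mul]

end WeightSequence

/-- The map `x ↦ ∑ₑ uₑ x uₑ^*`. -/
def sumConj (x : G.QuotAlg) : G.QuotAlg := ∑ e, G.u e * x * star (G.u e)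

lemma _root_.Function.iterate_map_comm {α β : Type*} {f : α → α} {g : β → β} {φ : α → β}
    (h : ∀ x, φ (f x) = g (φ x)) (n : ℕ) (x : α) : φ (f^[n] x) = g^[n] (φ x) :=
  (Function.Semiconj.iterate_right h n) x

/-- The `p`-th iterate of `X ↦ ∑ₑ Sₑ X Sₑ^*` at `Z` is diagonal with entry `I_p ⊗ Z_k` in position
`k + p`. Condition A(p) says that its difference from `Z` has entries tending to zero, hence is
compact. -/
lemma WeightSequence.ConditionA.sumConj_iterate_z {Z : G.WeightSequence} {p : ℕ}
    (hA : Z.ConditionA p) : sumConj^[p] Z.z = Z.z := by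
  set Φ : G.adjointableOps → G.adjointableOps := fun X => ∑ e, G.S e * X * star (G.S e) with hΦ
  have hq : ∀ X, QuotAlg.q G (Φ X) = sumConj (QuotAlg.q G X) := fun X => by
    rw [hΦ, map_sum, sumConj]
    simp only [map_mul, QuotAlg.q_star, u]
  have hd : ∀ n, IsDiag (Φ^[n] Z.opL) (Xk.oneTensorSeq^[n] Z.op) := fun n => by
    induction n with
    | zero => exact isDiag_opL Z
    | succ n ih =>
      rw [Function.iterate_succ_apply', Function.iterate_succ_apply']
      exact ih.sum_S
  have hT : ∀ n k, Xk.oneTensorSeq^[n] Z.op (k + n) = Xk.idTensor (Z.op k) n := fun n k => by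
    induction n with
    | zero => rfl
    | succ n ih =>
      rw [Function.iterate_succ_apply']
      change Xk.oneTensor (Xk.oneTensorSeq^[n] Z.op (k + n)) = _
      rw [ih]
      rfl
  rw [WeightSequence.z, ← Function.iterate_map_comm hq, ← sub_eq_zero, ← map_sub,
    QuotAlg.q_eq_zero_iff]
  refine ((hd p).sub (isDiag_opL Z)).mem_compactOps ?_
  rw [← Filter.tendsto_add_atTop_iff_nat p]
  simp only [hT]
  exact hA

end DirGraph
end

/-! ### Path isometries, the coefficient algebra, and `𝓒_n` as a matrix algebra over it. -/

noncomputable section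

/-- Induction for the closed `*`-subalgebra generated by a set. -/
lemma NonUnitalStarAlgebra.closure_adjoin_induction {B : Type*} [NonUnitalRing B] [Module ℂ B]
    [IsScalarTower ℂ B B] [SMulCommClass ℂ B B] [StarRing B] [StarModule ℂ B] [TopologicalSpace B]
    [IsTopologicalSemiring B] [ContinuousStar B] [ContinuousConstSMul ℂ B] {s : Set B}
    {p : B → Prop} (closed : IsClosed {x | p x}) (mem : ∀ x ∈ s, p x) (zero : p 0)
    (add : ∀ x y, p x → p y → p (x + y)) (mul : ∀ x y, p x → p y → p (x * y))
    (smul : ∀ (c : ℂ) x, p x → p (c • x)) (star : ∀ x, p x → p (star x)) {x : B}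
    (hx : x ∈ (adjoin ℂ s).topologicalClosure) : p x := by
  refine closed.closure_subset_iff.2 (fun y hy => ?_) hx
  exact adjoin_induction (R := ℂ) (p := fun y _ => p y) mem (fun x y _ _ => add x y) zero
    (fun x y _ _ => mul x y) (fun c x _ => smul c x) (fun x _ => star x) hy

namespace DirGraph

variable {V Ed : Type*} {G : DirGraph V Ed} [Fintype V] [Fintype Ed]

/-! ### The partial isometries of paths -/

section uPath

variable {k : ℕ}

lemma uPath_zero (α : G.Path 0) : uPath α = G.pv α.source := by
  rw [uPath, List.eq_nil_of_length_eq_zero α.length_eq]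
  rfl

lemma uPath_succ (α : G.Path (k + 1)) : uPath α = G.u α.head * uPath α.tail := by
  rw [uPath, Path.edges_eq]
  rfl

lemma uPath_cons (e : Ed) (α : G.Path k) (h) : uPath (α.cons e h) = G.u e * uPath α := rfl

lemma uPath_mul_pv (α : G.Path k) : uPath α * G.pv α.source = uPath α := by
  induction k with
  | zero => rw [uPath_zero, pv_mul_self]
  | succ k ih => rw [uPath_succ, mul_assoc, ← Path.source_tail, ih]

lemma uPath_mul_pv_of_ne (α : G.Path k) {v : V} (h : α.source ≠ v) : uPath α * G.pv v = 0 := by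
  rw [← uPath_mul_pv, mul_assoc, pv_mul_pv_of_ne h, mul_zero]

lemma pv_mul_star_uPath (α : G.Path k) : G.pv α.source * star (uPath α) = star (uPath α) := by
  have := congrArg star (uPath_mul_pv α)
  rwa [star_mul, star_pv] at this

lemma pv_mul_uPath (α : G.Path k) : G.pv α.range * uPath α = uPath α := by
  cases k with
  | zero =>
    have : α.range = α.source := by
      rw [Path.range, List.eq_nil_of_length_eq_zero α.length_eq]
      rfl
    rw [uPath_zero, this, pv_mul_self]
  | succ k => rw [uPath_succ, Path.range_eq, ← mul_assoc, pv_mul_u]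

lemma u_mul_uPath_of_ne {e : Ed} {α : G.Path k} (h : G.s e ≠ α.range) :
    G.u e * uPath α = 0 := by
  rw [← pv_mul_uPath, ← mul_assoc, u_mul_pv_of_ne h, zero_mul]

lemma uPath_snoc (α : G.Path k) (e : Ed) (h : α.source = G.r e) :
    uPath (α.snoc e h) = uPath α * G.u e := by
  have key : ∀ (l : List Ed) (v : V), v = G.r e →
      (l ++ [e]).foldr (fun e x => G.u e * x) (G.pv (G.s e)) =
        l.foldr (fun e x => G.u e * x) (G.pv v) * G.u e := by
    intro l v hv
    induction l with
    | nil => simp [hv]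
    | cons f l ih => simp only [List.cons_append, List.foldr_cons, mul_assoc, ih]
  exact key α.edges α.source h

open Classical in
lemma star_uPath_mul_uPath (α β : G.Path k) :
    star (uPath α) * uPath β = if α = β then G.pv α.source else 0 := by
  induction k with
  | zero =>
    rw [uPath_zero, uPath_zero, star_pv]
    split_ifs with h
    · rw [h, pv_mul_self]
    · refine pv_mul_pv_of_ne fun hs => h (Path.ext hs ?_)
      rw [List.eq_nil_of_length_eq_zero α.length_eq, List.eq_nil_of_length_eq_zero β.length_eq]
  | succ k ih =>
    rw [uPath_succ, uPath_succ, star_mul, mul_assoc, ← mul_assoc _ (G.u _)]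
    by_cases hh : α.head = β.head
    · rw [hh, star_u_mul_u_self, Path.s_head, pv_mul_uPath, ih]
      have : α = β ↔ α.tail = β.tail :=
        ⟨fun h => h ▸ rfl, fun h => Path.head_tail_injective (Prod.ext hh h)⟩
      simp only [this]
      rfl
    · rw [star_u_mul_u_of_ne hh, zero_mul, mul_zero, if_neg fun h => hh (congrArg Path.head h)]

lemma star_uPath_mul_self (α : G.Path k) : star (uPath α) * uPath α = G.pv α.source := by
  classical rw [star_uPath_mul_uPath, if_pos rfl]

omit [Fintype V] [Fintype Ed] in
lemma Path.edges_zero (α : G.Path 0) : α.edges = [] := List.eq_nil_of_length_eq_zero α.length_eq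

/-- The vertex `v` as a path of length `0`. -/
def Path.ofVertex (v : V) : G.Path 0 := ⟨v, [], rfl, trivial⟩

omit [Fintype V] [Fintype Ed] in
lemma Path.ofVertex_source (α : G.Path 0) : Path.ofVertex α.source = α :=
  Path.ext rfl α.edges_zero.symm

lemma Path.sum_zero {M : Type*} [AddCommMonoid M] (F : G.Path 0 → M) :
    ∑ α, F α = ∑ v, F (Path.ofVertex v) :=
  (Fintype.sum_bijective Path.ofVertex
    ⟨fun _ _ h => congrArg Path.source h, fun α => ⟨_, Path.ofVertex_source α⟩⟩ _ _
    fun _ => rfl).symm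

/-- The commutation hypothesis serves length `0`, where the sum is `∑ p_v x p_v`. In longer sums the
non-composable words contribute zero. -/
lemma sum_uPath_mul_mul_star_uPath (x : G.QuotAlg) (hx : ∀ v, x * G.pv v = G.pv v * x) :
    ∑ α : G.Path k, uPath α * x * star (uPath α) = sumConj^[k] x := by
  classical
  induction k with
  | zero =>
    rw [Path.sum_zero, Function.iterate_zero_apply]
    have : ∀ v, uPath (Path.ofVertex v : G.Path 0) * x * star (uPath (Path.ofVertex v : G.Path 0))
        = G.pv v * x := fun v => by
      rw [uPath_zero, star_pv, mul_assoc, hx, ← mul_assoc]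
      exact congrArg (· * x) (pv_mul_self v)
    simp only [this]
    rw [← Finset.sum_mul, sum_pv, one_mul]
  | succ k ih =>
    rw [Path.sum_succ, Function.iterate_succ_apply', ← ih, sumConj]
    refine Finset.sum_congr rfl fun e _ => ?_
    rw [Finset.mul_sum, Finset.sum_mul]
    refine Finset.sum_congr rfl fun γ _ => ?_
    have h : G.u e * (uPath γ * x * star (uPath γ)) * star (G.u e) =
        (G.u e * uPath γ) * x * star (G.u e * uPath γ) := by
      rw [star_mul]; noncomm_ring
    split_ifs with hs
    · rw [uPath_cons, h]
    · rw [h, u_mul_uPath_of_ne hs]; simp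

lemma sum_uPath_mul_star_uPath (k : ℕ) : ∑ α : G.Path k, uPath α * star (uPath α) = 1 := by
  have h := sum_uPath_mul_mul_star_uPath (G := G) (k := k) 1 (by simp)
  simp only [mul_one] at h
  have h1 : sumConj (1 : G.QuotAlg) = 1 := by simpa [sumConj] using sum_u_mul_star_u (G := G)
  rw [h, Function.iterate_fixed h1]

/-- The matrix expansion of an element along the paths of length `k` and `l`. -/
lemma eq_sum_uPath (k l : ℕ) (x : G.QuotAlg) :
    x = ∑ μ : G.Path k, ∑ ν : G.Path l,
      uPath μ * (star (uPath μ) * x * uPath ν) * star (uPath ν) := by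
  have h : x = (∑ μ : G.Path k, uPath μ * star (uPath μ)) * x *
      ∑ ν : G.Path l, uPath ν * star (uPath ν) := by
    rw [sum_uPath_mul_star_uPath, sum_uPath_mul_star_uPath, one_mul, mul_one]
  conv_lhs => rw [h, Finset.sum_mul, Finset.sum_mul]
  refine Finset.sum_congr rfl fun μ _ => ?_
  rw [Finset.mul_sum]
  refine Finset.sum_congr rfl fun ν _ => ?_
  noncomm_ring

end uPath

lemma mul_eq_sum_u (x y : G.QuotAlg) : x * y = ∑ e, (x * G.u e) * (star (G.u e) * y) := by
  conv_lhs => rw [← mul_one x, ← sum_u_mul_star_u, Finset.mul_sum, Finset.sum_mul]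
  exact Finset.sum_congr rfl fun e _ => by noncomm_ring

lemma mul_eq_sum_uPath (k : ℕ) (x y : G.QuotAlg) :
    x * y = ∑ α : G.Path k, (x * uPath α) * (star (uPath α) * y) := by
  conv_lhs => rw [← mul_one x, ← sum_uPath_mul_star_uPath k, Finset.mul_sum, Finset.sum_mul]
  exact Finset.sum_congr rfl fun e _ => by noncomm_ring

/-! ### The map `x ↦ ∑ uₑ x uₑ^*` -/

open Classical in
lemma star_u_mul_sumConj_mul_u (x : G.QuotAlg) (e f : Ed) :
    star (G.u e) * sumConj x * G.u f =
      if e = f then G.pv (G.s e) * x * G.pv (G.s e) else 0 := by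
  rw [sumConj, Finset.mul_sum, Finset.sum_mul, Finset.sum_eq_single e]
  · have : star (G.u e) * (G.u e * x * star (G.u e)) * G.u f =
        (star (G.u e) * G.u e) * x * (star (G.u e) * G.u f) := by noncomm_ring
    rw [this, star_u_mul_u_self, star_u_mul_u]
    split_ifs <;> simp
  · intro g _ hg
    have : star (G.u e) * (G.u g * x * star (G.u g)) * G.u f =
        (star (G.u e) * G.u g) * x * (star (G.u g) * G.u f) := by noncomm_ring
    rw [this, star_u_mul_u_of_ne hg.symm]
    simp
  · simp

/-- Inserting `∑ uf uf^* = 1` on the left leaves only the term of `e`. This is the commutation rule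
that lets `z_j` pass through paths, raising its index by the length. -/
lemma sumConj_mul_u (x : G.QuotAlg) (hx : ∀ v, x * G.pv v = G.pv v * x) (e : Ed) :
    sumConj x * G.u e = G.u e * x := by
  have h := mul_eq_sum_u 1 (sumConj x * G.u e)
  rw [one_mul] at h
  rw [h, Finset.sum_eq_single e]
  · classical
    rw [← mul_assoc (star _), star_u_mul_sumConj_mul_u, if_pos rfl, one_mul, mul_assoc (G.pv _), hx,
      ← mul_assoc (G.pv _), pv_mul_self, ← mul_assoc, u_mul_pv]
  · intro f _ hf
    classical
    rw [← mul_assoc (star _), star_u_mul_sumConj_mul_u, if_neg hf, mul_zero]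
  · simp

lemma sumConj_mul_pv (x : G.QuotAlg) (v : V) : sumConj x * G.pv v = G.pv v * sumConj x := by
  rw [sumConj, Finset.sum_mul, Finset.mul_sum]
  refine Finset.sum_congr rfl fun e _ => ?_
  by_cases h : v = G.r e
  · rw [h, mul_assoc, star_u_mul_pv, ← mul_assoc, ← mul_assoc, pv_mul_u]
  · have h1 := pv_mul_u_of_ne h
    have h2 := congrArg star h1
    rw [star_mul, star_pv, star_zero] at h2
    rw [mul_assoc, h2, ← mul_assoc, ← mul_assoc, h1]
    simp

namespace WeightSequence

variable (Z : G.WeightSequence)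

/-- The elements `z_j = ∑ u_α z u_α^*`, the sum over the paths `α` of length `j`. -/
def zShift (j : ℕ) : G.QuotAlg := sumConj^[j] Z.z

lemma zShift_succ (j : ℕ) : Z.zShift (j + 1) = sumConj (Z.zShift j) :=
  Function.iterate_succ_apply' _ _ _

lemma zShift_mul_pv (j : ℕ) (v : V) : Z.zShift j * G.pv v = G.pv v * Z.zShift j := by
  cases j with
  | zero => exact Z.z_mul_pv v
  | succ j => rw [zShift_succ, sumConj_mul_pv]

lemma uPath_mul_zShift {k : ℕ} (α : G.Path k) (j : ℕ) :
    uPath α * Z.zShift j = Z.zShift (j + k) * uPath α := by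
  induction k with
  | zero => rw [uPath_zero, add_zero, zShift_mul_pv]
  | succ k ih =>
    rw [uPath_succ, mul_assoc, ih, ← mul_assoc, ← sumConj_mul_u _ (Z.zShift_mul_pv _), mul_assoc,
      ← zShift_succ]
    rfl

/-- The coefficient algebra: the closed `*`-subalgebra generated by the `z_j` and the `p_v`. -/
def coeffAlg : NonUnitalStarSubalgebra ℂ G.QuotAlg :=
  (NonUnitalStarAlgebra.adjoin ℂ (Set.range Z.zShift ∪ Set.range G.pv)).topologicalClosure

lemma isClosed_coeffAlg : IsClosed (Z.coeffAlg : Set G.QuotAlg) := isClosed_closure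

lemma zShift_mem (j : ℕ) : Z.zShift j ∈ Z.coeffAlg :=
  subset_closure (NonUnitalStarAlgebra.subset_adjoin ℂ _ (Or.inl ⟨j, rfl⟩))

lemma pv_mem (v : V) : G.pv v ∈ Z.coeffAlg :=
  subset_closure (NonUnitalStarAlgebra.subset_adjoin ℂ _ (Or.inr ⟨v, rfl⟩))

lemma one_mem : (1 : G.QuotAlg) ∈ Z.coeffAlg := by
  rw [← sum_pv]
  exact sum_mem fun v _ => Z.pv_mem v

variable {Z}

lemma coeffAlg_induction {p : G.QuotAlg → Prop} (closed : IsClosed {x | p x})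
    (zShift : ∀ j, p (Z.zShift j)) (pv : ∀ v, p (G.pv v)) (zero : p 0)
    (add : ∀ x y, p x → p y → p (x + y)) (mul : ∀ x y, p x → p y → p (x * y))
    (smul : ∀ (c : ℂ) x, p x → p (c • x)) (star : ∀ x, p x → p (star x)) {x : G.QuotAlg}
    (hx : x ∈ Z.coeffAlg) : p x := by
  refine NonUnitalStarAlgebra.closure_adjoin_induction closed ?_ zero add mul smul star hx
  rintro _ (⟨j, rfl⟩ | ⟨v, rfl⟩)
  exacts [zShift j, pv v]

lemma mul_pv_of_mem_coeffAlg {x : G.QuotAlg} (hx : x ∈ Z.coeffAlg) (v : V) :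
    x * G.pv v = G.pv v * x := by
  refine coeffAlg_induction (p := fun x => x * G.pv v = G.pv v * x)
    (isClosed_eq (by fun_prop) (by fun_prop)) (fun j => Z.zShift_mul_pv j v) ?_ (by simp) ?_ ?_ ?_
    ?_ hx
  · intro w
    by_cases h : v = w
    · rw [h]
    · rw [pv_mul_pv_of_ne h, pv_mul_pv_of_ne (Ne.symm h)]
  · intro x y hx hy; rw [add_mul, mul_add, hx, hy]
  · intro x y hx hy; rw [mul_assoc, hy, ← mul_assoc, hx, mul_assoc]
  · intro c x hx; rw [smul_mul_assoc, mul_smul_comm, hx]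
  · intro x hx
    have := congrArg star hx
    rw [star_mul, star_mul, star_pv] at this
    exact this.symm

/-- Elements of the coefficient algebra are diagonal along edges, with entries again in the algebra.
Products reduce to their factors by inserting `∑ u_g u_g^* = 1`. -/
lemma conj_mem_coeffAlg {p : ℕ} (hp : 1 ≤ p) (hA : Z.ConditionA p) {x : G.QuotAlg}
    (hx : x ∈ Z.coeffAlg) (e f : Ed) :
    star (G.u e) * x * G.u f ∈ Z.coeffAlg ∧ (e ≠ f → star (G.u e) * x * G.u f = 0) := by
  revert e f
  refine coeffAlg_induction (p := fun x => ∀ e f, star (G.u e) * x * G.u f ∈ Z.coeffAlg ∧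
    (e ≠ f → star (G.u e) * x * G.u f = 0)) ?_ ?_ ?_ ?_ ?_ ?_ ?_ ?_ hx
  · simp only [Set.ofPred_forall, Set.ofPred_and]
    refine isClosed_iInter fun e => isClosed_iInter fun f => IsClosed.inter ?_
      (isClosed_iInter fun _ => isClosed_eq (by fun_prop) (by fun_prop))
    exact Z.isClosed_coeffAlg.preimage
      (by fun_prop : Continuous fun x => star (G.u e) * x * G.u f)
  · intro j e f
    -- Periodicity makes every `z_j`, including `z_0 = z`, a value of `sumConj`, whose compressions
    -- by edges are explicit.
    have hj : Z.zShift j = sumConj (Z.zShift (j + p - 1)) := by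
      rw [← zShift_succ, Nat.sub_add_cancel (hp.trans (Nat.le_add_left _ _)), zShift, zShift,
        Function.iterate_add_apply, hA.sumConj_iterate_z]
    classical
    rw [hj, star_u_mul_sumConj_mul_u]
    split_ifs with h
    · exact ⟨mul_mem (mul_mem (Z.pv_mem _) (Z.zShift_mem _)) (Z.pv_mem _), fun h' => absurd h h'⟩
    · exact ⟨zero_mem _, fun _ => rfl⟩
  · intro v e f
    by_cases h : v = G.r e
    · rw [h, star_u_mul_pv]
      classical
      rw [star_u_mul_u]
      split_ifs with h'
      · exact ⟨Z.pv_mem _, fun h => absurd h' h⟩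
      · exact ⟨zero_mem _, fun _ => rfl⟩
    · have h2 := congrArg star (pv_mul_u_of_ne h)
      rw [star_mul, star_pv, star_zero] at h2
      rw [h2, zero_mul]
      exact ⟨zero_mem _, fun _ => rfl⟩
  · intro e f; simp
  · intro x y hx hy e f
    rw [mul_add, add_mul]
    exact ⟨add_mem (hx e f).1 (hy e f).1, fun h => by rw [(hx e f).2 h, (hy e f).2 h, add_zero]⟩
  · intro x y hx hy e f
    have h : star (G.u e) * (x * y) * G.u f =
        ∑ g, (star (G.u e) * x * G.u g) * (star (G.u g) * y * G.u f) := by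
      rw [← mul_assoc, mul_assoc _ y, mul_eq_sum_u]
      simp only [mul_assoc]
    rw [h]
    refine ⟨sum_mem fun g _ => mul_mem (hx e g).1 (hy g f).1, fun hef =>
      Finset.sum_eq_zero fun g _ => ?_⟩
    by_cases hg : e = g
    · rw [(hy g f).2 (hg ▸ hef), mul_zero]
    · rw [(hx e g).2 hg, zero_mul]
  · intro c x hx e f
    rw [mul_smul_comm, smul_mul_assoc]
    exact ⟨SMulMemClass.smul_mem c (hx e f).1, fun h => by rw [(hx e f).2 h, smul_zero]⟩
  · intro x hx e f
    have h : star (G.u e) * star x * G.u f = star (star (G.u f) * x * G.u e) := by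
      rw [star_mul, star_mul, star_star, mul_assoc]
    rw [h]
    exact ⟨star_mem (hx f e).1, fun hef => by rw [(hx f e).2 hef.symm, star_zero]⟩

/-- Inserting `∑ uf uf^* = 1`, the off-diagonal terms vanish by `conj_mem_coeffAlg`. -/
lemma mul_u_of_mem_coeffAlg {p : ℕ} (hp : 1 ≤ p) (hA : Z.ConditionA p) {x : G.QuotAlg}
    (hx : x ∈ Z.coeffAlg) (e : Ed) : x * G.u e = G.u e * (star (G.u e) * x * G.u e) := by
  have h := mul_eq_sum_u 1 (x * G.u e)
  rw [one_mul] at h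
  rw [h, Finset.sum_eq_single e]
  · rw [one_mul, ← mul_assoc (star _)]
  · intro f _ hf
    rw [← mul_assoc (star _), (conj_mem_coeffAlg hp hA hx f e).2 hf, mul_zero]
  · simp

end WeightSequence

/-! ### The matrix algebras over the coefficient algebra -/

/-- The elements all of whose compressions `uₑ^* x u_f` lie in a given `*`-subalgebra. -/
def conjPreimage (A : NonUnitalStarSubalgebra ℂ G.QuotAlg) :
    NonUnitalStarSubalgebra ℂ G.QuotAlg where
  carrier := {x | ∀ e f, star (G.u e) * x * G.u f ∈ A}
  zero_mem' := fun e f => by simp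
  add_mem' := fun {x y} hx hy e f => by
    rw [mul_add, add_mul]
    exact add_mem (hx e f) (hy e f)
  mul_mem' := fun {x y} hx hy e f => by
    have h : star (G.u e) * (x * y) * G.u f =
        ∑ g, (star (G.u e) * x * G.u g) * (star (G.u g) * y * G.u f) := by
      rw [← mul_assoc, mul_assoc _ y, mul_eq_sum_u]
      simp only [mul_assoc]
    rw [h]
    exact sum_mem fun g _ => mul_mem (hx e g) (hy g f)
  smul_mem' := fun c x hx e f => by
    rw [mul_smul_comm, smul_mul_assoc]
    exact SMulMemClass.smul_mem c (hx e f)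
  star_mem' := fun {x} hx e f => by
    have h : star (G.u e) * star x * G.u f = star (star (G.u f) * x * G.u e) := by
      rw [star_mul, star_mul, star_star, mul_assoc]
    rw [h]
    exact star_mem (hx f e)

namespace WeightSequence

variable (Z : G.WeightSequence)

/-- The algebra of matrices over the coefficient algebra indexed by the paths of length `k`. -/
def matAlg : ℕ → NonUnitalStarSubalgebra ℂ G.QuotAlg
  | 0 => Z.coeffAlg
  | k + 1 => conjPreimage (matAlg k)

variable {Z}

lemma isClosed_matAlg (k : ℕ) : IsClosed (Z.matAlg k : Set G.QuotAlg) := by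
  induction k with
  | zero => exact Z.isClosed_coeffAlg
  | succ k ih =>
    have : (Z.matAlg (k + 1) : Set G.QuotAlg) =
        ⋂ e, ⋂ f, (fun x => star (G.u e) * x * G.u f) ⁻¹' (Z.matAlg k) := by
      ext x
      simp only [Set.mem_iInter]
      rfl
    rw [this]
    exact isClosed_iInter fun e => isClosed_iInter fun f => ih.preimage (by fun_prop)

section

variable {p : ℕ} (hp : 1 ≤ p) (hA : Z.ConditionA p)
include hp hA

lemma matAlg_le_succ (k : ℕ) : Z.matAlg k ≤ Z.matAlg (k + 1) := by
  induction k with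
  | zero => exact fun x hx e f => (conj_mem_coeffAlg hp hA hx e f).1
  | succ k ih => exact fun x hx e f => ih (hx e f)

lemma matAlg_mono : Monotone Z.matAlg := monotone_nat_of_le_succ (matAlg_le_succ hp hA)

lemma coeffAlg_le_matAlg (k : ℕ) : Z.coeffAlg ≤ Z.matAlg k := matAlg_mono hp hA (Nat.zero_le k)

lemma u_mul_mem_matAlg {k : ℕ} {x : G.QuotAlg} (hx : x ∈ Z.matAlg k) (e f : Ed) :
    G.u e * x * star (G.u f) ∈ Z.matAlg (k + 1) := by
  intro g h
  have hpm : ∀ v, G.pv v ∈ Z.matAlg k := fun v => coeffAlg_le_matAlg hp hA k (Z.pv_mem v)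
  have : star (G.u g) * (G.u e * x * star (G.u f)) * G.u h =
      (star (G.u g) * G.u e) * x * (star (G.u f) * G.u h) := by noncomm_ring
  classical
  rw [this, star_u_mul_u, star_u_mul_u]
  split_ifs
  · exact mul_mem (mul_mem (hpm _) hx) (hpm _)
  all_goals simp

lemma uPath_mul_mem_matAlg {k : ℕ} {x : G.QuotAlg} (hx : x ∈ Z.coeffAlg) (μ ν : G.Path k) :
    uPath μ * x * star (uPath ν) ∈ Z.matAlg k := by
  induction k with
  | zero =>
    rw [uPath_zero, uPath_zero, star_pv]
    exact mul_mem (mul_mem (Z.pv_mem _) hx) (Z.pv_mem _)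
  | succ k ih =>
    have : uPath μ * x * star (uPath ν) =
        G.u μ.head * (uPath μ.tail * x * star (uPath ν.tail)) * star (G.u ν.head) := by
      rw [uPath_succ, uPath_succ, star_mul]; noncomm_ring
    rw [this]
    exact u_mul_mem_matAlg hp hA (ih _ _) _ _

omit hp hA in
lemma star_uPath_mul_mem_coeffAlg {k : ℕ} {x : G.QuotAlg} (hx : x ∈ Z.matAlg k)
    (μ ν : G.Path k) : star (uPath μ) * x * uPath ν ∈ Z.coeffAlg := by
  induction k generalizing x with
  | zero =>
    rw [uPath_zero, uPath_zero, star_pv]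
    exact mul_mem (mul_mem (Z.pv_mem _) hx) (Z.pv_mem _)
  | succ k ih =>
    have : star (uPath μ) * x * uPath ν = star (uPath μ.tail) *
        (star (G.u μ.head) * x * G.u ν.head) * uPath ν.tail := by
      rw [uPath_succ, uPath_succ, star_mul]; noncomm_ring
    rw [this]
    exact ih (hx _ _) _ _

/-- Passes from the recursion by edges that defines `matAlg` to a description by whole paths; the
converse direction is the matrix expansion `eq_sum_uPath`. -/
lemma mem_matAlg_iff {k : ℕ} {x : G.QuotAlg} :
    x ∈ Z.matAlg k ↔ ∀ μ ν : G.Path k, star (uPath μ) * x * uPath ν ∈ Z.coeffAlg := by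
  refine ⟨fun hx => star_uPath_mul_mem_coeffAlg hx, fun h => ?_⟩
  rw [eq_sum_uPath k k x]
  exact sum_mem fun μ _ => sum_mem fun ν _ => uPath_mul_mem_matAlg hp hA (h μ ν) μ ν

omit hp hA in
lemma uPath_mul_mul_star_uPath_of_ne {x : G.QuotAlg} (hx : x ∈ Z.coeffAlg) {k l : ℕ}
    {μ : G.Path k} {ν : G.Path l} (h : μ.source ≠ ν.source) :
    uPath μ * x * star (uPath ν) = 0 := by
  rw [← uPath_mul_pv μ, mul_assoc (uPath μ), ← mul_pv_of_mem_coeffAlg hx, ← mul_assoc, mul_assoc,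
    ← pv_mul_star_uPath, ← mul_assoc (G.pv _), pv_mul_pv_of_ne h, zero_mul, mul_zero]

/-- The generators of `𝓒_n` use paths of length at most `N = np + p - 1`, hence lie in the largest
of the nested algebras. Conversely, an element expands into `u_μ r u_ν^*` with `r` in the
coefficient algebra, and a factor `z_j` of `r` moves past `u_μ` to become `z_{j+N}`. By periodicity
this is a `z_i` with `np ≤ i < (n+1)p`, which is a sum of generators `u_α z u_α^*`. -/
theorem C_eq_matAlg (n : ℕ) : Z.C p n = Z.matAlg (n * p + (p - 1)) := by
  set N := n * p + (p - 1) with hN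
  have hN1 : N < (n + 1) * p := by rw [add_mul, hN]; omega
  refine le_antisymm (fun x hx => ?_) fun x hx => ?_
  · refine NonUnitalStarAlgebra.closure_adjoin_induction (p := fun x => x ∈ Z.matAlg N)
      (isClosed_matAlg N) ?_ (zero_mem _) (fun _ _ => add_mem) (fun _ _ => mul_mem)
      (fun c _ => SMulMemClass.smul_mem c) (fun _ => star_mem) hx
    rintro _ ⟨l, k, α, β, h1, h2, -, rfl⟩
    refine matAlg_mono hp hA (show k ≤ N by rw [add_mul] at h2; omega)
      (uPath_mul_mem_matAlg hp hA ?_ α β)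
    have hz : Z.z ∈ Z.coeffAlg := Z.zShift_mem 0
    induction l with
    | zero => rw [pow_zero]; exact Z.one_mem
    | succ l ih => rw [pow_succ]; exact mul_mem ih hz
  · have hgen : ∀ (l k : ℕ) (α β : G.Path k), n * p ≤ k → k < (n + 1) * p →
        α.source = β.source → uPath α * Z.z ^ l * star (uPath β) ∈ Z.C p n :=
      fun l k α β h1 h2 h3 =>
        subset_closure (NonUnitalStarAlgebra.subset_adjoin ℂ _ ⟨l, k, α, β, h1, h2, h3, rfl⟩)
    have hunit : ∀ μ ν : G.Path N, μ.source = ν.source → uPath μ * star (uPath ν) ∈ Z.C p n := by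
      intro μ ν h
      simpa using hgen 0 N μ ν (by omega) hN1 h
    have hper : ∀ m i, Z.zShift (i + m * p) = Z.zShift i := by
      intro m i
      rw [zShift, zShift, Function.iterate_add_apply, mul_comm, Function.iterate_mul,
        Function.iterate_fixed hA.sumConj_iterate_z]
    have hz : ∀ j, Z.zShift j ∈ Z.C p n := by
      have h1 : ∀ i, n * p ≤ i → i < (n + 1) * p → Z.zShift i ∈ Z.C p n := by
        intro i hi hi'
        rw [zShift, ← sum_uPath_mul_mul_star_uPath _ Z.z_mul_pv]
        exact sum_mem fun α _ => by simpa using hgen 1 i α α hi hi' rfl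
      intro j
      -- The representative of `j` modulo `p` in the window `[np, (n+1)p)` of lengths allowed in
      -- `𝓒_n`.
      have h2 : Z.zShift j = Z.zShift (j % p + n * p) := by
        rw [hper]
        conv_lhs => rw [← Nat.mod_add_div j p, mul_comm, hper]
      rw [h2]
      refine h1 _ (Nat.le_add_left _ _) ?_
      have := Nat.mod_lt j hp
      rw [add_mul]
      omega
    have key : ∀ r ∈ Z.coeffAlg, ∀ μ ν : G.Path N, μ.source = ν.source →
        uPath μ * r * star (uPath ν) ∈ Z.C p n := by
      intro r hr
      -- Membership in the coefficient algebra is carried along because the product step has to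
      -- commute a factor with `p_{s(μ)}`.
      refine (coeffAlg_induction (p := fun r => r ∈ Z.coeffAlg ∧ ∀ μ ν : G.Path N, μ.source = ν.source →
        uPath μ * r * star (uPath ν) ∈ Z.C p n) ?_ ?_ ?_ ?_ ?_ ?_ ?_ ?_ hr).2
      · simp only [Set.ofPred_and, Set.ofPred_forall]
        refine IsClosed.inter Z.isClosed_coeffAlg ?_
        refine isClosed_iInter fun μ => isClosed_iInter fun ν => isClosed_iInter fun _ => ?_
        exact IsClosed.preimage (by fun_prop : Continuous fun r => uPath μ * r * star (uPath ν))
          (isClosed_closure : IsClosed (Z.C p n : Set G.QuotAlg))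
      · refine fun j => ⟨Z.zShift_mem j, fun μ ν h => ?_⟩
        rw [uPath_mul_zShift, mul_assoc]
        exact mul_mem (hz _) (hunit _ _ h)
      · refine fun v => ⟨Z.pv_mem v, fun μ ν h => ?_⟩
        by_cases hv : μ.source = v
        · rw [← hv, uPath_mul_pv]
          exact hunit _ _ h
        · rw [uPath_mul_pv_of_ne _ hv, zero_mul]
          exact zero_mem _
      · exact ⟨zero_mem _, fun μ ν _ => by simp⟩
      · refine fun x y hx hy => ⟨add_mem hx.1 hy.1, fun μ ν h => ?_⟩
        rw [mul_add, add_mul]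
        exact add_mem (hx.2 μ ν h) (hy.2 μ ν h)
      · refine fun x y hx hy => ⟨mul_mem hx.1 hy.1, fun μ ν h => ?_⟩
        have : uPath μ * (x * y) * star (uPath ν) =
            (uPath μ * x * star (uPath μ)) * (uPath μ * y * star (uPath ν)) := by
          have h1 : (uPath μ * x * star (uPath μ)) * (uPath μ * y * star (uPath ν)) =
              uPath μ * x * (star (uPath μ) * uPath μ) * y * star (uPath ν) := by noncomm_ring
          rw [h1, star_uPath_mul_self, mul_assoc _ x, mul_pv_of_mem_coeffAlg hx.1,
            ← mul_assoc (uPath μ) (G.pv _), uPath_mul_pv, ← mul_assoc (uPath μ) x y]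
        rw [this]
        exact mul_mem (hx.2 μ μ rfl) (hy.2 μ ν h)
      · refine fun c x hx => ⟨SMulMemClass.smul_mem c hx.1, fun μ ν h => ?_⟩
        rw [mul_smul_comm, smul_mul_assoc]
        exact SMulMemClass.smul_mem c (hx.2 μ ν h)
      · refine fun x hx => ⟨star_mem hx.1, fun μ ν h => ?_⟩
        have : uPath μ * star x * star (uPath ν) = star (uPath ν * x * star (uPath μ)) := by
          rw [star_mul, star_mul, star_star, mul_assoc]
        rw [this]
        exact star_mem (hx.2 ν μ h.symm)
    rw [eq_sum_uPath N N x]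
    refine sum_mem fun μ _ => sum_mem fun ν _ => ?_
    have hr := star_uPath_mul_mem_coeffAlg hx μ ν
    by_cases h : μ.source = ν.source
    · exact key _ hr μ ν h
    · rw [uPath_mul_mul_star_uPath_of_ne hr h]
      exact zero_mem _

end

end WeightSequence

end DirGraph
end

/-! ### The creation operators lie in the weighted Toeplitz algebra; degrees under the gauge action.
-/

noncomputable section

namespace DirGraph

variable {V Ed : Type*} {G : DirGraph V Ed} [Fintype V] [Fintype Ed]

/-! ### The weighted Toeplitz algebra contains the creation operators -/

lemma isClosed_adjointableOps :
    IsClosed (G.adjointableOps : Set (G.Fock →L[ℂ] G.Fock)) := by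
  have : (G.adjointableOps : Set (G.Fock →L[ℂ] G.Fock)) =
      ⋂ v, ⋂ ξ, {T | T (Fock.rightAct G (Fock.delta v) ξ) = Fock.rightAct G (Fock.delta v) (T ξ)} := by
    ext T
    simp only [Set.mem_iInter]
    exact Fock.isAdjointable_iff T
  rw [this]
  exact isClosed_iInter fun v => isClosed_iInter fun ξ => isClosed_eq (by fun_prop) (by fun_prop)

lemma IsDiag.isPositive {X : G.adjointableOps} {T : (k : ℕ) → (G.Xk k →L[ℂ] G.Xk k)}
    (hX : IsDiag X T) (hT : ∀ k, (T k).IsPositive) : X.1.IsPositive := by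
  have hsa : Star.star X = X :=
    hX.star.ext (hX.congr (funext fun k => (hT k).isSelfAdjoint.star_eq.symm))
  rw [ContinuousLinearMap.isPositive_def']
  refine ⟨congrArg Subtype.val hsa, fun ξ => ?_⟩
  rw [ContinuousLinearMap.reApplyInnerSelf_apply, lp.inner_eq_tsum, RCLike.re_tsum]
  · exact tsum_nonneg fun k => by rw [hX]; exact (hT k).re_inner_nonneg_left _
  · exact lp.summable_inner _ _

/-- From `ε ≤ T ≤ c` follows `0 ≤ 1 - T / c ≤ 1 - ε / c`, and for positive operators the order
bounds the norm. -/
lemma norm_one_sub_smul_le {E : Type*} [NormedAddCommGroup E] [InnerProductSpace ℂ E]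
    [CompleteSpace E] {T : E →L[ℂ] E} {c ε : ℝ} (hc : 0 < c) (hεc : ε ≤ c) (hT : T.IsPositive)
    (hTc : ‖T‖ ≤ c) (hTε : (T - (ε : ℂ) • ContinuousLinearMap.id ℂ E).IsPositive) :
    ‖1 - (c⁻¹ : ℂ) • T‖ ≤ 1 - ε / c := by
  have hsm : ∀ (r : ℝ) (A : E →L[ℂ] E), (r : ℂ) • A = r • A := fun r A => by
    ext x; simp
  have hc' : (c⁻¹ : ℂ) • T = c⁻¹ • T := by rw [← hsm]; push_cast; rfl
  have hT0 : 0 ≤ T := (ContinuousLinearMap.nonneg_iff_isPositive T).2 hT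
  have h1 : T ≤ algebraMap ℝ _ c := (CStarAlgebra.norm_le_iff_le_algebraMap T hc.le hT0).1 hTc
  have h2 : algebraMap ℝ _ ε ≤ T := by
    rw [ContinuousLinearMap.le_def, Algebra.algebraMap_eq_smul_one, ← hsm]
    exact hTε
  have hci : 0 ≤ c⁻¹ := inv_nonneg.2 hc.le
  rw [hc']
  have h3 : 0 ≤ 1 - c⁻¹ • T := by
    have := smul_le_smul_of_nonneg_left h1 hci
    rw [Algebra.algebraMap_eq_smul_one, smul_smul, inv_mul_cancel₀ hc.ne', one_smul] at this
    exact sub_nonneg.2 this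
  rw [CStarAlgebra.norm_le_iff_le_algebraMap _ (sub_nonneg.2 ((div_le_one hc).2 hεc)) h3, map_sub,
    map_one]
  have := smul_le_smul_of_nonneg_left h2 hci
  rw [Algebra.algebraMap_eq_smul_one, smul_smul] at this
  rw [Algebra.algebraMap_eq_smul_one, div_eq_inv_mul]
  exact sub_le_sub_left this 1

namespace WeightSequence

variable (Z : G.WeightSequence)

lemma isClosed_toeplitz : IsClosed (Z.toeplitz : Set G.adjointableOps) := isClosed_closure

lemma opL_mul_S_mem (e : Ed) : Z.opL * G.S e ∈ Z.toeplitz :=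
  subset_closure (NonUnitalStarAlgebra.subset_adjoin ℂ _ ⟨e, rfl⟩)

lemma isDiag_opL_sub_Q : IsDiag (Z.opL - G.Q 0) fun k => if k = 0 then 0 else Z.op k := by
  refine ((isDiag_opL Z).sub (isDiag_Q 0)).congr (funext fun k => ?_)
  by_cases h : k = 0
  · subst h; simp [Z.op_zero, ContinuousLinearMap.one_def]
  · simp [h]

/-- The weighted shifts do not reach the summand of the vertices, where `Z_0 = I`; this is why `Q_0`
is removed. The positive operator `Z - Q_0` has square `∑ₑ (Z Sₑ)(Z Sₑ)^*`, and its root stays in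
the closed algebra. -/
lemma opL_sub_Q_mem : Z.opL - G.Q 0 ∈ Z.toeplitz := by
  set B := Z.opL - G.Q 0 with hB
  have hBB : B * B ∈ Z.toeplitz := by
    have h : B * B = ∑ e, (Z.opL * G.S e) * star (Z.opL * G.S e) := by
      have h1 : ∑ e, (Z.opL * G.S e) * star (Z.opL * G.S e) = Z.opL * (1 - G.Q 0) * Z.opL := by
        rw [← sum_S_mul_star_S, Finset.mul_sum, Finset.sum_mul]
        refine Finset.sum_congr rfl fun e _ => ?_
        rw [star_mul, star_opL]
        noncomm_ring
      rw [h1]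
      refine (Z.isDiag_opL_sub_Q.mul Z.isDiag_opL_sub_Q).ext
        ((((isDiag_opL Z).mul (IsDiag.one.sub (isDiag_Q 0))).mul (isDiag_opL Z)).congr
          (funext fun k => ?_))
      by_cases h : k = 0 <;> simp [h]
    rw [h]
    exact sum_mem fun e _ => mul_mem (Z.opL_mul_S_mem e) (star_mem (Z.opL_mul_S_mem e))
  -- The square root is taken among all bounded operators of the Hilbert space, whose order is the
  -- usual one; the image of the Toeplitz algebra stays closed there.
  let φ : G.adjointableOps →⋆ₙₐ[ℂ] (G.Fock →L[ℂ] G.Fock) :=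
    (G.adjointableOps.subtype : G.adjointableOps →⋆ₐ[ℂ] (G.Fock →L[ℂ] G.Fock))
  have hcl : IsClosed ((Z.toeplitz.map φ : NonUnitalStarSubalgebra ℂ _) :
      Set (G.Fock →L[ℂ] G.Fock)) := by
    rw [NonUnitalStarSubalgebra.coe_map]
    exact isClosed_adjointableOps.isClosedEmbedding_subtypeVal.isClosedMap _ Z.isClosed_toeplitz
  have hpos : (0 : G.Fock →L[ℂ] G.Fock) ≤ B.1 := by
    rw [ContinuousLinearMap.nonneg_iff_isPositive]
    refine Z.isDiag_opL_sub_Q.isPositive fun k => ?_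
    split_ifs
    · exact ContinuousLinearMap.isPositive_zero
    · exact Z.positive k
  obtain ⟨Y, hY, hYB⟩ := NonUnitalStarSubalgebra.mem_map.1
    (NonUnitalStarSubalgebra.mem_of_mul_self_mem (Z.toeplitz.map φ) hcl hpos
      (NonUnitalStarSubalgebra.mem_map.2 ⟨B * B, hBB, rfl⟩))
  have : Y = B := Subtype.ext hYB
  exact this ▸ hY

lemma _root_.DirGraph.Q_zero_mul_S (e : Ed) : G.Q 0 * G.S e = 0 := by
  refine Subtype.ext (ContinuousLinearMap.ext fun ξ => ?_)
  ext k : 2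
  change (G.Q 0).1 ((G.S e).1 ξ) k = 0
  rw [isDiag_Q]
  cases k with
  | zero => rw [S_apply_zero, map_zero]
  | succ k => simp

/-- Partial sums of a Neumann series that recovers `Sₑ` from `Z Sₑ`. The recursion never needs the
unit, or `Sₑ` itself, to lie in the algebra. -/
lemma S_sub_pow_mul_S_mem (c : ℂ) (e : Ed) (n : ℕ) :
    G.S e - (1 - c • (Z.opL - G.Q 0)) ^ n * G.S e ∈ Z.toeplitz := by
  obtain ⟨K, hK⟩ : ∃ K, K = 1 - c • (Z.opL - G.Q 0) := ⟨_, rfl⟩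
  rw [← hK]
  have hKX : ∀ X ∈ Z.toeplitz, K * X ∈ Z.toeplitz := fun X hX => by
    rw [hK, sub_mul, one_mul, smul_mul_assoc]
    exact sub_mem hX (SMulMemClass.smul_mem _ (mul_mem Z.opL_sub_Q_mem hX))
  have h2 : K * G.S e = G.S e - c • (Z.opL * G.S e) := by
    rw [hK, sub_mul, one_mul, smul_mul_assoc, sub_mul, Q_zero_mul_S, sub_zero]
  induction n with
  | zero => simp
  | succ n ih =>
    have h1 : G.S e - K ^ (n + 1) * G.S e = c • (Z.opL * G.S e) + K * (G.S e - K ^ n * G.S e) := by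
      rw [mul_sub, h2, pow_succ', mul_assoc]
      abel
    rw [h1]
    exact add_mem (SMulMemClass.smul_mem _ (Z.opL_mul_S_mem e)) (hKX _ ih)

lemma exists_norm_pow_mul_S_le : ∃ (c : ℂ) (ρ : ℝ), 0 ≤ ρ ∧ ρ < 1 ∧ ∀ e n,
    ‖(1 - c • (Z.opL - G.Q 0)) ^ n * G.S e‖ ≤ ρ ^ n * ‖G.S e‖ := by
  obtain ⟨M, hM⟩ := Z.bounded
  obtain ⟨ε, hε, hZε⟩ := Z.lower_bound
  -- `c` dominates the norms of all `Z_k`; taking it also at least `ε` ensures `c > 0` and `0 ≤ 1 -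
  -- ε / c < 1`.
  obtain ⟨c, hMc, hεc⟩ : ∃ c, M ≤ c ∧ ε ≤ c := ⟨max M ε, le_max_left _ _, le_max_right _ _⟩
  have hc0 : 0 < c := hε.trans_le hεc
  have hρ0 : 0 ≤ 1 - ε / c := sub_nonneg.2 ((div_le_one hc0).2 hεc)
  refine ⟨(c⁻¹ : ℂ), 1 - ε / c, hρ0, sub_lt_self _ (div_pos hε hc0), fun e n => ?_⟩
  have hKd := IsDiag.one.sub (Z.isDiag_opL_sub_Q.smul (c⁻¹ : ℂ))
  obtain ⟨K, hK⟩ : ∃ K, K = 1 - (c⁻¹ : ℂ) • (Z.opL - G.Q 0) := ⟨_, rfl⟩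
  rw [← hK] at hKd ⊢
  -- On the summand of the vertices `K` is the identity and does not contract; the range of `Sₑ`
  -- avoids that summand.
  have h1 : K ^ n * G.S e = K ^ n * (1 - G.Q 0) * G.S e := by
    rw [mul_assoc, sub_mul, one_mul, Q_zero_mul_S, sub_zero]
  rw [h1]
  refine (norm_mul_le _ _).trans (mul_le_mul_of_nonneg_right ?_ (norm_nonneg _))
  refine ((hKd.pow n).mul (IsDiag.one.sub (isDiag_Q 0))).norm_le (pow_nonneg hρ0 n) fun k => ?_
  by_cases hk : k = 0
  · rw [if_pos hk, if_pos hk, sub_self, mul_zero, norm_zero]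
    exact pow_nonneg hρ0 n
  · rw [if_neg hk, if_neg hk, sub_zero, mul_one]
    have h2 := norm_one_sub_smul_le hc0 hεc (Z.positive k)
      ((hM k).trans hMc) (hZε k (Nat.one_le_iff_ne_zero.2 hk))
    rcases Nat.eq_zero_or_pos n with rfl | hn
    · rw [pow_zero, pow_zero]
      exact ContinuousLinearMap.norm_id_le
    · exact (norm_pow_le' _ hn).trans (pow_le_pow_left₀ (norm_nonneg _) h2 n)

lemma S_mem (e : Ed) : G.S e ∈ Z.toeplitz := by
  obtain ⟨c, ρ, hρ0, hρ1, hnorm⟩ := Z.exists_norm_pow_mul_S_le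
  refine Z.isClosed_toeplitz.mem_of_tendsto ?_
    (Filter.Eventually.of_forall (f := Filter.atTop) (Z.S_sub_pow_mul_S_mem c e))
  rw [tendsto_iff_norm_sub_tendsto_zero]
  refine squeeze_zero (fun _ => norm_nonneg _) (fun n => ?_)
    (by simpa using (tendsto_pow_atTop_nhds_zero_of_lt_one hρ0 hρ1).mul_const ‖G.S e‖)
  rw [sub_sub_cancel_left, norm_neg]
  exact hnorm e n

lemma P_mem (hG : G.NoSinks) (v : V) : G.P v ∈ Z.toeplitz := by
  obtain ⟨e, rfl⟩ := hG v
  classical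
  have h := star_S_mul_S (G := G) e e
  rw [if_pos rfl] at h
  rw [← h]
  exact mul_mem (star_mem (Z.S_mem e)) (Z.S_mem e)

end WeightSequence

/-! ### The gauge action -/

variable (G) in
/-- `X` is homogeneous of degree `d` for the gauge action. -/
def IsDeg (d : ℤ) (X : G.adjointableOps) : Prop :=
  ∀ t : ℝ, G.gauge t X = Complex.exp (Complex.I * d * t) • X

variable (G) in
/-- The gauge unitary as an element of `𝓛`. -/
def gaugeU (t : ℝ) : G.adjointableOps := ⟨Fock.gaugeUnitary t, Fock.isAdjointable_gaugeUnitary t⟩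

lemma isDiag_gaugeU (t : ℝ) : IsDiag (G.gaugeU t) fun k =>
    Complex.exp (Complex.I * k * t) • (1 : G.Xk k →L[ℂ] G.Xk k) := fun _ _ => rfl

lemma gauge_eq (t : ℝ) (X : G.adjointableOps) :
    G.gauge t X = G.gaugeU t * X * star (G.gaugeU t) := rfl

lemma conj_exp_I_mul (k t : ℝ) :
    conj (Complex.exp (Complex.I * k * t)) = (Complex.exp (Complex.I * k * t))⁻¹ := by
  rw [← Complex.exp_conj, ← Complex.exp_neg]
  simp

lemma star_gaugeU_mul (t : ℝ) : star (G.gaugeU t) * G.gaugeU t = 1 := by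
  refine ((isDiag_gaugeU t).star.mul (isDiag_gaugeU t)).ext (IsDiag.one.congr (funext fun k => ?_))
  have := conj_exp_I_mul k t
  simp only [Complex.ofReal_natCast] at this
  rw [star_smul, star_one, smul_mul_smul_comm, one_mul]
  change _ = (conj _ * _) • _
  rw [this, inv_mul_cancel₀ (Complex.exp_ne_zero _), one_smul]

lemma gaugeU_mul_star (t : ℝ) : G.gaugeU t * star (G.gaugeU t) = 1 := by
  refine ((isDiag_gaugeU t).mul (isDiag_gaugeU t).star).ext (IsDiag.one.congr (funext fun k => ?_))
  have := conj_exp_I_mul k t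
  simp only [Complex.ofReal_natCast] at this
  rw [star_smul, star_one, smul_mul_smul_comm, one_mul]
  change _ = (_ * conj _) • _
  rw [this, mul_inv_cancel₀ (Complex.exp_ne_zero _), one_smul]

lemma gauge_mul (t : ℝ) (X Y : G.adjointableOps) :
    G.gauge t (X * Y) = G.gauge t X * G.gauge t Y := by
  simp only [gauge_eq]
  have : G.gaugeU t * X * star (G.gaugeU t) * (G.gaugeU t * Y * star (G.gaugeU t)) =
    G.gaugeU t * X * (star (G.gaugeU t) * G.gaugeU t) * Y * star (G.gaugeU t) := by noncomm_ring
  rw [this, star_gaugeU_mul]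
  noncomm_ring

lemma gauge_star (t : ℝ) (X : G.adjointableOps) : G.gauge t (star X) = star (G.gauge t X) := by
  simp only [gauge_eq, star_mul, star_star, mul_assoc]

lemma gauge_add (t : ℝ) (X Y : G.adjointableOps) :
    G.gauge t (X + Y) = G.gauge t X + G.gauge t Y := by
  simp only [gauge_eq, mul_add, add_mul]

lemma gauge_smul (t : ℝ) (c : ℂ) (X : G.adjointableOps) :
    G.gauge t (c • X) = c • G.gauge t X := by
  simp only [gauge_eq, mul_smul_comm, smul_mul_assoc]

lemma norm_gauge_le (t : ℝ) (X : G.adjointableOps) : ‖G.gauge t X‖ ≤ ‖X‖ := by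
  have h : ‖G.gaugeU t‖ ≤ 1 := by
    refine (isDiag_gaugeU t).norm_le zero_le_one fun k => ?_
    rw [norm_smul, show Complex.I * k * t = ((k * t : ℝ) : ℂ) * Complex.I by push_cast; ring,
      Complex.norm_exp_ofReal_mul_I, one_mul]
    exact ContinuousLinearMap.norm_id_le
  have h' : ‖star (G.gaugeU t)‖ ≤ 1 := (norm_star (G.gaugeU t).1).trans_le h
  rw [gauge_eq]
  calc _ ≤ ‖G.gaugeU t‖ * ‖X‖ * ‖star (G.gaugeU t)‖ :=
        (norm_mul_le _ _).trans (by gcongr; exact norm_mul_le _ _)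
    _ ≤ 1 * ‖X‖ * 1 := by gcongr
    _ = ‖X‖ := by ring

namespace IsDeg

variable {d d' : ℤ} {X Y : G.adjointableOps}

lemma mul (hX : G.IsDeg d X) (hY : G.IsDeg d' Y) : G.IsDeg (d + d') (X * Y) := fun t => by
  rw [gauge_mul, hX, hY, smul_mul_smul_comm, ← Complex.exp_add]
  congr 2
  push_cast
  ring

lemma star (hX : G.IsDeg d X) : G.IsDeg (-d) (star X) := fun t => by
  rw [gauge_star, hX, star_smul]
  congr 1
  have := conj_exp_I_mul d t
  rw [Complex.ofReal_intCast, ← Complex.exp_neg] at this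
  change conj _ = _
  rw [this]
  push_cast
  ring_nf

lemma zero : G.IsDeg d 0 := fun t => by simp [gauge_eq]

end IsDeg

lemma IsDiag.isDeg {X : G.adjointableOps} {T : (k : ℕ) → (G.Xk k →L[ℂ] G.Xk k)}
    (hX : IsDiag X T) : G.IsDeg 0 X := fun t => by
  have h : G.gaugeU t * X = X * G.gaugeU t :=
    ((isDiag_gaugeU t).mul hX).ext ((hX.mul (isDiag_gaugeU t)).congr (funext fun k => by
      rw [mul_smul_comm, smul_mul_assoc, one_mul, mul_one]))
  rw [gauge_eq, h, mul_assoc, gaugeU_mul_star]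
  simp

lemma isDeg_S (e : Ed) : G.IsDeg 1 (G.S e) := fun t => by
  have h : G.gaugeU t * G.S e = Complex.exp (Complex.I * t) • (G.S e * G.gaugeU t) := by
    refine Subtype.ext (ContinuousLinearMap.ext fun ξ => ?_)
    ext k : 2
    change (G.gaugeU t).1 ((G.S e).1 ξ) k = Complex.exp (Complex.I * t) •
      (G.S e).1 ((G.gaugeU t).1 ξ) k
    rw [isDiag_gaugeU]
    cases k with
    | zero => simp [S_apply_zero]
    | succ k =>
      rw [S_apply_succ, S_apply_succ, isDiag_gaugeU]
      change Complex.exp _ • Xk.create e k (ξ k) =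
        Complex.exp _ • Xk.create e k (Complex.exp _ • ξ k)
      rw [map_smul, smul_smul, ← Complex.exp_add]
      congr 2
      push_cast
      ring
  rw [gauge_eq, h, smul_mul_assoc, mul_assoc, gaugeU_mul_star, mul_one]
  simp

end DirGraph
end

/-! ### Gauge averages, approximation of `q(𝓓)` by the matrix algebras, and membership in `q(𝓓)` and
`q(F)`. -/

noncomputable section

namespace DirGraph

variable {V Ed : Type*} {G : DirGraph V Ed} [Fintype V] [Fintype Ed]

/-- An element of a closed ideal of the quotient that is close to a closed `*`-subalgebra `C` is
close to the intersection of the ideal with `C`. -/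
lemma exists_mem_inter_norm_sub_le
    (C : NonUnitalStarSubalgebra ℂ G.QuotAlg) (hC : IsClosed (C : Set G.QuotAlg))
    (J : Submodule ℂ G.QuotAlg) (hJ : IsClosed (J : Set G.QuotAlg))
    (hl : ∀ a ∈ C, ∀ x ∈ J, a * x ∈ J) (hr : ∀ a ∈ C, ∀ x ∈ J, x * a ∈ J)
    (hJJ : ∀ a ∈ J, ∀ x ∈ J, a * x ∈ J) {x c : G.QuotAlg} (hx : x ∈ J) (hc : c ∈ C) {δ : ℝ}
    (hδ : 0 < δ) (hxc : ‖c - x‖ ≤ δ) :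
    ∃ y ∈ J, y ∈ C ∧ ‖c - y‖ ^ 2 ≤ 2 * ((‖x‖ + δ) * δ) := by
  let i1 : CStarAlgebra G.adjointableOps :=
    StarSubalgebra.cstarAlgebra _ (h_closed := isClosed_adjointableOps)
  let i2 : PartialOrder G.adjointableOps := CStarAlgebra.spectralOrder _
  let i3 : StarOrderedRing G.adjointableOps := CStarAlgebra.spectralOrderedRing _
  exact _root_.exists_mem_inter_norm_sub_le (A := G.adjointableOps) (qStar G) QuotAlg.norm_q_le
    QuotAlg.q_surjective C hC J hJ hl hr hJJ hx hc hδ hxc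

/-! ### Gauge averages -/

variable (G) in
/-- The average of the gauge action over the `m`-th roots of unity. -/
def gaugeAvg (m : ℕ) (X : G.adjointableOps) : G.adjointableOps :=
  (m : ℂ)⁻¹ • ∑ j ∈ Finset.range m, G.gauge (2 * Real.pi * j / m) X

lemma gaugeAvg_add (m : ℕ) (X Y : G.adjointableOps) :
    G.gaugeAvg m (X + Y) = G.gaugeAvg m X + G.gaugeAvg m Y := by
  simp only [gaugeAvg, gauge_add, Finset.sum_add_distrib, smul_add]

lemma gaugeAvg_smul (m : ℕ) (c : ℂ) (X : G.adjointableOps) :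
    G.gaugeAvg m (c • X) = c • G.gaugeAvg m X := by
  simp only [gaugeAvg, gauge_smul, ← Finset.smul_sum, smul_comm c]

lemma norm_gaugeAvg_le (m : ℕ) (X : G.adjointableOps) : ‖G.gaugeAvg m X‖ ≤ ‖X‖ := by
  have h1 : ‖∑ j ∈ Finset.range m, G.gauge (2 * Real.pi * j / m) X‖ ≤ m * ‖X‖ := by
    refine (norm_sum_le _ _).trans ((Finset.sum_le_sum fun j _ => norm_gauge_le _ X).trans ?_)
    simp
  rw [gaugeAvg, norm_smul, norm_inv, Complex.norm_natCast]
  rcases Nat.eq_zero_or_pos m with rfl | hm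
  · simp
  · rw [inv_mul_le_iff₀ (by positivity)]
    exact h1

lemma IsDeg.gaugeAvg_zero {X : G.adjointableOps} (hX : G.IsDeg 0 X) {m : ℕ} (hm : 0 < m) :
    G.gaugeAvg m X = X := by
  have h : ∀ t, G.gauge t X = X := fun t => by rw [hX]; simp
  have hm' : (m : ℂ) ≠ 0 := by exact_mod_cast hm.ne'
  simp only [gaugeAvg, h, Finset.sum_const, Finset.card_range]
  rw [← Nat.cast_smul_eq_nsmul ℂ, smul_smul, inv_mul_cancel₀ hm', one_smul]

/-- The average multiplies `X` by the mean of the powers of `ζ = exp(2πi d / m)`. As `0 < |d| < m`,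
`ζ` is an `m`-th root of unity other than `1`, so the mean vanishes. -/
lemma IsDeg.gaugeAvg_eq_zero {d : ℤ} {X : G.adjointableOps} (hX : G.IsDeg d X) (hd : d ≠ 0)
    {m : ℕ} (hm : d.natAbs < m) : G.gaugeAvg m X = 0 := by
  have hm0 : (m : ℂ) ≠ 0 := by exact_mod_cast (Nat.zero_le _).trans_lt hm |>.ne'
  set ζ : ℂ := Complex.exp (2 * Real.pi * Complex.I * (d / m)) with hζ
  have h1 : ∀ j : ℕ, G.gauge (2 * Real.pi * j / m) X = ζ ^ j • X := fun j => by
    rw [hX, hζ, ← Complex.exp_nat_mul]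
    congr 2
    push_cast
    ring
  have hζm : ζ ^ m = 1 := by
    rw [hζ, ← Complex.exp_nat_mul, Complex.exp_eq_one_iff]
    refine ⟨d, ?_⟩
    field_simp
  have hζ1 : ζ ≠ 1 := by
    rw [hζ, Ne, Complex.exp_eq_one_iff]
    rintro ⟨n, hn⟩
    have hpi : (2 * Real.pi * Complex.I : ℂ) ≠ 0 := Complex.two_pi_I_ne_zero
    rw [mul_comm (n : ℂ)] at hn
    have h2 := mul_left_cancel₀ hpi hn
    rw [div_eq_iff hm0] at h2
    have h3 : d = n * m := by exact_mod_cast h2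
    have h4 : (m : ℤ) ∣ d := ⟨n, by rw [h3, mul_comm]⟩
    have h5 := Int.le_of_dvd (by positivity : 0 < |d|) ((dvd_abs _ _).2 h4)
    rw [Int.abs_eq_natAbs] at h5
    omega
  have hsum : ∑ j ∈ Finset.range m, ζ ^ j = 0 := by
    have := mul_geom_sum ζ m
    rw [hζm, sub_self] at this
    exact (mul_eq_zero.1 this).resolve_left (sub_ne_zero.2 hζ1)
  simp only [gaugeAvg, h1]
  rw [← Finset.sum_smul, hsum, zero_smul, smul_zero]

namespace WeightSequence

variable (Z : G.WeightSequence)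

/-! ### Homogeneous elements of the quotient -/

/-- All matrix coefficients of `x` between sufficiently long paths whose lengths differ by `d` lie
in the coefficient algebra. -/
def HasCoeffs (d : ℤ) (x : G.QuotAlg) : Prop :=
  ∃ N : ℕ, ∀ m n : ℕ, N ≤ m → N ≤ n → (m : ℤ) - n = d → ∀ (μ : G.Path m) (ν : G.Path n),
    star (uPath μ) * x * uPath ν ∈ Z.coeffAlg

variable {Z}

namespace HasCoeffs

variable {d d' : ℤ} {x y : G.QuotAlg}

lemma add (hx : Z.HasCoeffs d x) (hy : Z.HasCoeffs d y) : Z.HasCoeffs d (x + y) := by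
  obtain ⟨M, hM⟩ := hx
  obtain ⟨N, hN⟩ := hy
  refine ⟨max M N, fun m n hm hn h μ ν => ?_⟩
  rw [mul_add, add_mul]
  exact add_mem (hM m n (by omega) (by omega) h μ ν) (hN m n (by omega) (by omega) h μ ν)

lemma smul (c : ℂ) (hx : Z.HasCoeffs d x) : Z.HasCoeffs d (c • x) := by
  obtain ⟨M, hM⟩ := hx
  refine ⟨M, fun m n hm hn h μ ν => ?_⟩
  rw [mul_smul_comm, smul_mul_assoc]
  exact SMulMemClass.smul_mem c (hM m n hm hn h μ ν)

lemma zero : Z.HasCoeffs d 0 := ⟨0, fun m n _ _ _ μ ν => by simp⟩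

lemma mul (hx : Z.HasCoeffs d x) (hy : Z.HasCoeffs d' y) : Z.HasCoeffs (d + d') (x * y) := by
  obtain ⟨M, hM⟩ := hx
  obtain ⟨N, hN⟩ := hy
  -- The summand `|d'|` keeps the intermediate length `l = n + d'` above both thresholds, even for
  -- negative `d'`.
  refine ⟨M + N + d'.natAbs, fun m n hm hn h μ ν => ?_⟩
  obtain ⟨l, hl⟩ : ∃ l : ℕ, (l : ℤ) = n + d' := ⟨(n + d').toNat, by omega⟩
  have h1 : star (uPath μ) * (x * y) * uPath ν = ∑ α : G.Path l,
      (star (uPath μ) * x * uPath α) * (star (uPath α) * y * uPath ν) := by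
    rw [← mul_assoc, mul_assoc _ y, mul_eq_sum_uPath l]
    simp only [mul_assoc]
  rw [h1]
  exact sum_mem fun α _ => mul_mem (hM m l (by omega) (by omega) (by omega) μ α)
    (hN l n (by omega) (by omega) (by omega) α ν)

lemma star (hx : Z.HasCoeffs d x) : Z.HasCoeffs (-d) (star x) := by
  obtain ⟨M, hM⟩ := hx
  refine ⟨M, fun m n hm hn h μ ν => ?_⟩
  have h1 : Star.star (uPath μ) * Star.star x * uPath ν =
      Star.star (Star.star (uPath ν) * x * uPath μ) := by
    rw [star_mul, star_mul, star_star, mul_assoc]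
  rw [h1]
  exact star_mem (hM n m hn hm (by omega) ν μ)

end HasCoeffs

section

variable {p : ℕ} (hp : 1 ≤ p) (hA : Z.ConditionA p)
include hp hA

lemma hasCoeffs_z_mul_u (e : Ed) : Z.HasCoeffs 1 (Z.z * G.u e) := by
  refine ⟨0, fun m n _ _ h μ ν => ?_⟩
  obtain rfl : m = n + 1 := by omega
  have hz : Z.z ∈ Z.matAlg (n + 1) := coeffAlg_le_matAlg hp hA _ (Z.zShift_mem 0)
  rw [mul_assoc, mul_assoc Z.z, ← mul_assoc]
  by_cases hs : G.s e = ν.range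
  · rw [← uPath_cons e ν hs]
    exact star_uPath_mul_mem_coeffAlg hz _ _
  · rw [u_mul_uPath_of_ne hs, mul_zero]
    exact zero_mem _

lemma HasCoeffs.exists_mem_matAlg {x : G.QuotAlg} (hx : Z.HasCoeffs 0 x) :
    ∃ N, ∀ k, N ≤ k → x ∈ Z.matAlg k := by
  obtain ⟨N, hN⟩ := hx
  exact ⟨N, fun k hk => (mem_matAlg_iff hp hA).2 (hN k k hk hk (sub_self _))⟩

/-- `X` is a combination of homogeneous words. Once `m` exceeds all their degrees, the average keeps
exactly the words of degree `0`, and these have coefficients in the coefficient algebra. -/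
lemma exists_gaugeAvg_eq {X : G.adjointableOps}
    (hX : X ∈ NonUnitalStarAlgebra.adjoin ℂ (Set.range fun e : Ed => Z.opL * G.S e)) :
    ∃ Y, Z.HasCoeffs 0 (QuotAlg.q G Y) ∧ ∃ M, ∀ m, M ≤ m → G.gaugeAvg m X = Y := by
  have hword : ∀ w ∈ Subsemigroup.closure ((Set.range fun e : Ed => Z.opL * G.S e) ∪
      star (Set.range fun e : Ed => Z.opL * G.S e)),
      ∃ d : ℤ, G.IsDeg d w ∧ Z.HasCoeffs d (QuotAlg.q G w) := by
    intro w hw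
    have hgen : ∀ e, G.IsDeg 1 (Z.opL * G.S e) ∧ Z.HasCoeffs 1 (QuotAlg.q G (Z.opL * G.S e)) := by
      refine fun e => ⟨by simpa using (isDiag_opL Z).isDeg.mul (isDeg_S e), ?_⟩
      rw [map_mul]
      exact hasCoeffs_z_mul_u hp hA e
    induction hw using Subsemigroup.closure_induction with
    | mem w hw =>
      rcases hw with ⟨e, rfl⟩ | ⟨e, he⟩
      · exact ⟨1, hgen e⟩
      · refine ⟨-1, ?_⟩
        rw [← star_star w, ← he, QuotAlg.q_star]
        exact ⟨(hgen e).1.star, (hgen e).2.star⟩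
    | mul x y _ _ hx hy =>
      obtain ⟨d, h1, h2⟩ := hx
      obtain ⟨d', h1', h2'⟩ := hy
      rw [map_mul]
      exact ⟨d + d', h1.mul h1', h2.mul h2'⟩
  have hX' : X ∈ Submodule.span ℂ (Subsemigroup.closure
      ((Set.range fun e : Ed => Z.opL * G.S e) ∪ star (Set.range fun e : Ed => Z.opL * G.S e)) :
        Set G.adjointableOps) := by
    rw [← NonUnitalStarAlgebra.adjoin_eq_span]
    exact hX
  clear hX
  induction hX' using Submodule.span_induction with
  | mem w hw =>
    obtain ⟨d, h1, h2⟩ := hword w hw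
    by_cases hd : d = 0
    · subst hd
      exact ⟨w, h2, 1, fun m hm => h1.gaugeAvg_zero hm⟩
    · exact ⟨0, by rw [map_zero]; exact HasCoeffs.zero, d.natAbs + 1,
        fun m hm => h1.gaugeAvg_eq_zero hd hm⟩
  | zero =>
    exact ⟨0, by rw [map_zero]; exact HasCoeffs.zero, 1, fun m hm => IsDeg.zero.gaugeAvg_zero hm⟩
  | add x y _ _ hx hy =>
    obtain ⟨X₀, hX₀, M, hM⟩ := hx
    obtain ⟨Y₀, hY₀, N, hN⟩ := hy
    refine ⟨X₀ + Y₀, by rw [map_add]; exact hX₀.add hY₀, max M N, fun m hm => ?_⟩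
    rw [gaugeAvg_add, hM m (by omega), hN m (by omega)]
  | smul c x _ hx =>
    obtain ⟨X₀, hX₀, M, hM⟩ := hx
    refine ⟨c • X₀, by rw [map_smul]; exact hX₀.smul c, M, fun m hm => ?_⟩
    rw [gaugeAvg_smul, hM m hm]

/-- `q(𝓓)` is contained in the closure of the union of the matrix algebras. -/
lemma exists_mem_matAlg_norm_sub_le {x : G.QuotAlg} (hx : x ∈ Z.qD) {ε : ℝ} (hε : 0 < ε) :
    ∃ N, ∀ k, N ≤ k → ∃ c ∈ Z.matAlg k, ‖c - x‖ ≤ ε := by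
  obtain ⟨X, ⟨hXT, hXg⟩, rfl⟩ := hx
  obtain ⟨Y, hY, hXY⟩ := Metric.mem_closure_iff.1 hXT ε hε
  obtain ⟨Y₀, hY₀, M, hM⟩ := exists_gaugeAvg_eq hp hA hY
  obtain ⟨N, hN⟩ := hY₀.exists_mem_matAlg hp hA
  refine ⟨N, fun k hk => ⟨_, hN k hk, ?_⟩⟩
  have h0 : G.IsDeg 0 X := fun t => by rw [hXg]; simp
  -- Averaging fixes `X`, turns the approximant `Y` into its degree-zero part `Y₀`, and does not
  -- increase norms, so `Y₀` is as close to `X` as `Y` is.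
  have h1 : X = G.gaugeAvg (M + 1) X := (h0.gaugeAvg_zero (Nat.succ_pos M)).symm
  have h2 : Y₀ - X = G.gaugeAvg (M + 1) (Y + (-1 : ℂ) • X) := by
    rw [gaugeAvg_add, gaugeAvg_smul, ← h1, hM _ (Nat.le_succ M), neg_smul, one_smul, sub_eq_add_neg]
  rw [← map_sub, h2]
  refine (QuotAlg.norm_q_le _).trans ((norm_gaugeAvg_le _ _).trans ?_)
  rw [neg_smul, one_smul, ← sub_eq_add_neg, ← dist_eq_norm, dist_comm]
  exact hXY.le

end

/-! ### The algebra `q(𝓓)` and the module `q(F)` -/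

variable (Z) in
/-- `q(𝓓)` as a `*`-algebra. -/
def qDAlg : NonUnitalStarSubalgebra ℂ G.QuotAlg where
  carrier := Z.qD
  zero_mem' := ⟨0, ⟨zero_mem _, fun t => by simp [gauge_eq]⟩, map_zero _⟩
  add_mem' := by
    rintro _ _ ⟨X, hX, rfl⟩ ⟨Y, hY, rfl⟩
    exact ⟨X + Y, ⟨add_mem hX.1 hY.1, fun t => by rw [gauge_add, hX.2, hY.2]⟩, map_add _ _ _⟩
  mul_mem' := by
    rintro _ _ ⟨X, hX, rfl⟩ ⟨Y, hY, rfl⟩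
    exact ⟨X * Y, ⟨mul_mem hX.1 hY.1, fun t => by rw [gauge_mul, hX.2, hY.2]⟩, map_mul _ _ _⟩
  smul_mem' := by
    rintro c _ ⟨X, hX, rfl⟩
    exact ⟨c • X, ⟨SMulMemClass.smul_mem c hX.1, fun t => by rw [gauge_smul, hX.2]⟩, map_smul _ _ _⟩
  star_mem' := by
    rintro _ ⟨X, hX, rfl⟩
    exact ⟨star X, ⟨star_mem hX.1, fun t => by rw [gauge_star, hX.2]⟩, QuotAlg.q_star _⟩

lemma mem_qD {X : G.adjointableOps} (hX : X ∈ Z.toeplitz) (h : G.IsDeg 0 X) :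
    QuotAlg.q G X ∈ Z.qD := ⟨X, ⟨hX, fun t => by rw [h]; simp⟩, rfl⟩

lemma isDeg_of_mem_D {X : G.adjointableOps} (hX : X ∈ Z.D) : G.IsDeg 0 X := fun t => by
  rw [hX.2]; simp

lemma isDeg_of_mem_F {X : G.adjointableOps} (hX : X ∈ Z.F) : G.IsDeg 1 X := fun t => by
  rw [hX.2]; simp

lemma u_mem_qF (e : Ed) : G.u e ∈ Z.qF :=
  ⟨G.S e, ⟨Z.S_mem e, fun t => by rw [isDeg_S]; simp⟩, rfl⟩

lemma star_u_mul_mem_qD {ξ : G.QuotAlg} (hξ : ξ ∈ Z.qF) (e : Ed) :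
    star (G.u e) * ξ ∈ Z.qD := by
  obtain ⟨X, hX, rfl⟩ := hξ
  have h := mem_qD (mul_mem (star_mem (Z.S_mem e)) hX.1)
    (by simpa using (isDeg_S e).star.mul (isDeg_of_mem_F hX))
  rwa [map_mul, QuotAlg.q_star] at h

lemma u_mul_mul_star_u_mem_qD {x : G.QuotAlg} (hx : x ∈ Z.qD) (e f : Ed) :
    G.u e * x * star (G.u f) ∈ Z.qD := by
  obtain ⟨X, hX, rfl⟩ := hx
  have h := mem_qD (mul_mem (mul_mem (Z.S_mem e) hX.1) (star_mem (Z.S_mem f)))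
    (by simpa using ((isDeg_S e).mul (isDeg_of_mem_D hX)).mul (isDeg_S f).star)
  rwa [map_mul, map_mul, QuotAlg.q_star] at h

lemma z_mem_qD : Z.z ∈ Z.qD := by
  have h := mem_qD Z.opL_sub_Q_mem Z.isDiag_opL_sub_Q.isDeg
  rwa [map_sub, q_Q, sub_zero] at h

lemma pv_mem_qD (hG : G.NoSinks) (v : V) : G.pv v ∈ Z.qD :=
  mem_qD (Z.P_mem hG v) (isDiag_P v).isDeg

lemma uPath_mul_mul_star_uPath_mem_qD (hG : G.NoSinks) {x : G.QuotAlg} (hx : x ∈ Z.qD) {k : ℕ}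
    (α β : G.Path k) : uPath α * x * star (uPath β) ∈ Z.qD := by
  induction k with
  | zero =>
    rw [uPath_zero, uPath_zero, star_pv]
    exact Z.qDAlg.mul_mem (Z.qDAlg.mul_mem (pv_mem_qD hG _) hx) (pv_mem_qD hG _)
  | succ k ih =>
    have : uPath α * x * star (uPath β) =
        G.u α.head * (uPath α.tail * x * star (uPath β.tail)) * star (G.u β.head) := by
      rw [uPath_succ, uPath_succ, star_mul]; noncomm_ring
    rw [this]
    exact u_mul_mul_star_u_mem_qD (ih _ _) _ _

lemma one_mem_qD (hG : G.NoSinks) : (1 : G.QuotAlg) ∈ Z.qD := by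
  rw [← sum_pv]
  exact sum_mem (S := Z.qDAlg) fun v _ => pv_mem_qD hG v

lemma uPath_mul_star_uPath_mem_qD (hG : G.NoSinks) {k : ℕ} (α β : G.Path k) :
    uPath α * star (uPath β) ∈ Z.qD := by
  simpa using uPath_mul_mul_star_uPath_mem_qD hG (one_mem_qD hG) α β

/-- The closure is enough for the sequel, since a closed ideal of `q(𝓓)` is stable under
multiplication by it. -/
lemma C_le_closure_qDAlg (hG : G.NoSinks) (p n : ℕ) : Z.C p n ≤ Z.qDAlg.topologicalClosure := by
  refine closure_mono (NonUnitalStarAlgebra.adjoin_le ?_)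
  rintro _ ⟨l, k, α, β, -, -, -, rfl⟩
  refine uPath_mul_mul_star_uPath_mem_qD hG ?_ α β
  induction l with
  | zero => rw [pow_zero]; exact one_mem_qD hG
  | succ l ih => rw [pow_succ]; exact Z.qDAlg.mul_mem ih z_mem_qD

end WeightSequence

end DirGraph
end

/-! ### Ideals of `q(𝓓)`, their coefficient ideals, and full invariance. -/

noncomputable section

namespace DirGraph

variable {V Ed : Type*} {G : DirGraph V Ed} [Fintype V] [Fintype Ed]

namespace WeightSequence

variable {Z : G.WeightSequence} {J : Submodule ℂ G.QuotAlg}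

/-! ### Ideals of `q(𝓓)` -/

namespace IsIdeal

variable (hJ : Z.IsIdeal J)
include hJ

lemma mul_mem_left_closure {a : G.QuotAlg} (ha : a ∈ Z.qDAlg.topologicalClosure) {x : G.QuotAlg}
    (hx : x ∈ J) : a * x ∈ J :=
  hJ.isClosed.closure_subset_iff.2 subset_rfl
    (map_mem_closure (f := fun a => a * x) (by fun_prop) ha
      fun b hb => hJ.mul_mem_left b hb x hx)

lemma mul_mem_right_closure {a : G.QuotAlg} (ha : a ∈ Z.qDAlg.topologicalClosure) {x : G.QuotAlg}
    (hx : x ∈ J) : x * a ∈ J :=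
  hJ.isClosed.closure_subset_iff.2 subset_rfl
    (map_mem_closure (f := fun a => x * a) (by fun_prop) ha
      fun b hb => hJ.mul_mem_right b hb x hx)

lemma mul_mul_mem {a x b : G.QuotAlg} (ha : a ∈ Z.qD) (hx : x ∈ J) (hb : b ∈ Z.qD) :
    a * x * b ∈ J :=
  hJ.mul_mem_right b hb _ (hJ.mul_mem_left a ha x hx)

/-- Full invariance in terms of the edges. -/
lemma fullyInvariant_iff : Z.FullyInvariant J ↔
    ∀ e f, ∀ x ∈ J, star (G.u e) * x * G.u f ∈ J ∧ G.u e * x * star (G.u f) ∈ J := by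
  -- Both `η^* uₑ` and `uₑ^* ξ` have degree zero, so elements of `q(F)` reduce to edges with
  -- coefficients in `q(𝓓)`, which an ideal absorbs.
  have hstar : ∀ {η}, η ∈ Z.qF → ∀ e, star η * G.u e ∈ Z.qD := fun {η} hη e => by
    have := Z.qDAlg.star_mem' (star_u_mul_mem_qD hη e)
    rwa [star_mul, star_star] at this
  constructor
  · rintro ⟨h1, h2⟩ e f x hx
    refine ⟨h1 (subset_closure (Submodule.subset_span
      ⟨x, hx, _, u_mem_qF f, _, u_mem_qF e, rfl⟩)), h2 ⟨u_mul_mul_star_u_mem_qD (hJ.subset hx) e f,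
      fun ξ hξ η hη => ?_⟩⟩
    have : star η * (G.u e * x * star (G.u f)) * ξ =
        (star η * G.u e) * x * (star (G.u f) * ξ) := by noncomm_ring
    rw [this]
    exact hJ.mul_mul_mem (hstar hη e) hx (star_u_mul_mem_qD hξ f)
  · intro h
    constructor
    · refine Submodule.topologicalClosure_minimal _ (Submodule.span_le.2 ?_) hJ.isClosed
      rintro _ ⟨a, ha, ξ, hξ, η, hη, rfl⟩
      have : star η * a * ξ = ∑ e, ∑ f,
          (star η * G.u e) * (star (G.u e) * a * G.u f) * (star (G.u f) * ξ) := by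
        rw [mul_eq_sum_u (star η) a, Finset.sum_mul]
        refine Finset.sum_congr rfl fun e _ => ?_
        rw [mul_eq_sum_u _ ξ]
        simp only [mul_assoc]
      rw [this]
      exact sum_mem fun e _ => sum_mem fun f _ =>
        hJ.mul_mul_mem (hstar hη e) (h e f a ha).1 (star_u_mul_mem_qD hξ f)
    · rintro a ⟨-, ha⟩
      have : a = ∑ e, ∑ f, G.u e * (star (G.u e) * a * G.u f) * star (G.u f) := by
        conv_lhs => rw [← one_mul a, mul_eq_sum_u 1 a]
        refine Finset.sum_congr rfl fun e _ => ?_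
        conv_lhs => rw [← mul_one (1 * G.u e * _), mul_eq_sum_u _ 1]
        simp only [mul_assoc, one_mul, mul_one]
      rw [this]
      exact sum_mem fun e _ => sum_mem fun f _ =>
        (h e f _ (ha _ (u_mem_qF f) _ (u_mem_qF e))).2

/-- The ideal is the closure of the union of the `J_n`. -/
lemma exists_mem_restrict_norm_sub_le (hG : G.NoSinks) {p : ℕ} (hp : 1 ≤ p) (hA : Z.ConditionA p)
    {x : G.QuotAlg} (hx : x ∈ J) {ε : ℝ} (hε : 0 < ε) :
    ∃ n, 1 ≤ n ∧ ∃ y ∈ Z.restrict p J n, ‖x - y‖ ≤ ε := by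
  -- Chosen so that the bound `2 (‖x‖ + δ) δ` for the squared error is at most `(ε / 2)²`, with `δ ≤
  -- 1` used to replace `‖x‖ + δ` by `‖x‖ + 1`.
  set δ : ℝ := min 1 (min (ε / 2) ((ε / 2) ^ 2 / (2 * (‖x‖ + 1)))) with hδ
  have hδ0 : 0 < δ := by positivity
  have hδ1 : δ ≤ 1 := min_le_left _ _
  have hδ2 : δ ≤ ε / 2 := (min_le_right _ _).trans (min_le_left _ _)
  have hδ3 : 2 * ((‖x‖ + δ) * δ) ≤ (ε / 2) ^ 2 := by
    have h : δ ≤ (ε / 2) ^ 2 / (2 * (‖x‖ + 1)) := (min_le_right _ _).trans (min_le_right _ _)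
    rw [le_div_iff₀ (by positivity)] at h
    refine le_trans ?_ h
    have : (‖x‖ + δ) * δ ≤ (‖x‖ + 1) * δ := by gcongr
    linarith
  obtain ⟨N, hN⟩ := exists_mem_matAlg_norm_sub_le hp hA (hJ.subset hx) hδ0
  have hle : N ≤ (N + 1) * p + (p - 1) :=
    (Nat.le_succ N).trans ((Nat.le_mul_of_pos_right _ hp).trans (Nat.le_add_right _ _))
  obtain ⟨c, hc, hcx⟩ := hN _ hle
  rw [← C_eq_matAlg hp hA] at hc
  obtain ⟨y, hyJ, hyC, hy⟩ := exists_mem_inter_norm_sub_le (Z.C p (N + 1)) isClosed_closure J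
    hJ.isClosed (fun a ha x hx => hJ.mul_mem_left_closure (C_le_closure_qDAlg hG p _ ha) hx)
    (fun a ha x hx => hJ.mul_mem_right_closure (C_le_closure_qDAlg hG p _ ha) hx)
    (fun a ha x hx => hJ.mul_mem_left a (hJ.subset ha) x hx) hx hc hδ0 hcx
  -- The index `N + 1` rather than `N` guarantees `n ≥ 1`, which later makes the path length `np +
  -- (p - 1)` positive.
  refine ⟨N + 1, Nat.succ_pos N, y, ⟨hyJ, hyC⟩, ?_⟩
  have h1 : ‖c - y‖ ≤ ε / 2 :=
    (pow_le_pow_iff_left₀ (norm_nonneg _) (by positivity) two_ne_zero).1 (hy.trans hδ3)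
  calc ‖x - y‖ = ‖(c - y) - (c - x)‖ := by congr 1; abel
    _ ≤ ‖c - y‖ + ‖c - x‖ := norm_sub_le _ _
    _ ≤ ε / 2 + ε / 2 := add_le_add h1 (hcx.trans hδ2)
    _ = ε := add_halves ε

end IsIdeal

/-! ### The coefficient ideals -/

variable (Z J) in
/-- The coefficient ideal at `v` of the part of `J` carried by the paths of length `k`. -/
def coeffIdeal (k : ℕ) (v : V) : Set G.QuotAlg :=
  {y | (y ∈ Z.coeffAlg ∧ G.pv v * y = y) ∧
    ∀ μ : G.Path k, μ.source = v → uPath μ * y * star (uPath μ) ∈ J}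

variable (Z) in
/-- The elements of `p_v R`, `R` the coefficient algebra, that are mapped into a given family of
sets by the compressions with the edges of range `v`. -/
def edgePreimage (X : V → Set G.QuotAlg) (v : V) : Set G.QuotAlg :=
  {y | (y ∈ Z.coeffAlg ∧ G.pv v * y = y) ∧
    ∀ g, G.r g = v → star (G.u g) * y * G.u g ∈ X (G.s g)}

lemma zero_mem_coeffIdeal (k : ℕ) (v : V) : (0 : G.QuotAlg) ∈ Z.coeffIdeal J k v :=
  ⟨⟨zero_mem _, mul_zero _⟩, fun μ _ => by simp⟩

lemma star_uPath_mul_uPath_mul {k : ℕ} (μ : G.Path k) {y : G.QuotAlg} (hy : y ∈ Z.coeffAlg)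
    (hv : G.pv μ.source * y = y) :
    star (uPath μ) * (uPath μ * y * star (uPath μ)) * uPath μ = y := by
  have : star (uPath μ) * (uPath μ * y * star (uPath μ)) * uPath μ =
      (star (uPath μ) * uPath μ) * y * (star (uPath μ) * uPath μ) := by noncomm_ring
  rw [this, star_uPath_mul_self, hv, mul_pv_of_mem_coeffAlg hy, hv]

section

variable (hJ : Z.IsIdeal J) (hG : G.NoSinks)
include hJ hG

/-- The matrix units `u_α u_μ^*` lie in `q(𝓓)` and move the entry at `(μ, μ)` to any `(α, β)`; one
path of source `v` therefore decides for all. -/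
lemma uPath_mul_mul_star_uPath_mem {k : ℕ} {v : V} {y : G.QuotAlg} (hv : G.pv v * y = y)
    (hy : y ∈ Z.coeffAlg) {μ : G.Path k} (hμ : μ.source = v)
    (h : uPath μ * y * star (uPath μ) ∈ J) (α β : G.Path k) :
    uPath α * y * star (uPath β) ∈ J := by
  have h1 : (uPath α * star (uPath μ)) * (uPath μ * y * star (uPath μ)) *
      (uPath μ * star (uPath β)) =
      uPath α * (star (uPath μ) * (uPath μ * y * star (uPath μ)) * uPath μ) * star (uPath β) := by
    noncomm_ring
  rw [star_uPath_mul_uPath_mul μ hy (by rw [hμ, hv])] at h1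
  rw [← h1]
  exact hJ.mul_mul_mem (uPath_mul_star_uPath_mem_qD hG _ _) h (uPath_mul_star_uPath_mem_qD hG _ _)

lemma mem_coeffIdeal_of {k : ℕ} {v : V} {y : G.QuotAlg} (hy : y ∈ Z.coeffAlg)
    (hv : G.pv v * y = y) {μ : G.Path k} (hμ : μ.source = v)
    (h : uPath μ * y * star (uPath μ) ∈ J) : y ∈ Z.coeffIdeal J k v :=
  ⟨⟨hy, hv⟩, fun α _ => uPath_mul_mul_star_uPath_mem hJ hG hv hy hμ h α α⟩

lemma uPath_mul_coeffIdeal_mem {k : ℕ} {v : V} {y : G.QuotAlg} (hy : y ∈ Z.coeffIdeal J k v)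
    {α β : G.Path k} (hα : α.source = v) : uPath α * y * star (uPath β) ∈ J :=
  uPath_mul_mul_star_uPath_mem hJ hG hy.1.2 hy.1.1 hα (hy.2 α hα) α β

lemma star_uPath_mul_mem_coeffIdeal {k : ℕ} {x : G.QuotAlg} (hx : x ∈ J) (hxM : x ∈ Z.matAlg k)
    (μ ν : G.Path k) : star (uPath μ) * x * uPath ν ∈ Z.coeffIdeal J k μ.source := by
  refine mem_coeffIdeal_of hJ hG (star_uPath_mul_mem_coeffAlg hxM μ ν) ?_ (μ := μ) rfl ?_
  · rw [← mul_assoc, ← mul_assoc, pv_mul_star_uPath]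
  · have : uPath μ * (star (uPath μ) * x * uPath ν) * star (uPath μ) =
      (uPath μ * star (uPath μ)) * x * (uPath ν * star (uPath μ)) := by noncomm_ring
    rw [this]
    exact hJ.mul_mul_mem (uPath_mul_star_uPath_mem_qD hG _ _) hx (uPath_mul_star_uPath_mem_qD hG _ _)

/-- With `star_uPath_mul_mem_coeffIdeal`, this shows that the part of `J` in `matAlg k` is
determined by the coefficient ideals at length `k`. -/
lemma mem_of_forall_mem_coeffIdeal {k : ℕ} {x : G.QuotAlg}
    (h : ∀ μ ν : G.Path k, star (uPath μ) * x * uPath ν ∈ Z.coeffIdeal J k μ.source) : x ∈ J := by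
  rw [eq_sum_uPath k k x]
  exact sum_mem fun μ _ => sum_mem fun ν _ => uPath_mul_coeffIdeal_mem hJ hG (h μ ν) rfl

omit hJ hG in
lemma mem_coeffIdeal_zero {v : V} {y : G.QuotAlg} :
    y ∈ Z.coeffIdeal J 0 v ↔ (y ∈ Z.coeffAlg ∧ G.pv v * y = y) ∧ y ∈ J := by
  have h1 : uPath (Path.ofVertex v : G.Path 0) = G.pv v := uPath_zero _
  refine and_congr_right fun hy => ⟨fun h => ?_, fun h μ hμ => ?_⟩
  · have := h (Path.ofVertex v) rfl
    rwa [h1, star_pv, hy.2, mul_pv_of_mem_coeffAlg hy.1, hy.2] at this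
  · rwa [uPath_zero, hμ, star_pv, hy.2, mul_pv_of_mem_coeffAlg hy.1, hy.2]

lemma star_uPath_mul_mem_of_fullyInvariant (hF : Z.FullyInvariant J) {k : ℕ} (α β : G.Path k)
    {x : G.QuotAlg} (hx : x ∈ J) : star (uPath α) * x * uPath β ∈ J := by
  induction k generalizing x with
  | zero =>
    rw [uPath_zero, uPath_zero, star_pv]
    exact hJ.mul_mul_mem (pv_mem_qD hG _) hx (pv_mem_qD hG _)
  | succ k ih =>
    have : star (uPath α) * x * uPath β = star (uPath α.tail) *
        (star (G.u α.head) * x * G.u β.head) * uPath β.tail := by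
      rw [uPath_succ, uPath_succ, star_mul]; noncomm_ring
    rw [this]
    exact ih _ _ (((hJ.fullyInvariant_iff).1 hF _ _ _ hx).1)

lemma uPath_mul_mem_of_fullyInvariant (hF : Z.FullyInvariant J) {k : ℕ} (α β : G.Path k)
    {x : G.QuotAlg} (hx : x ∈ J) : uPath α * x * star (uPath β) ∈ J := by
  induction k with
  | zero =>
    rw [uPath_zero, uPath_zero, star_pv]
    exact hJ.mul_mul_mem (pv_mem_qD hG _) hx (pv_mem_qD hG _)
  | succ k ih =>
    have : uPath α * x * star (uPath β) =
        G.u α.head * (uPath α.tail * x * star (uPath β.tail)) * star (G.u β.head) := by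
      rw [uPath_succ, uPath_succ, star_mul]; noncomm_ring
    rw [this]
    exact ((hJ.fullyInvariant_iff).1 hF _ _ _ (ih _ _)).2

/-- The coefficient ideals of a fully invariant ideal. -/
lemma coeffIdeal_eq_of_fullyInvariant (hF : Z.FullyInvariant J) (k : ℕ) :
    Z.coeffIdeal J k = Z.coeffIdeal J 0 := by
  ext v y
  rw [mem_coeffIdeal_zero]
  refine and_congr_right fun hy =>
    ⟨fun h => ?_, fun h μ _ => uPath_mul_mem_of_fullyInvariant hJ hG hF μ μ h⟩
  obtain ⟨μ, hμ⟩ := Path.exists_source_eq hG k v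
  rw [← star_uPath_mul_uPath_mul μ hy.1 (by rw [hμ, hy.2])]
  exact star_uPath_mul_mem_of_fullyInvariant hJ hG hF μ μ (h μ hμ)

variable {p : ℕ} (hp : 1 ≤ p) (hA : Z.ConditionA p)
include hp hA

/-- Since `y` is diagonal along edges, `u_μ y u_μ^* = ∑_g u_{μg} (u_g^* y u_g) u_{μg}^*`. Each
summand is cut out by the projection `u_{μg} u_{μg}^*` of `q(𝓓)`, so the sum lies in `J` exactly
when every summand does. No invariance of `J` enters. -/
lemma coeffIdeal_eq_edgePreimage (k : ℕ) :
    Z.coeffIdeal J k = Z.edgePreimage (Z.coeffIdeal J (k + 1)) := by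
  ext v y
  refine and_congr_right fun hy => ⟨fun h g hg => ?_, fun h μ hμ => ?_⟩
  · obtain ⟨μ, hμ⟩ := Path.exists_source_eq hG k v
    refine mem_coeffIdeal_of hJ hG (conj_mem_coeffAlg hp hA hy.1 g g).1 ?_
      (μ := μ.snoc g (hμ.trans hg.symm)) rfl ?_
    · rw [← mul_assoc, ← mul_assoc, pv_mul_star_u]
    · rw [uPath_snoc, star_mul]
      have h1 : uPath μ * G.u g * (star (G.u g) * y * G.u g) * (star (G.u g) * star (uPath μ)) =
          (uPath μ * (G.u g * star (G.u g)) * star (uPath μ)) * (uPath μ * y * star (uPath μ)) *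
            (uPath μ * (G.u g * star (G.u g)) * star (uPath μ)) := by
        have h2 : (uPath μ * (G.u g * star (G.u g)) * star (uPath μ)) *
            (uPath μ * y * star (uPath μ)) * (uPath μ * (G.u g * star (G.u g)) * star (uPath μ)) =
            uPath μ * (G.u g * star (G.u g)) *
              (star (uPath μ) * (uPath μ * y * star (uPath μ)) * uPath μ) *
              (G.u g * star (G.u g)) * star (uPath μ) := by noncomm_ring
        rw [h2, star_uPath_mul_uPath_mul μ hy.1 (by rw [hμ, hy.2])]
        noncomm_ring
      have h3 : uPath μ * (G.u g * star (G.u g)) * star (uPath μ) ∈ Z.qD := by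
        refine uPath_mul_mul_star_uPath_mem_qD hG ?_ _ _
        simpa using u_mul_mul_star_u_mem_qD (one_mem_qD hG) g g
      rw [h1]
      exact hJ.mul_mul_mem h3 (h μ hμ) h3
  · have h1 : uPath μ * y * star (uPath μ) = ∑ g,
        (uPath μ * G.u g) * (star (G.u g) * y * G.u g) * star (uPath μ * G.u g) := by
      have h2 : y = ∑ g, G.u g * (star (G.u g) * y * G.u g) * star (G.u g) := by
        conv_lhs => rw [← mul_one y, ← sum_u_mul_star_u, Finset.mul_sum]
        refine Finset.sum_congr rfl fun g _ => ?_
        rw [← mul_u_of_mem_coeffAlg hp hA hy.1, mul_assoc]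
      conv_lhs => rw [h2, Finset.mul_sum, Finset.sum_mul]
      refine Finset.sum_congr rfl fun g _ => ?_
      rw [star_mul]
      noncomm_ring
    rw [h1]
    refine sum_mem fun g _ => ?_
    by_cases hg : μ.source = G.r g
    · rw [← uPath_snoc μ g hg]
      exact (h g (hg.symm.trans hμ)).2 _ rfl
    · rw [← uPath_mul_pv μ, mul_assoc (uPath μ), pv_mul_u_of_ne hg]
      simp

lemma coeffIdeal_eq_iterate (k m : ℕ) :
    Z.coeffIdeal J k = Z.edgePreimage^[m] (Z.coeffIdeal J (k + m)) := by
  induction m with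
  | zero => rfl
  | succ m ih =>
    rw [ih, coeffIdeal_eq_edgePreimage hJ hG hp hA (k + m), Function.iterate_succ_apply]
    rfl

/-- The elements `u_{μ₁}^* x u_{μ₂}` run through exactly the coefficient ideal at length `np + p -
1`; in particular the choice of `μ₁, μ₂` is immaterial. -/
lemma corner_eq_image {ξ : V → G.Path (p - 1)} (n : ℕ) (v : V) :
    Z.corner p J ξ n v = (fun y => uPath (ξ v) * y * star (uPath (ξ v))) ''
      Z.coeffIdeal J (n * p + (p - 1)) v := by
  ext y
  constructor
  · rintro ⟨μ₁, μ₂, h1, -, x, ⟨hxJ, hxC⟩, rfl⟩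
    rw [C_eq_matAlg hp hA] at hxC
    refine ⟨_, h1 ▸ star_uPath_mul_mem_coeffIdeal hJ hG hxJ hxC μ₁ μ₂, ?_⟩
    simp only [mul_assoc]
  · rintro ⟨x, hx, rfl⟩
    obtain ⟨μ, hμ⟩ := Path.exists_source_eq hG (n * p + (p - 1)) v
    refine ⟨μ, μ, hμ, hμ, uPath μ * x * star (uPath μ), ⟨hx.2 μ hμ, ?_⟩, ?_⟩
    · rw [C_eq_matAlg hp hA]
      exact uPath_mul_mem_matAlg hp hA hx.1.1 μ μ
    · have : ∀ a b c : G.QuotAlg, a * star (uPath μ) * b * uPath μ * c =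
        a * (star (uPath μ) * b * uPath μ) * c := fun a b c => by noncomm_ring
      rw [this, star_uPath_mul_uPath_mul μ hx.1.1 (by rw [hμ, hx.1.2])]

/-- Conjugation by `u_{ξ_v}` is injective on `p_v R`, `R` the coefficient algebra, so equality of
corners is equality of coefficient ideals; `n = 0` is the length `p - 1`. -/
lemma corner_eq_corner_iff {ξ : V → G.Path (p - 1)} (hξ : ∀ v, (ξ v).source = v) :
    (∀ (v : V) (n : ℕ), Z.corner p J ξ 0 v = Z.corner p J ξ n v) ↔
      ∀ n, Z.coeffIdeal J (n * p + (p - 1)) = Z.coeffIdeal J (p - 1) := by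
  have hmem : ∀ n v y, y ∈ Z.coeffIdeal J (n * p + (p - 1)) v ↔
      (y ∈ Z.coeffAlg ∧ G.pv v * y = y) ∧
        uPath (ξ v) * y * star (uPath (ξ v)) ∈ Z.corner p J ξ n v := by
    intro n v y
    rw [corner_eq_image hJ hG hp hA]
    refine ⟨fun h => ⟨h.1, y, h, rfl⟩, ?_⟩
    rintro ⟨hy, y', hy', h⟩
    have h1 := star_uPath_mul_uPath_mul (ξ v) hy.1 (by rw [hξ, hy.2])
    have h2 := star_uPath_mul_uPath_mul (ξ v) hy'.1.1 (by rw [hξ, hy'.1.2])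
    have : y' = y := by rw [← h1, ← h2]; exact congrArg (fun a => star _ * a * _) h
    exact this ▸ hy'
  constructor
  · intro h n
    ext v y
    have h0 := hmem 0 v y
    rw [zero_mul, zero_add] at h0
    rw [hmem, h0, h v n]
  · intro h v n
    rw [corner_eq_image hJ hG hp hA, corner_eq_image hJ hG hp hA, h, h]

-- The coefficients of `uₑ^* y u_f` at `μ, ν` are those of `y` at `eμ, fν`, one edge longer;
-- constancy of the coefficient ideals absorbs the shift in length.
omit hp hA in
lemma star_u_mul_mem_of_coeffIdeal_eq (h : ∀ k, Z.coeffIdeal J k = Z.coeffIdeal J 0) {k : ℕ}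
    {y : G.QuotAlg} (hyJ : y ∈ J) (hy : y ∈ Z.matAlg (k + 1)) (e f : Ed) :
    star (G.u e) * y * G.u f ∈ J := by
  refine mem_of_forall_mem_coeffIdeal (k := k) hJ hG fun μ ν => ?_
  have h1 : star (uPath μ) * (star (G.u e) * y * G.u f) * uPath ν =
      star (G.u e * uPath μ) * y * (G.u f * uPath ν) := by
    rw [star_mul]
    simp only [mul_assoc]
  rw [h1]
  by_cases he : G.s e = μ.range
  · by_cases hf : G.s f = ν.range
    · rw [← uPath_cons e μ he, ← uPath_cons f ν hf, h k, ← h (k + 1)]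
      exact star_uPath_mul_mem_coeffIdeal hJ hG hyJ hy (μ.cons e he) (ν.cons f hf)
    · rw [u_mul_uPath_of_ne hf, mul_zero]
      exact zero_mem_coeffIdeal _ _
  · rw [u_mul_uPath_of_ne he, star_zero, zero_mul, zero_mul]
    exact zero_mem_coeffIdeal _ _

-- Here the length goes up by one: a coefficient of `uₑ y u_f^*` at `μ, ν` is zero unless the paths
-- start with `e` and `f`, and is then the coefficient of `y` at their tails.
omit hp hA in
lemma u_mul_mem_of_coeffIdeal_eq (h : ∀ k, Z.coeffIdeal J k = Z.coeffIdeal J 0) {k : ℕ}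
    {y : G.QuotAlg} (hyJ : y ∈ J) (hy : y ∈ Z.matAlg k) (e f : Ed) :
    G.u e * y * star (G.u f) ∈ J := by
  refine mem_of_forall_mem_coeffIdeal (k := k + 1) hJ hG fun μ ν => ?_
  have h1 : star (uPath μ) * (G.u e * y * star (G.u f)) * uPath ν =
      star (uPath μ.tail) * (star (G.u μ.head) * G.u e) * y *
        ((star (G.u f) * G.u ν.head) * uPath ν.tail) := by
    rw [uPath_succ μ, uPath_succ ν, star_mul]
    simp only [mul_assoc]
  rw [h1]
  by_cases he : μ.head = e
  · by_cases hf : f = ν.head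
    · have h2 : star (uPath μ.tail) * G.pv μ.tail.range = star (uPath μ.tail) := by
        have := congrArg star (pv_mul_uPath μ.tail)
        rwa [star_mul, star_pv] at this
      rw [hf, ← he, star_u_mul_u_self, star_u_mul_u_self, Path.s_head, Path.s_head,
        pv_mul_uPath, h2, h (k + 1), ← h k]
      exact star_uPath_mul_mem_coeffIdeal hJ hG hyJ hy μ.tail ν.tail
    · rw [star_u_mul_u_of_ne hf, zero_mul, mul_zero]
      exact zero_mem_coeffIdeal _ _
  · rw [star_u_mul_u_of_ne he, mul_zero, zero_mul, zero_mul]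
    exact zero_mem_coeffIdeal _ _

/-- Constant coefficient ideals give full invariance. -/
lemma fullyInvariant_of_coeffIdeal_eq (h : ∀ k, Z.coeffIdeal J k = Z.coeffIdeal J 0) :
    Z.FullyInvariant J := by
  rw [hJ.fullyInvariant_iff]
  intro e f x hx
  have hcl : IsClosed {x | star (G.u e) * x * G.u f ∈ J ∧ G.u e * x * star (G.u f) ∈ J} := by
    have h1 : Continuous fun x => star (G.u e) * x * G.u f := by fun_prop
    have h2 : Continuous fun x => G.u e * x * star (G.u f) := by fun_prop
    exact (hJ.isClosed.preimage h1).inter (hJ.isClosed.preimage h2)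
  have hdense : x ∈ closure {y | ∃ n, 1 ≤ n ∧ y ∈ Z.restrict p J n} := by
    refine Metric.mem_closure_iff.2 fun ε hε => ?_
    obtain ⟨n, hn, y, hy, hxy⟩ := hJ.exists_mem_restrict_norm_sub_le hG hp hA hx (half_pos hε)
    exact ⟨y, ⟨n, hn, hy⟩, by rw [dist_eq_norm]; exact hxy.trans_lt (half_lt_self hε)⟩
  refine hcl.closure_subset_iff.2 ?_ hdense
  rintro y ⟨n, hn, hyJ, hyC⟩
  rw [C_eq_matAlg hp hA] at hyC
  refine ⟨?_, u_mul_mem_of_coeffIdeal_eq hJ hG h hyJ hyC e f⟩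
  -- Removing an edge requires positive length, which `n ≥ 1` provides even for `p = 1`.
  obtain ⟨k, hk⟩ : ∃ k, n * p + (p - 1) = k + 1 :=
    ⟨n * p + (p - 1) - 1, by have := Nat.mul_pos hn hp; omega⟩
  rw [hk] at hyC
  exact star_u_mul_mem_of_coeffIdeal_eq hJ hG h hyJ hyC e f

/-- With `I_k` the coefficient ideals and `Ψ` the edge preimage, `Ψ(I_0) = Ψ^p(I_{p-1}) =
Ψ^p(I_{2p-1}) = I_{p-1}`, where the middle equality is the hypothesis at `n = 1`. -/
lemma edgePreimage_coeffIdeal_zero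
    (h1 : ∀ n, Z.coeffIdeal J (n * p + (p - 1)) = Z.coeffIdeal J (p - 1)) :
    Z.edgePreimage (Z.coeffIdeal J 0) = Z.coeffIdeal J (p - 1) := by
  have hiter := coeffIdeal_eq_iterate (Z := Z) hJ hG hp hA
  have h2 : 1 * p + (p - 1) = p - 1 + (p - 1 + 1) := by omega
  calc Z.edgePreimage (Z.coeffIdeal J 0)
      = Z.edgePreimage^[p - 1 + 1] (Z.coeffIdeal J (p - 1)) := by
        rw [Function.iterate_succ_apply', hiter 0 (p - 1), zero_add]
    _ = Z.edgePreimage^[p - 1 + 1] (Z.coeffIdeal J (p - 1 + (p - 1 + 1))) := by rw [← h2, h1]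
    _ = Z.coeffIdeal J (p - 1) := (hiter _ _).symm

/-- The two hypotheses make the ideal at length `0` a fixed point of `edgePreimage`. The ideal at
length `k` is an iterated edge preimage of the one at the longer length `kp + p - 1`, which is this
fixed point. -/
lemma coeffIdeal_eq_of_eq (h1 : ∀ n, Z.coeffIdeal J (n * p + (p - 1)) = Z.coeffIdeal J (p - 1))
    (h0 : Z.coeffIdeal J 0 = Z.coeffIdeal J (p - 1)) (k : ℕ) :
    Z.coeffIdeal J k = Z.coeffIdeal J 0 := by
  have hiter := coeffIdeal_eq_iterate (Z := Z) hJ hG hp hA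
  have hfix : Z.edgePreimage (Z.coeffIdeal J 0) = Z.coeffIdeal J 0 := by
    rw [edgePreimage_coeffIdeal_zero hJ hG hp hA h1, h0]
  have hk : k ≤ k * p + (p - 1) := (Nat.le_mul_of_pos_right _ hp).trans (Nat.le_add_right _ _)
  rw [hiter k (k * p + (p - 1) - k), Nat.add_sub_cancel' hk, h1, ← h0, Function.iterate_fixed hfix]

/-- The two families of conditions that force the coefficient ideals at the lengths `0` and `p - 1`
to agree characterize full invariance. -/
lemma fullyInvariant_iff_of_coeffIdeal {ξ : V → G.Path (p - 1)} (hξ : ∀ v, (ξ v).source = v)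
    {R : Prop} (hR : Z.FullyInvariant J → R)
    (hR' : (∀ n, Z.coeffIdeal J (n * p + (p - 1)) = Z.coeffIdeal J (p - 1)) → R →
      Z.coeffIdeal J 0 = Z.coeffIdeal J (p - 1)) :
    Z.FullyInvariant J ↔
      (∀ (v : V) (n : ℕ), Z.corner p J ξ 0 v = Z.corner p J ξ n v) ∧ R := by
  rw [corner_eq_corner_iff hJ hG hp hA hξ]
  refine ⟨fun hF => ⟨fun n => ?_, hR hF⟩, fun ⟨h1, h2⟩ => ?_⟩
  · rw [coeffIdeal_eq_of_fullyInvariant hJ hG hF, coeffIdeal_eq_of_fullyInvariant hJ hG hF (p - 1)]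
  · exact fullyInvariant_of_coeffIdeal_eq hJ hG hp hA
      (coeffIdeal_eq_of_eq hJ hG hp hA h1 (hR' h1 h2))

/-- One edge compression puts the ideal at length `0` inside its own edge preimage, which is the
ideal at length `p - 1`. For the reverse inclusion, `p - 1` edge compressions recover `y` from `u_μ
y u_μ^*`. -/
lemma coeffIdeal_zero_eq_of_edge
    (h1 : ∀ n, Z.coeffIdeal J (n * p + (p - 1)) = Z.coeffIdeal J (p - 1))
    (h2 : ∀ e f : Ed, ∀ x ∈ Z.restrict p J 0, star (G.u e) * x * G.u f ∈ Z.restrict p J 0) :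
    Z.coeffIdeal J 0 = Z.coeffIdeal J (p - 1) := by
  have hmat : Z.C p 0 = Z.matAlg (p - 1) := by rw [C_eq_matAlg hp hA, zero_mul, zero_add]
  have hcoeff : ∀ {y}, y ∈ Z.coeffAlg → y ∈ Z.C p 0 := fun hy => by
    rw [hmat]; exact coeffAlg_le_matAlg hp hA _ hy
  have hpath : ∀ (k : ℕ) (α β : G.Path k), ∀ x ∈ Z.restrict p J 0,
      star (uPath α) * x * uPath β ∈ Z.restrict p J 0 := by
    intro k
    induction k with
    | zero =>
      rintro α β x ⟨hx, hxC⟩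
      rw [uPath_zero, uPath_zero, star_pv]
      exact ⟨hJ.mul_mul_mem (pv_mem_qD hG _) hx (pv_mem_qD hG _),
        mul_mem (mul_mem (hcoeff (Z.pv_mem _)) hxC) (hcoeff (Z.pv_mem _))⟩
    | succ k ih =>
      intro α β x hx
      have : star (uPath α) * x * uPath β = star (uPath α.tail) *
          (star (G.u α.head) * x * G.u β.head) * uPath β.tail := by
        rw [uPath_succ, uPath_succ, star_mul]; noncomm_ring
      rw [this]
      exact ih _ _ _ (h2 _ _ _ hx)
  have hle : ∀ v, Z.coeffIdeal J 0 v ⊆ Z.edgePreimage (Z.coeffIdeal J 0) v := by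
    intro v y hy
    refine ⟨hy.1, fun g _ => ?_⟩
    rw [mem_coeffIdeal_zero] at hy ⊢
    exact ⟨⟨(conj_mem_coeffAlg hp hA hy.1.1 g g).1, by rw [← mul_assoc, ← mul_assoc, pv_mul_star_u]⟩,
      (h2 g g y ⟨hy.2, hcoeff hy.1.1⟩).1⟩
  have hedge := edgePreimage_coeffIdeal_zero hJ hG hp hA h1
  funext v
  refine Set.Subset.antisymm (fun y hy => hedge ▸ hle v hy) fun y hy => ?_
  rw [mem_coeffIdeal_zero]
  obtain ⟨μ, hμ⟩ := Path.exists_source_eq hG (p - 1) v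
  refine ⟨hy.1, ?_⟩
  rw [← star_uPath_mul_uPath_mul μ hy.1.1 (by rw [hμ, hy.1.2])]
  refine (hpath _ μ μ _ ⟨hy.2 μ hμ, ?_⟩).1
  rw [hmat]
  exact uPath_mul_mem_matAlg hp hA hy.1.1 μ μ

-- Passing from length `0` to length `p - 1` is conjugation by `u_μ` (`h3`), and the way back is
-- compression by `u_μ` (`h2`).
omit hJ in
lemma coeffIdeal_zero_eq_of_path
    (h2 : ∀ α β : G.Path (p - 1), ∀ x ∈ Z.restrict p J 0,
      star (uPath α) * x * uPath β ∈ Z.restrict p J 0)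
    (h3 : ∀ (k : ℕ) (α β : G.Path k), ∀ x ∈ Z.restrict p J 0,
      uPath α * x * star (uPath β) ∈ J) :
    Z.coeffIdeal J 0 = Z.coeffIdeal J (p - 1) := by
  have hmat : Z.C p 0 = Z.matAlg (p - 1) := by rw [C_eq_matAlg hp hA, zero_mul, zero_add]
  ext v y
  rw [mem_coeffIdeal_zero]
  refine and_congr_right fun hy => ⟨fun h μ _ => h3 _ μ μ y ⟨h, ?_⟩, fun h => ?_⟩
  · rw [hmat]
    exact coeffAlg_le_matAlg hp hA _ hy.1
  · obtain ⟨μ, hμ⟩ := Path.exists_source_eq hG (p - 1) v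
    rw [← star_uPath_mul_uPath_mul μ hy.1 (by rw [hμ, hy.2])]
    refine (h2 μ μ _ ⟨h μ hμ, ?_⟩).1
    rw [hmat]
    exact uPath_mul_mem_matAlg hp hA hy.1 μ μ

end

end WeightSequence

end DirGraph

end

/-! ### The theorem: both characterizations of full invariance. -/

theorem mainTheorem5 {V Ed : Type*} [Fintype V] [Fintype Ed] (G : DirGraph V Ed)
    (hsinks : G.NoSinks) (hsources : G.NoSources)
    (Z : G.WeightSequence) (p : ℕ) (hp : 1 ≤ p) (hA : Z.ConditionA p)
    (ξ : V → G.Path (p - 1)) (hξ : ∀ v, (ξ v).source = v)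
    (J : Submodule ℂ G.QuotAlg) (hJ : Z.IsIdeal J) :
    (Z.FullyInvariant J ↔
      (∀ (v : V) (n : ℕ), Z.corner p J ξ 0 v = Z.corner p J ξ n v) ∧
      (∀ α β : G.Path (p - 1), ∀ x ∈ Z.restrict p J 0,
        star (DirGraph.uPath α) * x * DirGraph.uPath β ∈ Z.restrict p J 0) ∧
      (∀ (k : ℕ) (α β : G.Path k), ∀ x ∈ Z.restrict p J 0,
        DirGraph.uPath α * x * star (DirGraph.uPath β) ∈ J)) ∧
    (Z.FullyInvariant J ↔
      (∀ (v : V) (n : ℕ), Z.corner p J ξ 0 v = Z.corner p J ξ n v) ∧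
      (∀ e f : Ed, ∀ x ∈ Z.restrict p J 0,
        star (G.u e) * x * G.u f ∈ Z.restrict p J 0)) := by
  have hmat : Z.C p 0 = Z.matAlg (p - 1) := by
    rw [DirGraph.WeightSequence.C_eq_matAlg hp hA, zero_mul, zero_add]
  refine ⟨DirGraph.WeightSequence.fullyInvariant_iff_of_coeffIdeal hJ hsinks hp hA hξ
      (fun hF => ⟨fun α β x hx => ⟨?_, ?_⟩, fun k α β x hx => ?_⟩)
      fun _ h => DirGraph.WeightSequence.coeffIdeal_zero_eq_of_path hsinks hp hA h.1 h.2,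
    DirGraph.WeightSequence.fullyInvariant_iff_of_coeffIdeal hJ hsinks hp hA hξ
      (fun hF e f x hx => ⟨?_, ?_⟩)
      (DirGraph.WeightSequence.coeffIdeal_zero_eq_of_edge hJ hsinks hp hA)⟩
  · exact DirGraph.WeightSequence.star_uPath_mul_mem_of_fullyInvariant hJ hsinks hF α β hx.1
  · have hxC := hx.2
    rw [hmat] at hxC ⊢
    exact DirGraph.WeightSequence.coeffAlg_le_matAlg hp hA _
      (DirGraph.WeightSequence.star_uPath_mul_mem_coeffAlg hxC α β)
  · exact DirGraph.WeightSequence.uPath_mul_mem_of_fullyInvariant hJ hsinks hF α β hx.1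
  · exact ((hJ.fullyInvariant_iff).1 hF e f x hx.1).1
  · have hxC := hx.2
    rw [hmat] at hxC ⊢
    exact DirGraph.WeightSequence.matAlg_le_succ hp hA _ hxC e f
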